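/- All manifolds are smooth and finite-dimensional, and all maps, bundles and forms are smooth. **Setting.** Let $\mathcal G\rightrightarrows M$ be a Lie groupoid with source $s$, target $t$, units $1_x$ and multiplication $m$ ($s,t$ submersions, $gh$ defined when $s(g)=t(h)$). Its Lie algebroid $A$ has fibres $A_x=\ker(ds)\subset T_{1_x}\mathcal G$, anchor $\rho=dt$, and bracket $[\alpha,\beta]=[\alpha^r,\beta^r]|_M$, where $\alpha^r_g=dR_g(\alpha_{t(g)})$. If $E\to M$ is a representation of $\mathcal G$, a form $\theta\in\Omega^1(\mathcal G,t^*E)$ is *multiplicative* if $(m^*\theta)_{(g,h)}=pr_1^*\theta+g\cdot pr_2^*\theta$ on composable pairs. The pair $(\mathcal G,\theta)$ is a *Pfaffian groupoid* if $\theta$ is multiplicative and pointwise surjective, $\mathcal H=\ker\theta$ satisfies $T\mathcal G=\mathcal H+\ker ds$, and $\mathcal H^s=\mathcal H\cap\ker ds$ is involutive. For $X,Y\in\mathcal H_g$ put $\delta\theta(X,Y)=\theta_g([U,V])$, where $U,V$ are local sections of $\mathcal H$ extending $X,Y$. Put $l=\theta|_A:A\to E$, and let the Spencer operator of $\theta$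 be $$D_X\alpha(x)=\theta_{1_x}([\tilde X,\alpha^r]),\qquad X\in T_xM,\ \alpha\in\Gamma(A),$$ where $\tilde X$ is any local section of $\mathcal H$ extending $du(X)$, $u(x)=1_x$. Let $\tfrac12\{\alpha,\beta\}_D=D_{\rho(\alpha)}\beta-D_{\rho(\beta)}\alpha-l[\alpha,\beta]$, which is a tensor on $A$ with values in $E$. A *Lie prolongation* of a Pfaffian groupoid $(\mathcal G,\theta)$ is a Pfaffian groupoid $(\tilde{\mathcal G},\tilde\theta)$ over $M$, $\tilde\theta\in\Omega^1(\tilde{\mathcal G},t^*\tilde E)$, with a groupoid morphism $p:\tilde{\mathcal G}\to\mathcal G$ over $\mathrm{id}_M$ that is a surjective submersion and satisfies, for $\tilde{\mathcal H}=\ker\tilde\theta$, $\tilde l=\tilde\theta|_{\tilde A}$ and $\tilde{\mathcal H}^s=\tilde{\mathcal H}\cap\ker ds$: (i) $dp(\tilde{\mathcal H})\subset\mathcal H$; (ii) $p_0(\delta\tilde\theta(X,Y))=\delta\theta(dp\,X,dp\,Y)$ for $X,Y\in\tilde{\mathcal H}$, where $p_0:\tilde E\to E$ is the map determined by $p_0\circ\tilde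 l=l\circ \mathrm{Lie}(p)$; (iii) $dp(\tilde{\mathcal H}^s)=0$; (iv) $\delta\theta(dp\,X,dp\,Y)=0$ for $X,Y\in\tilde{\mathcal H}$; (v) the map $L:\tilde E\to A$ determined by $L\circ\tilde l=\mathrm{Lie}(p)$ is an isomorphism of vector bundles. **Theorem.** Let $(\mathcal G,\theta)$, $\theta\in\Omega^1(\mathcal G,t^*E)$, be a Pfaffian groupoid over $M$ with Spencer operator $(D,l)$. Let $p:\tilde{\mathcal G}\to\mathcal G$ be a morphism of Lie groupoids over $\mathrm{id}_M$ which is a surjective submersion, and let $\tilde\theta\in\Omega^1(\tilde{\mathcal G},t^*A)$ be multiplicative with respect to some representation of $\tilde{\mathcal G}$ on $A=\mathrm{Lie}(\mathcal G)$, with $\mathrm{Lie}(p)=\tilde\theta|_{\tilde A}$ (that is, the map $L$ in (v) is the identity). Define $$d_D\tilde\theta(X,Y)=D^t_X(\tilde\theta(Y))-D^t_Y(\tilde\theta(X))-l(\tilde\theta([X,Y])),\qquad \tfrac12\{\tilde\theta,\tilde\theta\}_D(X,Y)=\tfrac12\{\tilde\theta(X),\tilde\theta(Y)\}_D$$ for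 vector fields $X,Y$ on $\tilde{\mathcal G}$, where $D^t$ is the pull-back of $D$ along $t:\tilde{\mathcal G}\to M$, determined by $D^t_X(t^*\alpha)=D_{dt(X)}\alpha$ and $D^t_X(f\sigma)=fD^t_X\sigma+X(f)\,l(\sigma)$. 1. If $p:(\tilde{\mathcal G},\tilde\theta)\to(\mathcal G,\theta)$ is a Lie prolongation of $(\mathcal G,\theta)$, then the Maurer–Cartan equation $$d_D\tilde\theta-\tfrac12\{\tilde\theta,\tilde\theta\}_D=0$$ holds. 2. Conversely, if the Maurer–Cartan equation holds and $\tilde{\mathcal G}$ is source-connected (the fibres of $s:\tilde{\mathcal G}\to M$ are connected), then $p:(\tilde{\mathcal G},\tilde\theta)\to(\mathcal G,\theta)$ is a Lie prolongation of $(\mathcal G,\theta)$; in particular $(\tilde{\mathcal G},\tilde\theta)$ is a Pfaffian groupoid. -/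

import Mathlib

open Bundle Manifold Set
open scoped ContDiff Topology

section Submersion

variable {EP P EN N : Type*} [NormedAddCommGroup EP] [NormedSpace ℝ EP]
  [TopologicalSpace P] [ChartedSpace EP P]
  [NormedAddCommGroup EN] [NormedSpace ℝ EN]
  [TopologicalSpace N] [ChartedSpace EN N]

/-- The differential of a submersion is surjective. -/
theorem surjective_mfderiv_of_isSubmersion {f : P → N} (hf : IsSubmersion 𝓘(ℝ, EP) 𝓘(ℝ, EN) ∞ f)
    (x : P) : Function.Surjective (mfderiv 𝓘(ℝ, EP) 𝓘(ℝ, EN) f x) := by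
  have h := hf.isSubmersionAt x
  obtain ⟨F, _, _, h⟩ := h
  set φ := h.domChart
  set ψ := h.codChart
  have hw := h.writtenInCharts
  set L := h.equiv
  have hxφ : x ∈ φ.source := h.mem_domChart_source
  have hxψ : f x ∈ ψ.source := h.mem_codChart_source
  have hfx : MDifferentiableAt 𝓘(ℝ, EP) 𝓘(ℝ, EN) f x :=
    (hf.contMDiff x).mdifferentiableAt (by simp)
  set c : F := (L (φ x)).2
  -- a local section of `f` through `x`
  let j : EN → EP := fun w => L.symm (w, c)
  let σ : N → P := fun y => φ.symm (j (ψ y))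
  have hj : ContDiff ℝ ∞ j := L.symm.contDiff.comp (contDiff_id.prodMk contDiff_const)
  have hj0 : j (ψ (f x)) = φ x := by
    have h1 := hw (x := φ x) (by simpa using φ.map_source hxφ)
    simp only [Function.comp_apply, OpenPartialHomeomorph.extend_coe, modelWithCornersSelf_coe,
      id_eq, OpenPartialHomeomorph.extend_coe_symm, modelWithCornersSelf_coe_symm] at h1
    rw [φ.left_inv hxφ] at h1
    have : j (ψ (f x)) = L.symm ((L (φ x)).1, (L (φ x)).2) := by
      show L.symm (h.codChart (f x), c) = _
      rw [h1]
    rw [this]; simp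
  have hσx : σ (f x) = x := by simp only [σ, hj0]; exact φ.left_inv hxφ
  have hψd : MDifferentiableAt 𝓘(ℝ, EN) 𝓘(ℝ, EN) ψ (f x) :=
    ((contMDiffOn_of_mem_maximalAtlas h.codChart_mem_maximalAtlas).contMDiffAt
      (ψ.open_source.mem_nhds hxψ)).mdifferentiableAt (by simp)
  have hφd : MDifferentiableAt 𝓘(ℝ, EP) 𝓘(ℝ, EP) φ.symm (j (ψ (f x))) :=
    ((contMDiffOn_symm_of_mem_maximalAtlas h.domChart_mem_maximalAtlas).contMDiffAt
      (φ.open_target.mem_nhds (by rw [hj0]; exact φ.map_source hxφ))).mdifferentiableAt (by simp)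
  have hjd : MDifferentiableAt 𝓘(ℝ, EN) 𝓘(ℝ, EP) j (ψ (f x)) :=
    (hj.contMDiff _).mdifferentiableAt (by simp)
  have hσd : MDifferentiableAt 𝓘(ℝ, EN) 𝓘(ℝ, EP) σ (f x) :=
    hφd.comp (f x) (hjd.comp (f x) hψd)
  have hev : f ∘ σ =ᶠ[𝓝 (f x)] id := by
    have hc : ContinuousAt (j ∘ ψ) (f x) := hj.continuous.continuousAt.comp (ψ.continuousAt hxψ)
    have h2 : ∀ᶠ y in 𝓝 (f x), j (ψ y) ∈ φ.target :=
      hc.eventually (φ.open_target.mem_nhds (by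
        show j (ψ (f x)) ∈ _
        rw [hj0]; exact φ.map_source hxφ))
    filter_upwards [h2, ψ.open_source.mem_nhds hxψ] with y hy hyψ
    have h1 := hw (x := j (ψ y)) (by simpa using hy)
    simp only [Function.comp_apply, OpenPartialHomeomorph.extend_coe, modelWithCornersSelf_coe,
      id_eq, OpenPartialHomeomorph.extend_coe_symm, modelWithCornersSelf_coe_symm] at h1
    have h3 : f (φ.symm (j (ψ y))) ∈ ψ.source :=
      h.source_subset_preimage_source (φ.map_target hy)
    have h4 : (L (j (ψ y))).1 = ψ y := by simp [j]
    exact ψ.injOn h3 hyψ (h1.trans h4)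
  have hd : HasMFDerivAt 𝓘(ℝ, EN) 𝓘(ℝ, EN) (f ∘ σ) (f x)
      ((mfderiv 𝓘(ℝ, EP) 𝓘(ℝ, EN) f (σ (f x))).comp (mfderiv 𝓘(ℝ, EN) 𝓘(ℝ, EP) σ (f x))) :=
    HasMFDerivAt.comp (f x) (by rw [hσx]; exact hfx.hasMFDerivAt) hσd.hasMFDerivAt
  have hd' := hd.congr_of_eventuallyEq hev.symm
  have heq := hasMFDerivAt_unique hd' (hasMFDerivAt_id (f x))
  have : Function.Surjective (mfderiv 𝓘(ℝ, EP) 𝓘(ℝ, EN) f (σ (f x))) := fun w =>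
    ⟨mfderiv 𝓘(ℝ, EN) 𝓘(ℝ, EP) σ (f x) w, DFunLike.congr_fun heq w⟩
  rwa [hσx] at this

end Submersion

/-- Transport of an element of a fibre along an equality of base points. -/
def fiberCast {B : Type*} (V : B → Type*) {x y : B} (h : x = y) (v : V x) : V y := h ▸ v

/-- A Lie groupoid `G ⇉ M`, given by its manifold of arrows `G`, its manifold of objects `M` and its
structure maps.  The product `mul g h = g h` is only meaningful for composable arrows, that is on
`G₂ = {(g, h) | s g = t h}`; its values elsewhere are irrelevant. -/
structure LieGroupoid (EM M EG G : Type*)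
    [NormedAddCommGroup EM] [NormedSpace ℝ EM] [TopologicalSpace M] [ChartedSpace EM M]
    [NormedAddCommGroup EG] [NormedSpace ℝ EG] [TopologicalSpace G] [ChartedSpace EG G] where
  /-- source -/
  s : G → M
  /-- target -/
  t : G → M
  /-- unit -/
  u : M → G
  /-- inversion -/
  inv : G → G
  /-- composition -/
  mul : G → G → G
  s_mul : ∀ {g h}, s g = t h → s (mul g h) = s h
  t_mul : ∀ {g h}, s g = t h → t (mul g h) = t g
  mul_assoc : ∀ {g h k}, s g = t h → s h = t k → mul (mul g h) k = mul g (mul h k)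
  s_u : ∀ x, s (u x) = x
  t_u : ∀ x, t (u x) = x
  mul_u : ∀ g, mul g (u (s g)) = g
  u_mul : ∀ g, mul (u (t g)) g = g
  s_inv : ∀ g, s (inv g) = t g
  t_inv : ∀ g, t (inv g) = s g
  inv_mul : ∀ g, mul (inv g) g = u (s g)
  mul_inv : ∀ g, mul g (inv g) = u (t g)
  isSubmersion_s : IsSubmersion 𝓘(ℝ, EG) 𝓘(ℝ, EM) ∞ s
  isSubmersion_t : IsSubmersion 𝓘(ℝ, EG) 𝓘(ℝ, EM) ∞ t
  contMDiff_u : ContMDiff 𝓘(ℝ, EM) 𝓘(ℝ, EG) ∞ u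
  contMDiff_inv : ContMDiff 𝓘(ℝ, EG) 𝓘(ℝ, EG) ∞ inv
  contMDiffOn_mul : ContMDiffOn (𝓘(ℝ, EG).prod 𝓘(ℝ, EG)) 𝓘(ℝ, EG) ∞
    (fun q : G × G => mul q.1 q.2) {q | s q.1 = t q.2}

namespace LieGroupoid

section Algebroid

variable {EM M EG G : Type*}
  [NormedAddCommGroup EM] [NormedSpace ℝ EM] [TopologicalSpace M] [ChartedSpace EM M]
  [NormedAddCommGroup EG] [NormedSpace ℝ EG] [TopologicalSpace G] [ChartedSpace EG G]

/-- The fibre `A_x = ker (d s : T_{1_x} G → T_x M)` of the Lie algebroid `A` of `G`. -/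
def A (𝒢 : LieGroupoid EM M EG G) (x : M) : Type _ :=
  (mfderiv 𝓘(ℝ, EG) 𝓘(ℝ, EM) 𝒢.s (𝒢.u x)).ker

variable (𝒢 : LieGroupoid EM M EG G)

noncomputable instance (x : M) : AddCommGroup (𝒢.A x) :=
  inferInstanceAs (AddCommGroup (mfderiv 𝓘(ℝ, EG) 𝓘(ℝ, EM) 𝒢.s (𝒢.u x)).ker)

noncomputable instance (x : M) : Module ℝ (𝒢.A x) :=
  inferInstanceAs (Module ℝ (mfderiv 𝓘(ℝ, EG) 𝓘(ℝ, EM) 𝒢.s (𝒢.u x)).ker)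

instance (x : M) : TopologicalSpace (𝒢.A x) :=
  inferInstanceAs (TopologicalSpace (mfderiv 𝓘(ℝ, EG) 𝓘(ℝ, EM) 𝒢.s (𝒢.u x)).ker)

instance (x : M) : IsTopologicalAddGroup (𝒢.A x) :=
  inferInstanceAs (IsTopologicalAddGroup (mfderiv 𝓘(ℝ, EG) 𝓘(ℝ, EM) 𝒢.s (𝒢.u x)).ker)

instance (x : M) : ContinuousSMul ℝ (𝒢.A x) :=
  inferInstanceAs (ContinuousSMul ℝ (mfderiv 𝓘(ℝ, EG) 𝓘(ℝ, EM) 𝒢.s (𝒢.u x)).ker)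

/-- The inclusion `A_x ⊂ T_{1_x} G`. -/
noncomputable def incl (x : M) : 𝒢.A x →L[ℝ] TangentSpace 𝓘(ℝ, EG) (𝒢.u x) :=
  (mfderiv 𝓘(ℝ, EG) 𝓘(ℝ, EM) 𝒢.s (𝒢.u x)).ker.subtypeL

theorem incl_injective (x : M) : Function.Injective (𝒢.incl x) := Subtype.val_injective

theorem mfderiv_incl (x : M) (a : 𝒢.A x) :
    mfderiv 𝓘(ℝ, EG) 𝓘(ℝ, EM) 𝒢.s (𝒢.u x) (𝒢.incl x a) = 0 := a.2

/-- A vector of `T_{1_x} G` killed by `d s`, as an element of `A_x`. -/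
noncomputable def mkA (x : M) (v : TangentSpace 𝓘(ℝ, EG) (𝒢.u x))
    (hv : mfderiv 𝓘(ℝ, EG) 𝓘(ℝ, EM) 𝒢.s (𝒢.u x) v = 0) : 𝒢.A x := ⟨v, hv⟩

@[simp] theorem incl_mkA (x : M) (v : TangentSpace 𝓘(ℝ, EG) (𝒢.u x))
    (hv : mfderiv 𝓘(ℝ, EG) 𝓘(ℝ, EM) 𝒢.s (𝒢.u x) v = 0) : 𝒢.incl x (𝒢.mkA x v hv) = v := rfl

theorem contMDiff_s : ContMDiff 𝓘(ℝ, EG) 𝓘(ℝ, EM) ∞ 𝒢.s := 𝒢.isSubmersion_s.contMDiff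

/-! ### The smooth vector bundle structure of `A`

Around `x₀` the bundle `A` is trivialized by `a ↦ P (c a)`, where `c` is the coordinate of `T G`
given by the preferred chart at `1_{x₀}` and `P` is a fixed linear map to the model fibre that
restricts to an isomorphism on `ker d s` at `1_{x₀}`. -/

variable (EM EG) in
/-- The model fibre of `A`. -/
abbrev Fib : Type := EuclideanSpace ℝ (Fin (Module.finrank ℝ EG - Module.finrank ℝ EM))

variable [IsManifold 𝓘(ℝ, EM) ∞ M] [IsManifold 𝓘(ℝ, EG) ∞ G]

/-- The preferred trivialization of `T G` near `1_{x₀}`. -/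
noncomputable abbrev trivG (x₀ : M) :
    Trivialization EG (π EG (TangentSpace 𝓘(ℝ, EG) : G → Type _)) :=
  trivializationAt EG (TangentSpace 𝓘(ℝ, EG) : G → Type _) (𝒢.u x₀)

/-- The preferred trivialization of `T M` near `x₀`. -/
noncomputable abbrev trivM (x₀ : M) :
    Trivialization EM (π EM (TangentSpace 𝓘(ℝ, EM) : M → Type _)) :=
  trivializationAt EM (TangentSpace 𝓘(ℝ, EM) : M → Type _) (𝒢.s (𝒢.u x₀))

/-- The differential of the source map at `1_x`, in the preferred coordinates around `x₀`. -/
noncomputable def dsCoord (x₀ x : M) : EG →L[ℝ] EM :=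
  ((𝒢.trivM x₀).continuousLinearMapAt ℝ (𝒢.s (𝒢.u x))) ∘L
    (mfderiv 𝓘(ℝ, EG) 𝓘(ℝ, EM) 𝒢.s (𝒢.u x)) ∘L ((𝒢.trivG x₀).symmL ℝ (𝒢.u x))

/-- The domain of the preferred coordinates around `x₀`. -/
def coordSet (x₀ : M) : Set M :=
  {x | 𝒢.u x ∈ (𝒢.trivG x₀).baseSet ∧ 𝒢.s (𝒢.u x) ∈ (𝒢.trivM x₀).baseSet}

theorem isOpen_coordSet (x₀ : M) : IsOpen (𝒢.coordSet x₀) :=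
  ((𝒢.trivG x₀).open_baseSet.preimage 𝒢.contMDiff_u.continuous).inter
    ((𝒢.trivM x₀).open_baseSet.preimage
      (𝒢.contMDiff_s.continuous.comp 𝒢.contMDiff_u.continuous))

theorem mem_coordSet (x₀ : M) : x₀ ∈ 𝒢.coordSet x₀ :=
  ⟨mem_baseSet_trivializationAt _ _ _, mem_baseSet_trivializationAt _ _ _⟩

theorem contMDiffOn_dsCoord (x₀ : M) :
    ContMDiffOn 𝓘(ℝ, EM) 𝓘(ℝ, EG →L[ℝ] EM) ∞ (𝒢.dsCoord x₀) (𝒢.coordSet x₀) := by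
  intro x₁ hx₁
  refine ContMDiffAt.contMDiffWithinAt ?_
  have h1 : ContMDiffAt 𝓘(ℝ, EM) 𝓘(ℝ, EG →L[ℝ] EM) ∞ (𝒢.dsCoord x₁) x₁ :=
    ContMDiffAt.mfderiv (n := ∞) (fun _ : M => 𝒢.s) 𝒢.u
      ((𝒢.contMDiff_s.comp contMDiff_snd).contMDiffAt) 𝒢.contMDiff_u.contMDiffAt (by simp)
  have h2 : ContMDiffAt 𝓘(ℝ, EM) 𝓘(ℝ, EG →L[ℝ] EG) ∞
      (fun x => ((𝒢.trivG x₀).coordChangeL ℝ (𝒢.trivG x₁) (𝒢.u x) : EG →L[ℝ] EG)) x₁ :=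
    ((contMDiffOn_coordChangeL (n := ∞) (𝒢.trivG x₀) (𝒢.trivG x₁)).contMDiffAt
      (((𝒢.trivG x₀).open_baseSet.inter (𝒢.trivG x₁).open_baseSet).mem_nhds
        ⟨hx₁.1, (𝒢.mem_coordSet x₁).1⟩)).comp x₁ 𝒢.contMDiff_u.contMDiffAt
  have h3 : ContMDiffAt 𝓘(ℝ, EM) 𝓘(ℝ, EM →L[ℝ] EM) ∞
      (fun x => ((𝒢.trivM x₁).coordChangeL ℝ (𝒢.trivM x₀) (𝒢.s (𝒢.u x)) : EM →L[ℝ] EM)) x₁ :=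
    ((contMDiffOn_coordChangeL (n := ∞) (𝒢.trivM x₁) (𝒢.trivM x₀)).contMDiffAt
      (((𝒢.trivM x₁).open_baseSet.inter (𝒢.trivM x₀).open_baseSet).mem_nhds
        ⟨(𝒢.mem_coordSet x₁).2, hx₁.2⟩)).comp x₁
        (𝒢.contMDiff_s.comp 𝒢.contMDiff_u).contMDiffAt
  refine (h3.clm_comp (h1.clm_comp h2)).congr_of_eventuallyEq ?_
  filter_upwards [(𝒢.isOpen_coordSet x₀).mem_nhds hx₁,
    (𝒢.isOpen_coordSet x₁).mem_nhds (𝒢.mem_coordSet x₁)] with x hx hx'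
  ext w
  have e1 : ∀ v : TangentSpace 𝓘(ℝ, EG) (𝒢.u x),
      (𝒢.trivG x₁).symmL ℝ (𝒢.u x) ((𝒢.trivG x₁) ⟨𝒢.u x, v⟩).2 = v := fun v => by
    rw [← Trivialization.continuousLinearMapAt_apply_of_mem ℝ (𝒢.trivG x₁) hx'.1]
    exact (𝒢.trivG x₁).symmL_continuousLinearMapAt hx'.1 v
  have e2 : ∀ v : TangentSpace 𝓘(ℝ, EM) (𝒢.s (𝒢.u x)),
      ((𝒢.trivM x₀) ⟨𝒢.s (𝒢.u x), (𝒢.trivM x₁).symm (𝒢.s (𝒢.u x))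
        ((𝒢.trivM x₁).continuousLinearMapAt ℝ (𝒢.s (𝒢.u x)) v)⟩).2 =
      (𝒢.trivM x₀).continuousLinearMapAt ℝ (𝒢.s (𝒢.u x)) v := fun v => by
    rw [← Trivialization.continuousLinearMapAt_apply_of_mem ℝ (𝒢.trivM x₀) hx.2]
    rw [← (𝒢.trivM x₁).symmL_apply (R := ℝ) hx'.2]
    exact congrArg _ ((𝒢.trivM x₁).symmL_continuousLinearMapAt hx'.2 v)
  simp only [dsCoord, ContinuousLinearMap.comp_apply, ContinuousLinearEquiv.coe_coe]
  rw [Trivialization.coordChangeL_apply _ _ ⟨hx'.2, hx.2⟩,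
    Trivialization.coordChangeL_apply _ _ ⟨hx.1, hx'.1⟩, e2, e1,
    (𝒢.trivG x₀).symmL_apply (R := ℝ) hx.1]

theorem surjective_dsCoord {x₀ x : M} (hx : x ∈ 𝒢.coordSet x₀) :
    Function.Surjective (𝒢.dsCoord x₀ x) := by
  intro w
  obtain ⟨v, hv⟩ := surjective_mfderiv_of_isSubmersion 𝒢.isSubmersion_s (𝒢.u x)
    ((𝒢.trivM x₀).symmL ℝ (𝒢.s (𝒢.u x)) w)
  refine ⟨(𝒢.trivG x₀).continuousLinearMapAt ℝ (𝒢.u x) v, ?_⟩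
  simp only [dsCoord, ContinuousLinearMap.comp_apply]
  rw [(𝒢.trivG x₀).symmL_continuousLinearMapAt hx.1 v, hv]
  exact (𝒢.trivM x₀).continuousLinearMapAt_symmL hx.2 w

variable [FiniteDimensional ℝ EM] [FiniteDimensional ℝ EG]

theorem exists_fibProj (x₀ : M) :
    ∃ P : EG →L[ℝ] Fib EM EG, ((𝒢.dsCoord x₀ x₀).prod P).IsInvertible := by
  set S := 𝒢.dsCoord x₀ x₀
  have hS : (S : EG →ₗ[ℝ] EM).range = ⊤ :=
    LinearMap.range_eq_top.2 (𝒢.surjective_dsCoord (𝒢.mem_coordSet x₀))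
  have hrank : Module.finrank ℝ (S : EG →ₗ[ℝ] EM).ker = Module.finrank ℝ (Fib EM EG) := by
    have h := LinearMap.finrank_range_add_finrank_ker (S : EG →ₗ[ℝ] EM)
    rw [hS, finrank_top] at h
    rw [finrank_euclideanSpace_fin]
    omega
  obtain ⟨C, hC⟩ := Submodule.exists_isCompl (S : EG →ₗ[ℝ] EM).ker
  let ε := LinearEquiv.ofFinrankEq _ _ hrank
  let P₀ : EG →ₗ[ℝ] Fib EM EG := ε.toLinearMap ∘ₗ Submodule.projectionOnto _ C hC
  let P : EG →L[ℝ] Fib EM EG := P₀.toContinuousLinearMap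
  have hPr : (P : EG →ₗ[ℝ] Fib EM EG).range = ⊤ := by
    apply LinearMap.range_eq_top.2
    intro w
    refine ⟨(ε.symm w : (S : EG →ₗ[ℝ] EM).ker), ?_⟩
    show ε (Submodule.projectionOnto _ C hC _) = w
    rw [Submodule.projectionOnto_apply_left, LinearEquiv.apply_symm_apply]
  have hPk : (P : EG →ₗ[ℝ] Fib EM EG).ker = C := by
    ext v
    show ε (Submodule.projectionOnto _ C hC v) = 0 ↔ v ∈ C
    rw [LinearEquiv.map_eq_zero_iff, Submodule.projectionOnto_apply_eq_zero_iff]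
  exact ⟨P, ContinuousLinearMap.equivProdOfSurjectiveOfIsCompl S P hS hPr (hPk ▸ hC), rfl⟩

/-- A linear map `T_{1_{x₀}} G → Fib` that is an isomorphism on `ker d s`. -/
noncomputable def fibProj (x₀ : M) : EG →L[ℝ] Fib EM EG := (𝒢.exists_fibProj x₀).choose

/-- The map `(d s, P) : T_{1_x} G → T_x M × Fib` in the preferred coordinates around `x₀`. -/
noncomputable def splitting (x₀ x : M) : EG →L[ℝ] EM × Fib EM EG :=
  (𝒢.dsCoord x₀ x).prod (𝒢.fibProj x₀)

/-- The domain of the trivialization of `A` around `x₀`. -/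
def trivSet (x₀ : M) : Set M := {x ∈ 𝒢.coordSet x₀ | (𝒢.splitting x₀ x).IsInvertible}

theorem mem_trivSet (x₀ : M) : x₀ ∈ 𝒢.trivSet x₀ :=
  ⟨𝒢.mem_coordSet x₀, (𝒢.exists_fibProj x₀).choose_spec⟩

theorem contMDiffOn_splitting (x₀ : M) :
    ContMDiffOn 𝓘(ℝ, EM) 𝓘(ℝ, EG →L[ℝ] EM × Fib EM EG) ∞ (𝒢.splitting x₀) (𝒢.coordSet x₀) := by
  have h : 𝒢.splitting x₀ = fun x =>
      (ContinuousLinearMap.inl ℝ EM (Fib EM EG)) ∘L (𝒢.dsCoord x₀ x) +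
        (ContinuousLinearMap.inr ℝ EM (Fib EM EG)) ∘L (𝒢.fibProj x₀) := by
    funext x
    ext v <;> simp [splitting]
  rw [h]
  exact (contMDiffOn_const.clm_comp (𝒢.contMDiffOn_dsCoord x₀)).add contMDiffOn_const

theorem isOpen_trivSet (x₀ : M) : IsOpen (𝒢.trivSet x₀) :=
  (𝒢.contMDiffOn_splitting x₀).continuousOn.isOpen_inter_preimage (𝒢.isOpen_coordSet x₀)
    (ContinuousLinearEquiv.isOpen (𝕜 := ℝ) (E := EG) (F := EM × Fib EM EG))

theorem contMDiffOn_inverse_splitting (x₀ : M) :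
    ContMDiffOn 𝓘(ℝ, EM) 𝓘(ℝ, EM × Fib EM EG →L[ℝ] EG) ∞
      (fun x => (𝒢.splitting x₀ x).inverse) (𝒢.trivSet x₀) := by
  intro x hx
  obtain ⟨e, he⟩ := hx.2
  have h1 : ContMDiffAt 𝓘(ℝ, EM) 𝓘(ℝ, EG →L[ℝ] EM × Fib EM EG) ∞ (𝒢.splitting x₀) x :=
    (𝒢.contMDiffOn_splitting x₀).contMDiffAt ((𝒢.isOpen_coordSet x₀).mem_nhds hx.1)
  have h2 : ContDiffAt ℝ ∞ (ContinuousLinearMap.inverse (R := ℝ)) (𝒢.splitting x₀ x) :=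
    he ▸ contDiffAt_map_inverse e
  exact (h2.contMDiffAt.comp x h1).contMDiffWithinAt

/-- The vector of `A_x` with coordinate `w` in the trivialization around `x₀`. -/
noncomputable def ofCoord (x₀ x : M) (w : Fib EM EG) : TangentSpace 𝓘(ℝ, EG) (𝒢.u x) :=
  (𝒢.trivG x₀).symmL ℝ (𝒢.u x) ((𝒢.splitting x₀ x).inverse (0, w))

/-- The coordinate of a vector of `A_x` in the trivialization around `x₀`. -/
noncomputable def toCoord (x₀ x : M) (v : TangentSpace 𝓘(ℝ, EG) (𝒢.u x)) : Fib EM EG :=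
  𝒢.fibProj x₀ ((𝒢.trivG x₀).continuousLinearMapAt ℝ (𝒢.u x) v)

theorem splitting_inverse {x₀ x : M} (hx : x ∈ 𝒢.trivSet x₀) (q : EM × Fib EM EG) :
    𝒢.splitting x₀ x ((𝒢.splitting x₀ x).inverse q) = q := by
  obtain ⟨e, he⟩ := hx.2
  rw [← he]; simp

theorem mfderiv_ofCoord {x₀ x : M} (hx : x ∈ 𝒢.trivSet x₀) (w : Fib EM EG) :
    mfderiv 𝓘(ℝ, EG) 𝓘(ℝ, EM) 𝒢.s (𝒢.u x) (𝒢.ofCoord x₀ x w) = 0 := by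
  have h : 𝒢.dsCoord x₀ x ((𝒢.splitting x₀ x).inverse (0, w)) = 0 :=
    congrArg Prod.fst (𝒢.splitting_inverse hx (0, w))
  have h' := congrArg ((𝒢.trivM x₀).symmL ℝ (𝒢.s (𝒢.u x))) h
  rw [map_zero] at h'
  rw [← h']
  exact ((𝒢.trivM x₀).symmL_continuousLinearMapAt hx.1.2 _).symm

theorem toCoord_ofCoord {x₀ x : M} (hx : x ∈ 𝒢.trivSet x₀) (w : Fib EM EG) :
    𝒢.toCoord x₀ x (𝒢.ofCoord x₀ x w) = w := by
  unfold toCoord ofCoord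
  rw [(𝒢.trivG x₀).continuousLinearMapAt_symmL hx.1.1]
  exact congrArg Prod.snd (𝒢.splitting_inverse hx (0, w))

theorem ofCoord_toCoord {x₀ x : M} (hx : x ∈ 𝒢.trivSet x₀) (a : 𝒢.A x) :
    𝒢.ofCoord x₀ x (𝒢.toCoord x₀ x (𝒢.incl x a)) = 𝒢.incl x a := by
  obtain ⟨e, he⟩ := hx.2
  set v := 𝒢.incl x a
  have h0 : 𝒢.dsCoord x₀ x ((𝒢.trivG x₀).continuousLinearMapAt ℝ (𝒢.u x) v) = 0 := by
    simp only [dsCoord, ContinuousLinearMap.comp_apply]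
    rw [(𝒢.trivG x₀).symmL_continuousLinearMapAt hx.1.1 v, 𝒢.mfderiv_incl x a, map_zero]
  have h1 : 𝒢.splitting x₀ x ((𝒢.trivG x₀).continuousLinearMapAt ℝ (𝒢.u x) v) =
      (0, 𝒢.toCoord x₀ x v) := Prod.ext h0 rfl
  unfold ofCoord
  rw [← h1, ← he]
  simp only [ContinuousLinearMap.inverse_equiv, ContinuousLinearEquiv.coe_coe,
    ContinuousLinearEquiv.symm_apply_apply]
  exact (𝒢.trivG x₀).symmL_continuousLinearMapAt hx.1.1 v

open Classical in
/-- The trivialization `a ↦ P (c a)` of `A` around `x₀`. -/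
noncomputable def pretriv (x₀ : M) : Pretrivialization (Fib EM EG) (π (Fib EM EG) 𝒢.A) where
  toFun z := (z.1, 𝒢.toCoord x₀ z.1 (𝒢.incl z.1 z.2))
  invFun q := ⟨q.1, if h : q.1 ∈ 𝒢.trivSet x₀ then
    𝒢.mkA q.1 (𝒢.ofCoord x₀ q.1 q.2) (𝒢.mfderiv_ofCoord h q.2) else 0⟩
  source := π (Fib EM EG) 𝒢.A ⁻¹' 𝒢.trivSet x₀
  target := 𝒢.trivSet x₀ ×ˢ univ
  map_source' z hz := ⟨hz, mem_univ _⟩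
  map_target' q hq := hq.1
  left_inv' := by
    rintro ⟨x, a⟩ (hx : x ∈ 𝒢.trivSet x₀)
    simp only [dif_pos hx, TotalSpace.mk_inj]
    exact 𝒢.incl_injective x (𝒢.ofCoord_toCoord hx a)
  right_inv' := by
    rintro ⟨x, w⟩ ⟨hx : x ∈ 𝒢.trivSet x₀, -⟩
    simp only [dif_pos hx, incl_mkA, 𝒢.toCoord_ofCoord hx]
  open_target := (𝒢.isOpen_trivSet x₀).prod isOpen_univ
  baseSet := 𝒢.trivSet x₀
  open_baseSet := 𝒢.isOpen_trivSet x₀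
  source_eq := rfl
  target_eq := rfl
  proj_toFun _ _ := rfl

open Classical in
theorem pretriv_symm {x₀ x : M} (hx : x ∈ 𝒢.trivSet x₀) (w : Fib EM EG) :
    (𝒢.pretriv x₀).symm x w = 𝒢.mkA x (𝒢.ofCoord x₀ x w) (𝒢.mfderiv_ofCoord hx w) := by
  rw [Pretrivialization.symm_apply _ hx]
  show (if h : x ∈ 𝒢.trivSet x₀ then
    𝒢.mkA x (𝒢.ofCoord x₀ x w) (𝒢.mfderiv_ofCoord h w) else 0) = _
  rw [dif_pos hx]

/-- The transition functions of `A`. -/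
noncomputable def transition (x₀ x₁ x : M) : Fib EM EG →L[ℝ] Fib EM EG :=
  (𝒢.fibProj x₁) ∘L ((𝒢.trivG x₀).coordChangeL ℝ (𝒢.trivG x₁) (𝒢.u x) : EG →L[ℝ] EG) ∘L
    (𝒢.splitting x₀ x).inverse ∘L ContinuousLinearMap.inr ℝ EM (Fib EM EG)

theorem transition_spec {x₀ x₁ x : M} (hx : x ∈ 𝒢.trivSet x₀ ∩ 𝒢.trivSet x₁) (w : Fib EM EG) :
    𝒢.transition x₀ x₁ x w = (𝒢.pretriv x₁ ⟨x, (𝒢.pretriv x₀).symm x w⟩).2 := by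
  rw [𝒢.pretriv_symm hx.1]
  show _ = 𝒢.fibProj x₁ ((𝒢.trivG x₁).continuousLinearMapAt ℝ (𝒢.u x) (𝒢.ofCoord x₀ x w))
  simp only [transition, ContinuousLinearMap.comp_apply, ContinuousLinearEquiv.coe_coe]
  rw [Trivialization.coordChangeL_apply _ _ ⟨hx.1.1.1, hx.2.1.1⟩,
    Trivialization.continuousLinearMapAt_apply_of_mem ℝ (𝒢.trivG x₁) hx.2.1.1,
    ← (𝒢.trivG x₀).symmL_apply (R := ℝ) hx.1.1.1]
  rfl

theorem contMDiffOn_transition (x₀ x₁ : M) :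
    ContMDiffOn 𝓘(ℝ, EM) 𝓘(ℝ, Fib EM EG →L[ℝ] Fib EM EG) ∞ (𝒢.transition x₀ x₁)
      (𝒢.trivSet x₀ ∩ 𝒢.trivSet x₁) := by
  have h2 : ContMDiffOn 𝓘(ℝ, EM) 𝓘(ℝ, EG →L[ℝ] EG) ∞
      (fun x => ((𝒢.trivG x₀).coordChangeL ℝ (𝒢.trivG x₁) (𝒢.u x) : EG →L[ℝ] EG))
      (𝒢.trivSet x₀ ∩ 𝒢.trivSet x₁) :=
    (contMDiffOn_coordChangeL (n := ∞) (𝒢.trivG x₀) (𝒢.trivG x₁)).comp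
      𝒢.contMDiff_u.contMDiffOn (fun x hx => ⟨hx.1.1.1, hx.2.1.1⟩)
  exact contMDiffOn_const.clm_comp (h2.clm_comp
    (((𝒢.contMDiffOn_inverse_splitting x₀).mono inter_subset_left).clm_comp contMDiffOn_const))

instance (x₀ : M) : (𝒢.pretriv x₀).IsLinear ℝ where
  linear x _ := ⟨fun a b => by
      show 𝒢.toCoord x₀ x (𝒢.incl x (a + b)) = _
      simp only [toCoord, map_add]; rfl,
    fun c a => by
      show 𝒢.toCoord x₀ x (𝒢.incl x (c • a)) = _
      simp only [toCoord, map_smul]; rfl⟩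

/-- The vector bundle atlas of `A`. -/
noncomputable def prebundle : VectorPrebundle ℝ (Fib EM EG) 𝒢.A where
  pretrivializationAtlas := range 𝒢.pretriv
  pretrivialization_linear' := by rintro _ ⟨x₀, rfl⟩; infer_instance
  pretrivializationAt := 𝒢.pretriv
  mem_base_pretrivializationAt := 𝒢.mem_trivSet
  pretrivialization_mem_atlas := mem_range_self
  exists_coordChange := by
    rintro _ ⟨x₀, rfl⟩ _ ⟨x₁, rfl⟩
    exact ⟨𝒢.transition x₀ x₁, (𝒢.contMDiffOn_transition x₀ x₁).continuousOn,
      fun x hx w => 𝒢.transition_spec hx w⟩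
  totalSpaceMk_isInducing x := by
    have hx := 𝒢.mem_trivSet x
    have hl : Function.LeftInverse
        (fun q : M × Fib EM EG => 𝒢.mkA x (𝒢.ofCoord x x q.2) (𝒢.mfderiv_ofCoord hx q.2))
        (fun a : 𝒢.A x => (x, 𝒢.toCoord x x (𝒢.incl x a))) := fun a =>
      𝒢.incl_injective x (𝒢.ofCoord_toCoord hx a)
    refine (hl.isEmbedding ?_ ?_).isInducing
    · exact Continuous.subtype_mk (((𝒢.trivG x).symmL ℝ (𝒢.u x)).continuous.comp
        ((𝒢.splitting x x).inverse.continuous.comp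
          (continuous_const.prodMk continuous_snd))) _
    · exact continuous_const.prodMk ((𝒢.fibProj x).continuous.comp
        (((𝒢.trivG x).continuousLinearMapAt ℝ (𝒢.u x)).continuous.comp (𝒢.incl x).continuous))

noncomputable instance : TopologicalSpace (TotalSpace (Fib EM EG) 𝒢.A) :=
  𝒢.prebundle.totalSpaceTopology

noncomputable instance : FiberBundle (Fib EM EG) 𝒢.A := 𝒢.prebundle.toFiberBundle

noncomputable instance : VectorBundle ℝ (Fib EM EG) 𝒢.A := 𝒢.prebundle.toVectorBundle

instance : 𝒢.prebundle.IsContMDiff 𝓘(ℝ, EM) ∞ where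
  exists_contMDiffCoordChange := by
    rintro _ ⟨x₀, rfl⟩ _ ⟨x₁, rfl⟩
    exact ⟨𝒢.transition x₀ x₁, 𝒢.contMDiffOn_transition x₀ x₁,
      fun x hx w => 𝒢.transition_spec hx w⟩

instance : ContMDiffVectorBundle ∞ (Fib EM EG) 𝒢.A 𝓘(ℝ, EM) :=
  𝒢.prebundle.contMDiffVectorBundle 𝓘(ℝ, EM)

end Algebroid

section Forms

variable {EM M EG G : Type*}
  [NormedAddCommGroup EM] [NormedSpace ℝ EM] [TopologicalSpace M] [ChartedSpace EM M]
  [NormedAddCommGroup EG] [NormedSpace ℝ EG] [TopologicalSpace G] [ChartedSpace EG G]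

theorem contMDiff_t (𝒢 : LieGroupoid EM M EG G) : ContMDiff 𝓘(ℝ, EG) 𝓘(ℝ, EM) ∞ 𝒢.t :=
  𝒢.isSubmersion_t.contMDiff

/-- The source map, as a bundled smooth map. -/
def sMap (𝒢 : LieGroupoid EM M EG G) : C^∞⟮𝓘(ℝ, EG), G; 𝓘(ℝ, EM), M⟯ := ⟨𝒢.s, 𝒢.contMDiff_s⟩

/-- The differential `d m (X, Y)` of the multiplication at a composable pair `(g, h)`; it is only
meaningful for vectors tangent to `G₂`, that is for `d s X = d t Y`. -/
noncomputable def dmul (𝒢 : LieGroupoid EM M EG G) (g h : G)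
    (X : TangentSpace 𝓘(ℝ, EG) g) (Y : TangentSpace 𝓘(ℝ, EG) h) :
    TangentSpace 𝓘(ℝ, EG) (𝒢.mul g h) :=
  mfderivWithin (𝓘(ℝ, EG).prod 𝓘(ℝ, EG)) 𝓘(ℝ, EG) (fun q : G × G => 𝒢.mul q.1 q.2)
    {q | 𝒢.s q.1 = 𝒢.t q.2} (g, h) (X, Y)

section

variable (𝒢 : LieGroupoid EM M EG G)
  (F : Type*) [NormedAddCommGroup F] [NormedSpace ℝ F]
  (E : M → Type*) [∀ x, AddCommGroup (E x)] [∀ x, Module ℝ (E x)] [∀ x, TopologicalSpace (E x)]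
  [TopologicalSpace (TotalSpace F E)] [FiberBundle F E]

/-- A representation of `G` on the vector bundle `E → M`: a smooth linear action
`E_{s g} → E_{t g}` of the arrows `g`. -/
structure Representation where
  /-- the action of an arrow -/
  act : ∀ g : G, E (𝒢.s g) →L[ℝ] E (𝒢.t g)
  act_u : ∀ x (v : E (𝒢.s (𝒢.u x))),
    fiberCast E (𝒢.t_u x) (act (𝒢.u x) v) = fiberCast E (𝒢.s_u x) v
  act_mul : ∀ g h (c : 𝒢.s g = 𝒢.t h) (v : E (𝒢.s (𝒢.mul g h))),
    fiberCast E (𝒢.t_mul c) (act (𝒢.mul g h) v) =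
      act g (fiberCast E c.symm (act h (fiberCast E (𝒢.s_mul c) v)))
  contMDiff_act : ContMDiff (𝓘(ℝ, EG).prod 𝓘(ℝ, F)) (𝓘(ℝ, EM).prod 𝓘(ℝ, F)) ∞
    (fun z : TotalSpace F (𝒢.sMap *ᵖ E) =>
      (⟨𝒢.t z.1, act z.1 (show E (𝒢.s z.1) from z.2)⟩ : TotalSpace F E))

/-- A smooth one-form on `G` with values in `t^* E`. -/
structure OneForm [IsManifold 𝓘(ℝ, EG) ∞ G] where
  /-- the value at an arrow -/
  toFun : ∀ g : G, TangentSpace 𝓘(ℝ, EG) g →L[ℝ] E (𝒢.t g)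
  contMDiff_toFun : ContMDiff 𝓘(ℝ, EG).tangent (𝓘(ℝ, EM).prod 𝓘(ℝ, F)) ∞
    (fun z : TangentBundle 𝓘(ℝ, EG) G => (⟨𝒢.t z.1, toFun z.1 z.2⟩ : TotalSpace F E))

end

variable {𝒢 : LieGroupoid EM M EG G} [IsManifold 𝓘(ℝ, EG) ∞ G]
  {F : Type*} [NormedAddCommGroup F] [NormedSpace ℝ F]
  {E : M → Type*} [∀ x, AddCommGroup (E x)] [∀ x, Module ℝ (E x)] [∀ x, TopologicalSpace (E x)]
  [TopologicalSpace (TotalSpace F E)] [FiberBundle F E]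

instance : CoeFun (OneForm 𝒢 F E) fun _ => ∀ g : G, TangentSpace 𝓘(ℝ, EG) g →L[ℝ] E (𝒢.t g) :=
  ⟨OneForm.toFun⟩

/-- Multiplicativity of a form: `(m^* θ)_{(g, h)} = pr₁^* θ + g · pr₂^* θ` on `G₂`. -/
def IsMultiplicative (R : Representation 𝒢 F E) (θ : OneForm 𝒢 F E) : Prop :=
  ∀ (g h : G) (c : 𝒢.s g = 𝒢.t h) (X : TangentSpace 𝓘(ℝ, EG) g) (Y : TangentSpace 𝓘(ℝ, EG) h),
    fiberCast (TangentSpace 𝓘(ℝ, EM)) c (mfderiv 𝓘(ℝ, EG) 𝓘(ℝ, EM) 𝒢.s g X) =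
      mfderiv 𝓘(ℝ, EG) 𝓘(ℝ, EM) 𝒢.t h Y →
    fiberCast E (𝒢.t_mul c) (θ (𝒢.mul g h) (𝒢.dmul g h X Y)) =
      θ g X + R.act g (fiberCast E c.symm (θ h Y))

/-- The vector field `V` is smooth on a neighbourhood of `g`. -/
def SmoothNear (V : ∀ g : G, TangentSpace 𝓘(ℝ, EG) g) (g : G) : Prop :=
  ∀ᶠ k in 𝓝 g, ContMDiffAt 𝓘(ℝ, EG) 𝓘(ℝ, EG).tangent ∞
    (fun k => (⟨k, V k⟩ : TangentBundle 𝓘(ℝ, EG) G)) k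

/-- The pair `(G, θ)` is a Pfaffian groupoid: `θ` is multiplicative and pointwise surjective, its
kernel `H` is transversal to the fibres of `s`, and `H^s = H ∩ ker d s` is involutive. -/
structure IsPfaffian (R : Representation 𝒢 F E) (θ : OneForm 𝒢 F E) : Prop where
  isMultiplicative : IsMultiplicative R θ
  surjective : ∀ g, Function.Surjective (θ g)
  transversal : ∀ (g : G) (X : TangentSpace 𝓘(ℝ, EG) g), ∃ Y Z : TangentSpace 𝓘(ℝ, EG) g,
    X = Y + Z ∧ θ g Y = 0 ∧ mfderiv 𝓘(ℝ, EG) 𝓘(ℝ, EM) 𝒢.s g Z = 0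
  involutive : ∀ (g : G) (V W : ∀ k : G, TangentSpace 𝓘(ℝ, EG) k),
    SmoothNear V g → SmoothNear W g →
    (∀ᶠ k in 𝓝 g, (θ k (V k) = 0 ∧ mfderiv 𝓘(ℝ, EG) 𝓘(ℝ, EM) 𝒢.s k (V k) = 0) ∧
      θ k (W k) = 0 ∧ mfderiv 𝓘(ℝ, EG) 𝓘(ℝ, EM) 𝒢.s k (W k) = 0) →
    θ g (VectorField.mlieBracket 𝓘(ℝ, EG) V W g) = 0

/-- `V` is, near `g`, a smooth vector field tangent to `ker θ`, with value `X` at `g`. -/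
def IsKerExtension (θ : OneForm 𝒢 F E) (g : G) (X : TangentSpace 𝓘(ℝ, EG) g)
    (V : ∀ k : G, TangentSpace 𝓘(ℝ, EG) k) : Prop :=
  V g = X ∧ SmoothNear V g ∧ ∀ᶠ k in 𝓝 g, θ k (V k) = 0

/-- A choice of local extension of `X ∈ ker θ_g` to a smooth vector field tangent to `ker θ`
(such an extension exists when `θ` is pointwise surjective). -/
noncomputable def extendInKer (θ : OneForm 𝒢 F E) (g : G) (X : TangentSpace 𝓘(ℝ, EG) g) :
    ∀ k : G, TangentSpace 𝓘(ℝ, EG) k :=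
  Classical.epsilon (IsKerExtension θ g X)

/-- The partial differential `δθ (X, Y) = θ [X̃, Ỹ]` of `θ`, for `X, Y ∈ ker θ_g`, where `X̃, Ỹ`
are local extensions tangent to `ker θ`; the value does not depend on the extensions. -/
noncomputable def partialDiff (θ : OneForm 𝒢 F E) (g : G) (X Y : TangentSpace 𝓘(ℝ, EG) g) :
    E (𝒢.t g) :=
  θ g (VectorField.mlieBracket 𝓘(ℝ, EG) (extendInKer θ g X) (extendInKer θ g Y) g)

/-! ### The Lie algebroid and the Spencer operator -/

/-- The anchor `ρ = d t : A → T M`. -/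
noncomputable def anchor (𝒢 : LieGroupoid EM M EG G) (x : M) (a : 𝒢.A x) :
    TangentSpace 𝓘(ℝ, EM) x :=
  fiberCast (TangentSpace 𝓘(ℝ, EM)) (𝒢.t_u x)
    (mfderiv 𝓘(ℝ, EG) 𝓘(ℝ, EM) 𝒢.t (𝒢.u x) (𝒢.incl x a))

/-- The right-invariant vector field `α^r` of a section `α` of `A`: `α^r_g = d R_g (α_{t g})`. -/
noncomputable def rightInv (𝒢 : LieGroupoid EM M EG G) (α : ∀ x, 𝒢.A x) (g : G) :
    TangentSpace 𝓘(ℝ, EG) g :=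
  fiberCast (TangentSpace 𝓘(ℝ, EG)) (𝒢.u_mul g)
    (𝒢.dmul (𝒢.u (𝒢.t g)) g (𝒢.incl (𝒢.t g) (α (𝒢.t g))) 0)

/-- The bracket `[α, β]` of two sections of `A`, at `x`: it is `[α^r, β^r]` at `1_x`, which for
smooth sections is a vector of `A_x ⊂ T_{1_x} G`. -/
noncomputable def algebroidBracket (𝒢 : LieGroupoid EM M EG G) (α β : ∀ x, 𝒢.A x) (x : M) :
    TangentSpace 𝓘(ℝ, EG) (𝒢.u x) :=
  VectorField.mlieBracket 𝓘(ℝ, EG) (𝒢.rightInv α) (𝒢.rightInv β) (𝒢.u x)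

/-- The restriction of `θ` to `T_{1_x} G`, with values in `E_x`.  Its restriction to `A_x` is the
vector bundle map `l = θ|_A : A → E`. -/
noncomputable def atUnit (θ : OneForm 𝒢 F E) (x : M) (v : TangentSpace 𝓘(ℝ, EG) (𝒢.u x)) : E x :=
  fiberCast E (𝒢.t_u x) (θ (𝒢.u x) v)

/-- The vector bundle map `l = θ|_A : A → E`. -/
noncomputable def symbolMap (θ : OneForm 𝒢 F E) (x : M) (a : 𝒢.A x) : E x :=
  atUnit θ x (𝒢.incl x a)

/-- The Spencer operator of `θ`: `D_X α (x) = θ [X̃, α^r]` at `1_x`, where `X̃` is a local vector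
field tangent to `ker θ` that extends the vector `d u (X)`; the value does not depend on `X̃`. -/
noncomputable def spencer (θ : OneForm 𝒢 F E) (α : ∀ x, 𝒢.A x) (x : M)
    (X : TangentSpace 𝓘(ℝ, EM) x) : E x :=
  atUnit θ x (VectorField.mlieBracket 𝓘(ℝ, EG)
    (extendInKer θ (𝒢.u x) (mfderiv 𝓘(ℝ, EM) 𝓘(ℝ, EG) 𝒢.u x X)) (𝒢.rightInv α) (𝒢.u x))

variable [IsManifold 𝓘(ℝ, EM) ∞ M] [FiniteDimensional ℝ EM] [FiniteDimensional ℝ EG]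

/-- The tensor `½ {a, b}_D = D_{ρ α} β - D_{ρ β} α - l [α, β]` at `x`, where `α, β` are local
sections of `A` with values `a, b` at `x`. -/
noncomputable def halfBracket (θ : OneForm 𝒢 F E) (x : M) (a b : 𝒢.A x) : E x :=
  spencer θ (FiberBundle.extend (Fib EM EG) b) x (𝒢.anchor x a) -
    spencer θ (FiberBundle.extend (Fib EM EG) a) x (𝒢.anchor x b) -
    atUnit θ x (𝒢.algebroidBracket (FiberBundle.extend (Fib EM EG) a)
      (FiberBundle.extend (Fib EM EG) b) x)

section Pullback

variable {EQ Q : Type*} [NormedAddCommGroup EQ] [NormedSpace ℝ EQ] [TopologicalSpace Q]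
  [ChartedSpace EQ Q]

/-- The pull-back `D^τ` of the Spencer operator `D` of `θ` along a map `τ : Q → M`, applied to a
section `σ` of `τ^* A` in the direction `X ∈ T_q Q`.  It is the operator with
`D^τ_X (τ^* α) = D_{d τ (X)} α` and `D^τ_X (f σ) = f D^τ_X σ + (X f) l σ`: near `q` one writes
`σ = ∑ f_i τ^* α_i` with `α_i` a local frame of `A`, so that
`D^τ_X σ = ∑ (f_i D_{d τ (X)} α_i + (X f_i) l α_i)`. -/
noncomputable def pullbackSpencer (θ : OneForm 𝒢 F E) (τ : Q → M) (σ : ∀ q, 𝒢.A (τ q)) (q : Q)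
    (X : TangentSpace 𝓘(ℝ, EQ) q) : E (τ q) :=
  let e := trivializationAt (Fib EM EG) 𝒢.A (τ q)
  let b := Module.finBasis ℝ (Fib EM EG)
  let f := fun i (k : Q) => b.repr (e ⟨τ k, σ k⟩).2 i
  ∑ i, (f i q • spencer θ (e.localFrame b i) (τ q) (mfderiv 𝓘(ℝ, EQ) 𝓘(ℝ, EM) τ q X) +
    mvfderiv 𝓘(ℝ, EQ) (f i) q X • symbolMap θ (τ q) (e.localFrame b i (τ q)))

end Pullback

section MaurerCartan

variable {EG' G' : Type*} [NormedAddCommGroup EG'] [NormedSpace ℝ EG'] [TopologicalSpace G']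
  [ChartedSpace EG' G'] [IsManifold 𝓘(ℝ, EG') ∞ G'] {𝒢' : LieGroupoid EM M EG' G'}

/-- The form `d_D θ'`, for `θ' ∈ Ω¹(G', t^* A)`, evaluated on vector fields:
`d_D θ' (X, Y) = D^t_X (θ' Y) - D^t_Y (θ' X) - l θ' [X, Y]`. -/
noncomputable def dSpencer (θ : OneForm 𝒢 F E) (θ' : OneForm 𝒢' (Fib EM EG) 𝒢.A)
    (X Y : ∀ g : G', TangentSpace 𝓘(ℝ, EG') g) (g : G') : E (𝒢'.t g) :=
  pullbackSpencer θ 𝒢'.t (fun k => θ' k (Y k)) g (X g) -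
    pullbackSpencer θ 𝒢'.t (fun k => θ' k (X k)) g (Y g) -
    symbolMap θ (𝒢'.t g) (θ' g (VectorField.mlieBracket 𝓘(ℝ, EG') X Y g))

/-- The form `MC (θ', θ) = d_D θ' - ½ {θ', θ'}_D`, evaluated on vector fields. -/
noncomputable def maurerCartan (θ : OneForm 𝒢 F E) (θ' : OneForm 𝒢' (Fib EM EG) 𝒢.A)
    (X Y : ∀ g : G', TangentSpace 𝓘(ℝ, EG') g) (g : G') : E (𝒢'.t g) :=
  dSpencer θ θ' X Y g - halfBracket θ (𝒢'.t g) (θ' g (X g)) (θ' g (Y g))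

/-- The Maurer-Cartan equation `d_D θ' - ½ {θ', θ'}_D = 0`. -/
def SatisfiesMaurerCartan (θ : OneForm 𝒢 F E) (θ' : OneForm 𝒢' (Fib EM EG) 𝒢.A) : Prop :=
  ∀ (g : G') (X Y : ∀ k : G', TangentSpace 𝓘(ℝ, EG') k),
    SmoothNear X g → SmoothNear Y g → maurerCartan θ θ' X Y g = 0

end MaurerCartan

end Forms

section Morphisms

variable {EM M EG G EG' G' : Type*}
  [NormedAddCommGroup EM] [NormedSpace ℝ EM] [TopologicalSpace M] [ChartedSpace EM M]
  [NormedAddCommGroup EG] [NormedSpace ℝ EG] [TopologicalSpace G] [ChartedSpace EG G]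
  [NormedAddCommGroup EG'] [NormedSpace ℝ EG'] [TopologicalSpace G'] [ChartedSpace EG' G']
  {𝒢' : LieGroupoid EM M EG' G'} {𝒢 : LieGroupoid EM M EG G}

/-- `p : G' → G` is a morphism of Lie groupoids over `M` (covering the identity of `M`). -/
structure IsHom (𝒢' : LieGroupoid EM M EG' G') (𝒢 : LieGroupoid EM M EG G) (p : G' → G) :
    Prop where
  contMDiff : ContMDiff 𝓘(ℝ, EG') 𝓘(ℝ, EG) ∞ p
  s_map : ∀ g, 𝒢.s (p g) = 𝒢'.s g
  t_map : ∀ g, 𝒢.t (p g) = 𝒢'.t g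
  map_mul : ∀ {g h}, 𝒢'.s g = 𝒢'.t h → p (𝒢'.mul g h) = 𝒢.mul (p g) (p h)

theorem IsHom.map_u {p : G' → G} (hp : IsHom 𝒢' 𝒢 p) (x : M) : p (𝒢'.u x) = 𝒢.u x := by
  set k := p (𝒢'.u x)
  have hs : 𝒢.s k = x := (hp.s_map _).trans (𝒢'.s_u x)
  have ht : 𝒢.t k = x := (hp.t_map _).trans (𝒢'.t_u x)
  have hkk : 𝒢.mul k k = k := by
    have h1 := hp.map_mul (g := 𝒢'.u x) (h := 𝒢'.u x) ((𝒢'.s_u x).trans (𝒢'.t_u x).symm)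
    have h2 : 𝒢'.mul (𝒢'.u x) (𝒢'.u x) = 𝒢'.u x := by
      have := 𝒢'.mul_u (𝒢'.u x)
      rwa [𝒢'.s_u] at this
    rw [h2] at h1
    exact h1.symm
  have h3 := 𝒢.mul_assoc (g := 𝒢.inv k) (h := k) (k := k) (𝒢.s_inv k) (hs.trans ht.symm)
  rw [hkk, 𝒢.inv_mul, hs] at h3
  have h4 := 𝒢.u_mul k
  rw [ht] at h4
  exact h4.symm.trans h3

theorem IsHom.mfderiv_incl {p : G' → G} (hp : IsHom 𝒢' 𝒢 p) (x : M) (a : 𝒢'.A x) :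
    mfderiv 𝓘(ℝ, EG) 𝓘(ℝ, EM) 𝒢.s (𝒢.u x)
      (fiberCast (TangentSpace 𝓘(ℝ, EG)) (hp.map_u x)
        (mfderiv 𝓘(ℝ, EG') 𝓘(ℝ, EG) p (𝒢'.u x) (𝒢'.incl x a))) = 0 := by
  have h1 : mfderiv 𝓘(ℝ, EG) 𝓘(ℝ, EM) 𝒢.s (p (𝒢'.u x))
      (mfderiv 𝓘(ℝ, EG') 𝓘(ℝ, EG) p (𝒢'.u x) (𝒢'.incl x a)) = 0 := by
    have h2 := mfderiv_comp (𝒢'.u x)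
      (𝒢.contMDiff_s.mdifferentiable (by simp) (p (𝒢'.u x)))
      (hp.contMDiff.mdifferentiable (by simp) (𝒢'.u x))
    have h3 : 𝒢.s ∘ p = 𝒢'.s := funext hp.s_map
    have h4 := DFunLike.congr_fun h2 (𝒢'.incl x a)
    rw [ContinuousLinearMap.comp_apply] at h4
    refine h4.symm.trans ?_
    have h5 := 𝒢'.mfderiv_incl x a
    rw [← h3] at h5
    exact h5
  have key : ∀ (k k' : G) (e : k = k') (v : TangentSpace 𝓘(ℝ, EG) k),
      mfderiv 𝓘(ℝ, EG) 𝓘(ℝ, EM) 𝒢.s k v = 0 →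
      mfderiv 𝓘(ℝ, EG) 𝓘(ℝ, EM) 𝒢.s k' (fiberCast (TangentSpace 𝓘(ℝ, EG)) e v) = 0 := by
    rintro k _ rfl v hv
    exact hv
  exact key _ _ (hp.map_u x) _ h1

/-- The map `Lie (p) : A' → A` induced by `p`: the restriction of `d p`. -/
noncomputable def lieMap {p : G' → G} (hp : IsHom 𝒢' 𝒢 p) (x : M) (a : 𝒢'.A x) : 𝒢.A x :=
  𝒢.mkA x (fiberCast (TangentSpace 𝓘(ℝ, EG)) (hp.map_u x)
    (mfderiv 𝓘(ℝ, EG') 𝓘(ℝ, EG) p (𝒢'.u x) (𝒢'.incl x a))) (hp.mfderiv_incl x a)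

variable [IsManifold 𝓘(ℝ, EG) ∞ G] [IsManifold 𝓘(ℝ, EG') ∞ G']
  {F : Type*} [NormedAddCommGroup F] [NormedSpace ℝ F]
  {E : M → Type*} [∀ x, AddCommGroup (E x)] [∀ x, Module ℝ (E x)] [∀ x, TopologicalSpace (E x)]
  [TopologicalSpace (TotalSpace F E)] [FiberBundle F E]
  {F' : Type*} [NormedAddCommGroup F'] [NormedSpace ℝ F']
  {E' : M → Type*} [∀ x, AddCommGroup (E' x)] [∀ x, Module ℝ (E' x)]
  [∀ x, TopologicalSpace (E' x)] [TopologicalSpace (TotalSpace F' E')] [FiberBundle F' E']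

/-- `p : (G', θ') → (G, θ)` is a morphism of Pfaffian groupoids: `d p (ker θ') ⊂ ker θ` and
`p₀ (δθ' (X, Y)) = δθ (d p (X), d p (Y))` for `X, Y ∈ ker θ'`, where `p₀ : E' → E` is the map
determined by `p₀ (l' a) = l (Lie (p) a)` for `a ∈ A'`. -/
structure IsPfaffianMorphism (θ' : OneForm 𝒢' F' E') (θ : OneForm 𝒢 F E) {p : G' → G}
    (hp : IsHom 𝒢' 𝒢 p) : Prop where
  map_ker : ∀ (g : G') (X : TangentSpace 𝓘(ℝ, EG') g), θ' g X = 0 →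
    θ (p g) (mfderiv 𝓘(ℝ, EG') 𝓘(ℝ, EG) p g X) = 0
  exists_map : ∃ p₀ : ∀ x, E' x →ₗ[ℝ] E x,
    (∀ x (a : 𝒢'.A x), p₀ x (symbolMap θ' x a) = symbolMap θ x (lieMap hp x a)) ∧
    ∀ (g : G') (X Y : TangentSpace 𝓘(ℝ, EG') g), θ' g X = 0 → θ' g Y = 0 →
      p₀ (𝒢'.t g) (partialDiff θ' g X Y) =
        fiberCast E (hp.t_map g) (partialDiff θ (p g) (mfderiv 𝓘(ℝ, EG') 𝓘(ℝ, EG) p g X)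
          (mfderiv 𝓘(ℝ, EG') 𝓘(ℝ, EG) p g Y))

variable [IsManifold 𝓘(ℝ, EM) ∞ M] [FiniteDimensional ℝ EM] [FiniteDimensional ℝ EG]

/-- `p : (G', θ') → (G, θ)` is a Lie prolongation of the Pfaffian groupoid `(G, θ)`: a morphism of
Pfaffian groupoids which is a surjective submersion, such that `d p` vanishes on
`ker θ' ∩ ker d s`, `δθ (d p (X), d p (Y)) = 0` for `X, Y ∈ ker θ'`, and the map `L : E' → A`
determined by `L (l' a) = Lie (p) a` for `a ∈ A'` is an isomorphism of vector bundles. -/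
structure IsLieProlongation (R' : Representation 𝒢' F' E') (θ' : OneForm 𝒢' F' E')
    (R : Representation 𝒢 F E) (θ : OneForm 𝒢 F E) {p : G' → G} (hp : IsHom 𝒢' 𝒢 p) :
    Prop where
  isPfaffian' : IsPfaffian R' θ'
  isPfaffian : IsPfaffian R θ
  isPfaffianMorphism : IsPfaffianMorphism θ' θ hp
  surjective : Function.Surjective p
  isSubmersion : IsSubmersion 𝓘(ℝ, EG') 𝓘(ℝ, EG) ∞ p
  map_ker_s : ∀ (g : G') (X : TangentSpace 𝓘(ℝ, EG') g), θ' g X = 0 →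
    mfderiv 𝓘(ℝ, EG') 𝓘(ℝ, EM) 𝒢'.s g X = 0 → mfderiv 𝓘(ℝ, EG') 𝓘(ℝ, EG) p g X = 0
  partialDiff_map : ∀ (g : G') (X Y : TangentSpace 𝓘(ℝ, EG') g), θ' g X = 0 → θ' g Y = 0 →
    partialDiff θ (p g) (mfderiv 𝓘(ℝ, EG') 𝓘(ℝ, EG) p g X)
      (mfderiv 𝓘(ℝ, EG') 𝓘(ℝ, EG) p g Y) = 0
  exists_equiv : ∃ L : ∀ x, E' x ≃ₗ[ℝ] 𝒢.A x,
    ContMDiff (𝓘(ℝ, EM).prod 𝓘(ℝ, F')) (𝓘(ℝ, EM).prod 𝓘(ℝ, Fib EM EG)) ∞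
      (fun z : TotalSpace F' E' => (⟨z.1, L z.1 z.2⟩ : TotalSpace (Fib EM EG) 𝒢.A)) ∧
    ∀ x (a : 𝒢'.A x), L x (symbolMap θ' x a) = lieMap hp x a

end Morphisms

end LieGroupoid

/-! Fix a local trivialization of `E`. Then θ on G and lθ' on G' become vector-valued one-forms with
an ordinary exterior derivative d (`extD`). The argument is governed by the defect ζ = p^*θ - lθ'
(`defectForm`) and by the vector hX = dp(X) - R_{p(g)} θ'(X) (`horPart`), where R is right
translation. A multiplicative form is invariant under right translation of vectors tangent to source
fibres, so ζ(X) = θ(hX). The condition Lie(p) = θ'|_{A'} gives hX = 0 whenever X is tangent to a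
source fibre.

Two computations express the Maurer–Cartan form through ζ. First, Cartan's formula turns every
ingredient of the equation into d; for instance D_X α = X(lα) - dθ(du X, α). The sum is MC(X,Y) =
d(lθ')(X,Y) - dθ(X_u, Y_u), where X_u = du(dt X - ρθ'X) + θ'X is a vector at the unit 1_{t(g)}
(`continuousLinearMapAt_maurerCartan`). Second, differentiating m^*θ = pr₁^*θ + g·pr₂^*θ along a
two-parameter family of products computes dθ on vectors Y + R_g a: a term at the unit, the term
dθ(Y₁,Y₂), and terms from the derivative λ of the representation (`extD_add_rTrans`). For dp(X) = hX
+ R θ'X the unit term is again dθ(X_u, Y_u), hence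

MC(X,Y) = dθ(hX,hY) + λ(θ'X)ζ(Y) - λ(θ'Y)ζ(X) - dζ(X,Y)

(`continuousLinearMapAt_maurerCartan_eq_defect`).

For a Lie prolongation, TG' = ker θ' + ker ds, so every hX equals dp(Z) with Z in ker θ'. Condition
(i) gives ζ = 0 everywhere, hence dζ = 0, and (iv) gives dθ(hX,hY) = 0; thus MC = 0.

Conversely let MC = 0. For X tangent to a source fibre, hX = 0 and ζ(X) = 0, so the identity reads
dζ(X,Y) = λ(θ'X)ζ(Y): a linear ordinary differential equation for ζ along source fibres. Since ζ
vanishes at units and source fibres are connected, ζ = 0. The identity then leaves dθ(hX,hY) = 0,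
which on ker θ' is (iv); together with dζ = 0 it gives l(δθ') = 0, so (ii) holds with p₀ = l.
Condition (iii) and the Pfaffian property of θ' need no Maurer–Cartan equation: they come from ker
dp = ker θ' ∩ ker ds and from p being a submersion. -/

set_option linter.unusedSectionVars false

/-! ### Tangent maps in the trivial identification of tangent spaces with the model space -/

section TangentMaps

variable {EP P EN N EQ Q : Type*}
  [NormedAddCommGroup EP] [NormedSpace ℝ EP] [TopologicalSpace P] [ChartedSpace EP P]
  [NormedAddCommGroup EN] [NormedSpace ℝ EN] [TopologicalSpace N] [ChartedSpace EN N]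
  [NormedAddCommGroup EQ] [NormedSpace ℝ EQ] [TopologicalSpace Q] [ChartedSpace EQ Q]

variable (EP EN) in
/-- The differential of `f` at `x`, as a map between the model spaces. -/
noncomputable def tderiv (f : P → N) (x : P) : EP →L[ℝ] EN := mfderiv 𝓘(ℝ, EP) 𝓘(ℝ, EN) f x

variable (EP EN) in
/-- `f` is smooth at `x`. -/
abbrev SmoothAt (f : P → N) (x : P) : Prop := ContMDiffAt 𝓘(ℝ, EP) 𝓘(ℝ, EN) ∞ f x

variable (EP EN) in
/-- `f` is differentiable at `x`. -/
abbrev DiffAt (f : P → N) (x : P) : Prop := MDifferentiableAt 𝓘(ℝ, EP) 𝓘(ℝ, EN) f x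

theorem SmoothAt.diffAt {f : P → N} {x : P} (h : SmoothAt EP EN f x) : DiffAt EP EN f x :=
  h.mdifferentiableAt (by simp)

theorem tderiv_comp {f : P → N} {g : N → Q} {x : P} (hg : DiffAt EN EQ g (f x))
    (hf : DiffAt EP EN f x) (v : EP) :
    tderiv EP EQ (fun y => g (f y)) x v = tderiv EN EQ g (f x) (tderiv EP EN f x v) :=
  DFunLike.congr_fun (mfderiv_comp x hg hf) v

theorem tderiv_congr {f g : P → N} {x : P} (h : f =ᶠ[𝓝 x] g) :
    tderiv EP EN f x = tderiv EP EN g x :=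
  h.mfderiv_eq

theorem tderiv_id (x : P) (v : EP) : tderiv EP EP (fun y : P => y) x v = v :=
  DFunLike.congr_fun (mfderiv_id (I := 𝓘(ℝ, EP)) (x := x)) v

theorem tderiv_const (x : P) (c : N) (v : EP) : tderiv EP EN (fun _ : P => c) x v = 0 :=
  DFunLike.congr_fun (mfderiv_const (I := 𝓘(ℝ, EP)) (I' := 𝓘(ℝ, EN)) (c := c) (x := x)) v

theorem tderiv_eq_fderiv {V W : Type*} [NormedAddCommGroup V] [NormedSpace ℝ V]
    [NormedAddCommGroup W] [NormedSpace ℝ W] (f : V → W) (x : V) :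
    tderiv V W f x = fderiv ℝ f x := mfderiv_eq_fderiv

variable [IsManifold 𝓘(ℝ, EP) ∞ P] [IsManifold 𝓘(ℝ, EN) ∞ N]

/-- `V` is a smooth vector field at `x`. -/
abbrev SmoothFieldAt (V : N → EN) (x : N) : Prop :=
  ContMDiffAt 𝓘(ℝ, EN) 𝓘(ℝ, EN).tangent ∞ (fun k => (⟨k, V k⟩ : TangentBundle 𝓘(ℝ, EN) N)) x

/-- Every tangent space is the model space itself, so vectors over equal base points are compared
without transport. -/
theorem tangentBundle_mk_congr {x y : N} {v w : EN} (h : x = y) (h' : v = w) :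
    (⟨x, v⟩ : TangentBundle 𝓘(ℝ, EN) N) = ⟨y, w⟩ := by
  subst h h'
  rfl

/-- Smoothness of order ∞ at a point provides a neighbourhood for each finite order only. The
tangent map is therefore shown to be C^n for every n, from C^{n+1} regularity on a neighbourhood
depending on n. -/
theorem contMDiffAt_tangentMap' {f : P → N} {x : P} (hf : SmoothAt EP EN f x) (v : EP) :
    ContMDiffAt 𝓘(ℝ, EP).tangent 𝓘(ℝ, EN).tangent ∞
      (fun z : TangentBundle 𝓘(ℝ, EP) P =>
        (⟨f z.1, tderiv EP EN f z.1 z.2⟩ : TangentBundle 𝓘(ℝ, EN) N)) ⟨x, v⟩ := by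
  have : IsManifold 𝓘(ℝ, EP) 1 P := IsManifold.of_le (n := ∞) (by simp)
  have : IsManifold 𝓘(ℝ, EN) 1 N := IsManifold.of_le (n := ∞) (by simp)
  rw [contMDiffAt_infty]
  intro n
  have h1 : ContMDiffAt 𝓘(ℝ, EP) 𝓘(ℝ, EN) ((n + 1 : ℕ) : WithTop ℕ∞) f x :=
    hf.of_le (by exact_mod_cast le_top)
  have : IsManifold 𝓘(ℝ, EP) ((n + 1 : ℕ) : WithTop ℕ∞) P :=
    IsManifold.of_le (n := ∞) (by exact_mod_cast le_top)
  have : IsManifold 𝓘(ℝ, EN) ((n + 1 : ℕ) : WithTop ℕ∞) N :=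
    IsManifold.of_le (n := ∞) (by exact_mod_cast le_top)
  obtain ⟨u, hu, hfu⟩ := (contMDiffAt_iff_contMDiffOn_nhds (by simp)).1 h1
  obtain ⟨s, hsu, hso, hxs⟩ := mem_nhds_iff.1 hu
  have h2 := (hfu.mono hsu).contMDiffOn_tangentMapWithin (m := n) (by norm_cast)
    hso.uniqueMDiffOn
  have hpre : IsOpen (π EP (TangentSpace 𝓘(ℝ, EP) : P → Type _) ⁻¹' s) :=
    hso.preimage (FiberBundle.continuous_proj _ _)
  refine (h2.contMDiffAt (hpre.mem_nhds (show x ∈ s from hxs))).congr_of_eventuallyEq ?_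
  filter_upwards [hpre.mem_nhds (show (⟨x, v⟩ : TangentBundle 𝓘(ℝ, EP) P).1 ∈ s from hxs)]
    with z hz
  simp only [tangentMapWithin]
  rw [mfderivWithin_of_isOpen hso hz]
  rfl

/-- The image of a smooth family of tangent vectors under a smooth map. -/
theorem ContMDiffAt.tderiv_apply {f : P → N} {c : Q → P} {V : Q → EP} {q : Q}
    (hf : SmoothAt EP EN f (c q))
    (hV : ContMDiffAt 𝓘(ℝ, EQ) 𝓘(ℝ, EP).tangent ∞
      (fun k => (⟨c k, V k⟩ : TangentBundle 𝓘(ℝ, EP) P)) q) :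
    ContMDiffAt 𝓘(ℝ, EQ) 𝓘(ℝ, EN).tangent ∞
      (fun k => (⟨f (c k), tderiv EP EN f (c k) (V k)⟩ : TangentBundle 𝓘(ℝ, EN) N)) q :=
  ContMDiffAt.comp (x := q) (g := fun z : TangentBundle 𝓘(ℝ, EP) P =>
      (⟨f z.1, tderiv EP EN f z.1 z.2⟩ : TangentBundle 𝓘(ℝ, EN) N))
    (f := fun k => (⟨c k, V k⟩ : TangentBundle 𝓘(ℝ, EP) P)) (contMDiffAt_tangentMap' hf _) hV

theorem contMDiffAt_tangent_vectorSpace {c : Q → EN} {V : Q → EN} {q : Q}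
    (h : ContMDiffAt 𝓘(ℝ, EQ) 𝓘(ℝ, EN).tangent ∞
      (fun k => (⟨c k, V k⟩ : TangentBundle 𝓘(ℝ, EN) EN)) q) : SmoothAt EQ EN V q :=
  ContMDiffAt.comp (x := q) (g := fun z : TangentBundle 𝓘(ℝ, EN) EN => (z.2 : EN))
    (f := fun k => (⟨c k, V k⟩ : TangentBundle 𝓘(ℝ, EN) EN))
    (contMDiff_snd_tangentBundle_modelSpace EN 𝓘(ℝ, EN)).contMDiffAt h

theorem contMDiffAt_tangent_vectorSpace_mk {c : Q → EN} {V : Q → EN} {q : Q}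
    (hc : SmoothAt EQ EN c q) (hV : SmoothAt EQ EN V q) :
    ContMDiffAt 𝓘(ℝ, EQ) 𝓘(ℝ, EN).tangent ∞
      (fun k => (⟨c k, V k⟩ : TangentBundle 𝓘(ℝ, EN) EN)) q := by
  apply Bundle.contMDiffAt_totalSpace.2
  refine ⟨hc, ?_⟩
  convert! hV with y
  simp

end TangentMaps

/-! ### Charts as local diffeomorphisms -/

section Charts

variable {EN N : Type*} [NormedAddCommGroup EN] [NormedSpace ℝ EN] [TopologicalSpace N]
  [ChartedSpace EN N] [IsManifold 𝓘(ℝ, EN) ∞ N]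

theorem smoothAt_of_mem_maximalAtlas {φ : OpenPartialHomeomorph N EN}
    (hφ : φ ∈ IsManifold.maximalAtlas 𝓘(ℝ, EN) ∞ N) {x : N} (hx : x ∈ φ.source) :
    SmoothAt EN EN φ x :=
  (contMDiffOn_of_mem_maximalAtlas hφ).contMDiffAt (φ.open_source.mem_nhds hx)

theorem smoothAt_symm_of_mem_maximalAtlas {φ : OpenPartialHomeomorph N EN}
    (hφ : φ ∈ IsManifold.maximalAtlas 𝓘(ℝ, EN) ∞ N) {y : EN} (hy : y ∈ φ.target) :
    SmoothAt EN EN φ.symm y :=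
  (contMDiffOn_symm_of_mem_maximalAtlas hφ).contMDiffAt (φ.open_target.mem_nhds hy)

theorem tderiv_symm_tderiv {φ : OpenPartialHomeomorph N EN}
    (hφ : φ ∈ IsManifold.maximalAtlas 𝓘(ℝ, EN) ∞ N) {x : N} (hx : x ∈ φ.source) (v : EN) :
    tderiv EN EN φ.symm (φ x) (tderiv EN EN φ x v) = v := by
  rw [← tderiv_comp (smoothAt_symm_of_mem_maximalAtlas hφ (φ.map_source hx)).diffAt
    (smoothAt_of_mem_maximalAtlas hφ hx).diffAt]
  rw [tderiv_congr (g := fun y => y), tderiv_id]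
  filter_upwards [φ.open_source.mem_nhds hx] with y hy using φ.left_inv hy

theorem tderiv_tderiv_symm {φ : OpenPartialHomeomorph N EN}
    (hφ : φ ∈ IsManifold.maximalAtlas 𝓘(ℝ, EN) ∞ N) {y : EN} (hy : y ∈ φ.target) (v : EN) :
    tderiv EN EN φ (φ.symm y) (tderiv EN EN φ.symm y v) = v := by
  rw [← tderiv_comp (smoothAt_of_mem_maximalAtlas hφ (φ.map_target hy)).diffAt
    (smoothAt_symm_of_mem_maximalAtlas hφ hy).diffAt]
  rw [tderiv_congr (g := fun y => y), tderiv_id]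
  filter_upwards [φ.open_target.mem_nhds hy] with y hy using φ.right_inv hy

theorem chartAt_mem_maximalAtlas' (x : N) :
    chartAt EN x ∈ IsManifold.maximalAtlas 𝓘(ℝ, EN) ∞ N :=
  IsManifold.chart_mem_maximalAtlas x

/-- The tangent space at `x` is identified with the model space by this very chart. Hence forms,
fields and brackets at `x` can be computed in it with no change of coordinates at `x`. -/
theorem tderiv_chartAt_self (x : N) (v : EN) : tderiv EN EN (chartAt EN x) x v = v := by
  have : IsManifold 𝓘(ℝ, EN) 1 N := IsManifold.of_le (n := ∞) (by simp)
  have h := mfderiv_extChartAt_self (I := 𝓘(ℝ, EN)) (x := x)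
  have e : (extChartAt 𝓘(ℝ, EN) x : N → EN) = chartAt EN x := by
    ext y; simp [mfld_simps]
  rw [e] at h
  exact DFunLike.congr_fun h v

theorem tderiv_chartAt_symm_self (x : N) (v : EN) :
    tderiv EN EN (chartAt EN x).symm (chartAt EN x x) v = v := by
  conv_rhs => rw [← tderiv_symm_tderiv (chartAt_mem_maximalAtlas' x) (mem_chart_source EN x) v]
  rw [tderiv_chartAt_self]

end Charts

/-! ### Vector-valued one-forms and their exterior derivatives -/

section OneForms

variable {EN N F : Type*} [NormedAddCommGroup EN] [NormedSpace ℝ EN] [FiniteDimensional ℝ EN]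
  [TopologicalSpace N] [ChartedSpace EN N] [IsManifold 𝓘(ℝ, EN) ∞ N]
  [NormedAddCommGroup F] [NormedSpace ℝ F]

/-- The one-form `η` is smooth at `x`. -/
def SmoothFormAt (η : N → EN →L[ℝ] F) (x : N) : Prop :=
  ∀ v : EN, ContMDiffAt 𝓘(ℝ, EN).tangent 𝓘(ℝ, F) ∞
    (fun z : TangentBundle 𝓘(ℝ, EN) N => η z.1 z.2) ⟨x, v⟩

theorem SmoothFormAt.apply {EQ Q : Type*} [NormedAddCommGroup EQ] [NormedSpace ℝ EQ]
    [TopologicalSpace Q] [ChartedSpace EQ Q]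
    {η : N → EN →L[ℝ] F} {c : Q → N} {V : Q → EN} {q : Q} (hη : SmoothFormAt η (c q))
    (hV : ContMDiffAt 𝓘(ℝ, EQ) 𝓘(ℝ, EN).tangent ∞
      (fun k => (⟨c k, V k⟩ : TangentBundle 𝓘(ℝ, EN) N)) q) :
    SmoothAt EQ F (fun k => η (c k) (V k)) q :=
  ContMDiffAt.comp (x := q) (g := fun z : TangentBundle 𝓘(ℝ, EN) N => η z.1 z.2)
    (f := fun k => (⟨c k, V k⟩ : TangentBundle 𝓘(ℝ, EN) N)) (hη _) hV

/-- The one-form `η` in the chart `φ`. -/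
noncomputable def chartForm (η : N → EN →L[ℝ] F) (φ : OpenPartialHomeomorph N EN) (y : EN) :
    EN →L[ℝ] F := (η (φ.symm y)).comp (tderiv EN EN φ.symm y)

/-- The exterior derivative of the one-form `η`. -/
noncomputable def extD (η : N → EN →L[ℝ] F) (x : N) (u v : EN) : F :=
  fderiv ℝ (chartForm η (chartAt EN x)) (chartAt EN x x) u v -
    fderiv ℝ (chartForm η (chartAt EN x)) (chartAt EN x x) v u

/-- A family of linear maps on a finite-dimensional space is smooth if it is so pointwise. -/
theorem contMDiffAt_clm_of_apply {EQ Q V : Type*} [NormedAddCommGroup EQ] [NormedSpace ℝ EQ]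
    [TopologicalSpace Q] [ChartedSpace EQ Q] [NormedAddCommGroup V] [NormedSpace ℝ V]
    [FiniteDimensional ℝ V] {T : Q → V →L[ℝ] F} {q : Q}
    (h : ∀ v, SmoothAt EQ F (fun k => T k v) q) : SmoothAt EQ (V →L[ℝ] F) T q := by
  let b := Module.finBasis ℝ V
  have e : T = fun k => ∑ i, (ContinuousLinearMap.smulRightL ℝ V F
      (LinearMap.toContinuousLinearMap (b.coord i))) (T k (b i)) := by
    funext k
    ext v
    conv_lhs => rw [← b.sum_repr v]
    simp only [map_sum, map_smul, sum_apply]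
    rfl
  rw [e]
  refine ContMDiffAt.sum fun i _ => ?_
  exact ((ContinuousLinearMap.contMDiff _).contMDiffAt).comp q (h (b i))

theorem contDiffAt_chartForm {η : N → EN →L[ℝ] F} {φ : OpenPartialHomeomorph N EN}
    (hφ : φ ∈ IsManifold.maximalAtlas 𝓘(ℝ, EN) ∞ N) {y : EN} (hy : y ∈ φ.target)
    (hη : SmoothFormAt η (φ.symm y)) : ContDiffAt ℝ ∞ (chartForm η φ) y := by
  rw [← contMDiffAt_iff_contDiffAt]
  refine contMDiffAt_clm_of_apply fun v => ?_
  exact hη.apply (c := φ.symm) (V := fun y => tderiv EN EN φ.symm y v)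
    (ContMDiffAt.tderiv_apply (c := fun y => y) (V := fun _ => v)
      (smoothAt_symm_of_mem_maximalAtlas hφ hy)
      (contMDiffAt_tangent_vectorSpace_mk contMDiffAt_id contMDiffAt_const))

section

variable (η : N → EN →L[ℝ] F) (x : N)

theorem extD_add_left (u u' v : EN) : extD η x (u + u') v = extD η x u v + extD η x u' v := by
  simp only [extD, map_add, add_apply]; abel

theorem extD_swap (u v : EN) : extD η x u v = -extD η x v u := by simp [extD]

theorem extD_add_right (u v v' : EN) : extD η x u (v + v') = extD η x u v + extD η x u v' := by
  simp only [extD, map_add, add_apply]; abel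

theorem extD_sub_left (u u' v : EN) : extD η x (u - u') v = extD η x u v - extD η x u' v := by
  simp only [extD, map_sub, sub_apply]; abel

theorem extD_sub_right (u v v' : EN) : extD η x u (v - v') = extD η x u v - extD η x u v' := by
  simp only [extD, map_sub, sub_apply]; abel

theorem extD_smul_right (u v : EN) (r : ℝ) : extD η x u (r • v) = r • extD η x u v := by
  simp only [extD, map_smul, smul_apply, smul_sub]

theorem extD_sum_right {ι : Type*} (s : Finset ι) (u : EN) (v : ι → EN) :
    extD η x u (∑ i ∈ s, v i) = ∑ i ∈ s, extD η x u (v i) := by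
  simp only [extD, map_sum, sum_apply, Finset.sum_sub_distrib]

theorem extD_congr {η η' : N → EN →L[ℝ] F} {x : N} (h : η =ᶠ[𝓝 x] η') :
    extD η x = extD η' x := by
  have : chartForm η (chartAt EN x) =ᶠ[𝓝 (chartAt EN x x)] chartForm η' (chartAt EN x) := by
    have hc : Filter.Tendsto (chartAt EN x).symm (𝓝 (chartAt EN x x)) (𝓝 x) := by
      have := (chartAt EN x).continuousAt_symm (mem_chart_target EN x)
      rwa [ContinuousAt, (chartAt EN x).left_inv (mem_chart_source EN x)] at this
    filter_upwards [hc.eventually h] with y hy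
    simp only [chartForm, hy]
  funext u v
  simp only [extD, this.fderiv_eq]

end

theorem extD_zero (x : N) (u v : EN) : extD (fun _ : N => (0 : EN →L[ℝ] F)) x u v = 0 := by
  have : chartForm (fun _ : N => (0 : EN →L[ℝ] F)) (chartAt EN x) = fun _ => 0 := by
    funext y
    simp [chartForm]
  simp [extD, this]

theorem extD_sub {η η' : N → EN →L[ℝ] F} {x : N} (hη : SmoothFormAt η x)
    (hη' : SmoothFormAt η' x) (u v : EN) :
    extD (fun k => η k - η' k) x u v = extD η x u v - extD η' x u v := by
  have e : chartForm (fun k => η k - η' k) (chartAt EN x) =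
      fun y => chartForm η (chartAt EN x) y - chartForm η' (chartAt EN x) y := by
    funext y
    simp [chartForm, ContinuousLinearMap.sub_comp]
  have hx : (chartAt EN x).symm (chartAt EN x x) = x :=
    (chartAt EN x).left_inv (mem_chart_source EN x)
  have h1 := (contDiffAt_chartForm (η := η) (chartAt_mem_maximalAtlas' x)
    (mem_chart_target EN x) (by rwa [hx])).differentiableAt (by simp)
  have h2 := (contDiffAt_chartForm (η := η') (chartAt_mem_maximalAtlas' x)
    (mem_chart_target EN x) (by rwa [hx])).differentiableAt (by simp)
  simp only [extD, e]
  rw [fderiv_fun_sub h1 h2]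
  simp only [sub_apply]
  abel

/-- Naturality of the exterior derivative, for maps defined on a vector space. -/
theorem extD_tderiv {V : Type*} [NormedAddCommGroup V] [NormedSpace ℝ V]
    {η : N → EN →L[ℝ] F} {f : V → N} {q : V}
    (hη : SmoothFormAt η (f q)) (hf : SmoothAt V EN f q) (a b : V) :
    extD η (f q) (tderiv V EN f q a) (tderiv V EN f q b) =
      fderiv ℝ (fun k => η (f k) (tderiv V EN f k b)) q a -
        fderiv ℝ (fun k => η (f k) (tderiv V EN f k a)) q b := by
  set x := f q
  set φ := chartAt EN x
  have hφ : φ ∈ IsManifold.maximalAtlas 𝓘(ℝ, EN) ∞ N := chartAt_mem_maximalAtlas' x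
  have hx : φ.symm (φ x) = x := φ.left_inv (mem_chart_source EN x)
  have hW : DifferentiableAt ℝ (chartForm η φ) (φ x) :=
    (contDiffAt_chartForm hφ (mem_chart_target EN x) (by rwa [hx])).differentiableAt (by simp)
  let g : V → EN := fun k => φ (f k)
  have hg : ContDiffAt ℝ ∞ g q := by
    rw [← contMDiffAt_iff_contDiffAt]
    exact (smoothAt_of_mem_maximalAtlas hφ (mem_chart_source EN x)).comp q hf
  have hg' : DifferentiableAt ℝ (fderiv ℝ g) q :=
    (hg.fderiv_right (m := 1) (by norm_cast)).differentiableAt (by simp)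
  have hsymm : IsSymmSndFDerivAt ℝ g q := hg.isSymmSndFDerivAt
    (by simp only [minSmoothness_of_isRCLikeNormedField]; exact WithTop.coe_le_coe.2 (le_top : (2 : ℕ∞) ≤ ⊤))
  have hfd : ∀ᶠ k in 𝓝 q, DiffAt V EN f k := by
    have := (contMDiffAt_iff_contMDiffAt_nhds (n := 1) (by simp)).1
      (hf.of_le (by simp : (1 : WithTop ℕ∞) ≤ ∞))
    filter_upwards [this] with k hk using hk.mdifferentiableAt (by simp)
  -- With W the form in the chart and g the coordinate expression of f, the function to
  -- differentiate is W(g k)(Dg_k c).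
  have key : ∀ c : V, (fun k => η (f k) (tderiv V EN f k c)) =ᶠ[𝓝 q]
      fun k => chartForm η φ (g k) (fderiv ℝ g k c) := by
    intro c
    filter_upwards [hfd, hf.continuousAt.eventually (φ.open_source.mem_nhds
      (mem_chart_source EN x))] with k hk hkφ
    have h1 : fderiv ℝ g k c = tderiv EN EN φ (f k) (tderiv V EN f k c) := by
      rw [← tderiv_eq_fderiv]
      exact tderiv_comp (smoothAt_of_mem_maximalAtlas hφ hkφ).diffAt hk c
    have h2 : φ.symm (g k) = f k := φ.left_inv hkφ
    simp only [chartForm, ContinuousLinearMap.comp_apply]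
    rw [h1, tderiv_symm_tderiv hφ hkφ, h2]
  have hga : ∀ c : V, fderiv ℝ g q c = tderiv V EN f q c := by
    intro c
    have h1 : fderiv ℝ g q c = tderiv EN EN φ (f q) (tderiv V EN f q c) := by
      rw [← tderiv_eq_fderiv]
      exact tderiv_comp (smoothAt_of_mem_maximalAtlas hφ (mem_chart_source EN x)).diffAt
        hf.diffAt c
    rw [h1]
    exact tderiv_chartAt_self x _
  have key2 : ∀ c d : V, fderiv ℝ (fun k => η (f k) (tderiv V EN f k c)) q d =
      fderiv ℝ (chartForm η φ) (φ x) (tderiv V EN f q d) (tderiv V EN f q c) +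
        chartForm η φ (φ x) (fderiv ℝ (fderiv ℝ g) q d c) := by
    intro c d
    rw [(key c).fderiv_eq]
    have hWg : HasFDerivAt (fun k => chartForm η φ (g k))
        ((fderiv ℝ (chartForm η φ) (φ x)).comp (fderiv ℝ g q)) q :=
      HasFDerivAt.comp (g := chartForm η φ) (f := g) (x := q) hW.hasFDerivAt
        (hg.differentiableAt (by simp)).hasFDerivAt
    have hgc : HasFDerivAt (fun k => fderiv ℝ g k c)
        ((fderiv ℝ (fderiv ℝ g) q).flip c) q := by
      simpa using hg'.hasFDerivAt.clm_apply (hasFDerivAt_const c q)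
    rw [(hWg.clm_apply hgc).fderiv]
    simp only [add_apply, ContinuousLinearMap.comp_apply,
      ContinuousLinearMap.flip_apply, hga]
    rw [add_comm]
  -- The terms containing D²g are symmetric in a and b, so they cancel and only dη remains.
  rw [key2, key2, hsymm.eq a b]
  simp only [extD]
  abel

/-- The coordinate expression of a vector field in the preferred chart around `x`. -/
noncomputable def chartField (x : N) (X : N → EN) (y : EN) : EN :=
  tderiv EN EN (chartAt EN x) ((chartAt EN x).symm y) (X ((chartAt EN x).symm y))

theorem contDiffAt_chartField {X : N → EN} {x : N} (hX : SmoothFieldAt X x) :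
    ContDiffAt ℝ ∞ (chartField x X) (chartAt EN x x) := by
  rw [← contMDiffAt_iff_contDiffAt]
  have hx : (chartAt EN x).symm (chartAt EN x x) = x :=
    (chartAt EN x).left_inv (mem_chart_source EN x)
  refine contMDiffAt_tangent_vectorSpace (c := fun y => chartAt EN x ((chartAt EN x).symm y)) ?_
  refine ContMDiffAt.tderiv_apply (c := (chartAt EN x).symm)
    (V := fun y => X ((chartAt EN x).symm y)) ?_ ?_
  · rw [hx]
    exact smoothAt_of_mem_maximalAtlas (chartAt_mem_maximalAtlas' x) (mem_chart_source EN x)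
  · refine ContMDiffAt.comp (x := chartAt EN x x) (f := (chartAt EN x).symm)
      (g := fun k => (⟨k, X k⟩ : TangentBundle 𝓘(ℝ, EN) N)) ?_
      (smoothAt_symm_of_mem_maximalAtlas (chartAt_mem_maximalAtlas' x) (mem_chart_target EN x))
    rwa [hx]

/-- The Lie bracket of vector fields, with values in the model space. -/
noncomputable def fieldBracket (X Y : N → EN) (x : N) : EN :=
  VectorField.mlieBracket 𝓘(ℝ, EN) X Y x

/-- The preferred chart at `x` has identity derivative there, so the manifold bracket at `x` is the
bracket of the coordinate expressions. -/
theorem fieldBracket_eq_lieBracket_chartField (X Y : N → EN) (x : N) :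
    fieldBracket X Y x =
      VectorField.lieBracket ℝ (chartField x X) (chartField x Y) (chartAt EN x x) := by
  have : IsManifold 𝓘(ℝ, EN) 1 N := IsManifold.of_le (n := ∞) (by simp)
  have e : (extChartAt 𝓘(ℝ, EN) x : N → EN) = chartAt EN x := by
    ext y; simp [mfld_simps]
  have e' : ((extChartAt 𝓘(ℝ, EN) x).symm : EN → N) = (chartAt EN x).symm := by
    ext y; simp [mfld_simps]
  have h0 : tderiv EN EN (chartAt EN x) x = ContinuousLinearMap.id ℝ EN :=
    ContinuousLinearMap.ext (tderiv_chartAt_self x)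
  have h1 : ∀ Z : N → EN, VectorField.mpullbackWithin 𝓘(ℝ, EN) 𝓘(ℝ, EN) (chartAt EN x).symm Z
      (range 𝓘(ℝ, EN)) =ᶠ[𝓝 (chartAt EN x x)] chartField x Z := by
    intro Z
    filter_upwards [(chartAt EN x).open_target.mem_nhds (mem_chart_target EN x)] with y hy
    have hφ := chartAt_mem_maximalAtlas' (EN := EN) x
    have hys : (chartAt EN x).symm y ∈ (chartAt EN x).source := (chartAt EN x).map_target hy
    let T : EN ≃L[ℝ] EN := ContinuousLinearEquiv.equivOfInverse
      (tderiv EN EN (chartAt EN x).symm y) (tderiv EN EN (chartAt EN x) ((chartAt EN x).symm y))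
      (fun v => tderiv_tderiv_symm hφ hy v)
      (fun v => by
        have := tderiv_symm_tderiv hφ hys v
        rwa [(chartAt EN x).right_inv hy] at this)
    have hT : mfderiv 𝓘(ℝ, EN) 𝓘(ℝ, EN) (chartAt EN x).symm y = (T : EN →L[ℝ] EN) := rfl
    simp only [VectorField.mpullbackWithin, modelWithCornersSelf_coe, range_id,
      mfderivWithin_univ, hT]
    exact congrArg (fun T : EN →L[ℝ] EN => T (Z ((chartAt EN x).symm y)))
      (ContinuousLinearMap.inverse_equiv T)
  -- The arguments are kept arbitrary because those of `mlieBracketWithin_apply` match the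
  -- coordinate fields only as germs or after rewriting the chart.
  have gen : ∀ (T : EN →L[ℝ] EN) (A B : EN → EN) (s : Set EN) (y : EN),
      T = ContinuousLinearMap.id ℝ EN → y = chartAt EN x x →
      A =ᶠ[𝓝 (chartAt EN x x)] chartField x X → B =ᶠ[𝓝 (chartAt EN x x)] chartField x Y →
      s = univ → T.inverse (VectorField.lieBracketWithin ℝ A B s y) =
        VectorField.lieBracket ℝ (chartField x X) (chartField x Y) (chartAt EN x x) := by
    rintro T A B s y rfl rfl hA hB rfl
    rw [ContinuousLinearMap.inverse_id, VectorField.lieBracketWithin_univ,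
      hA.lieBracket_vectorField_eq hB]
    rfl
  refine Eq.trans (VectorField.mlieBracketWithin_apply (I := 𝓘(ℝ, EN)) (V := X) (W := Y)
    (s := univ) (x₀ := x)) (gen _ _ _ _ _ (by rw [e]; exact h0) (by rw [e]) ?_ ?_ (by simp))
  · rw [e']; exact h1 X
  · rw [e']; exact h1 Y

/-- The exterior derivative evaluated on vector fields. -/
theorem extD_apply_fields {η : N → EN →L[ℝ] F} {x : N} (hη : SmoothFormAt η x)
    {X Y : N → EN} (hX : SmoothFieldAt X x) (hY : SmoothFieldAt Y x) :
    extD η x (X x) (Y x) = tderiv EN F (fun k => η k (Y k)) x (X x) -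
      tderiv EN F (fun k => η k (X k)) x (Y x) -
      η x (fieldBracket X Y x) := by
  set φ := chartAt EN x
  have hφ : φ ∈ IsManifold.maximalAtlas 𝓘(ℝ, EN) ∞ N := chartAt_mem_maximalAtlas' x
  have hxs : x ∈ φ.source := mem_chart_source EN x
  have hx : φ.symm (φ x) = x := φ.left_inv hxs
  have hW : DifferentiableAt ℝ (chartForm η φ) (φ x) :=
    (contDiffAt_chartForm hφ (mem_chart_target EN x) (by rwa [hx])).differentiableAt (by simp)
  have hval : ∀ Z : N → EN, chartField x Z (φ x) = Z x := by
    intro Z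
    simp only [chartField]
    rw [show (chartAt EN x).symm (φ x) = x from hx, tderiv_chartAt_self]
  have hW0 : ∀ v, chartForm η φ (φ x) v = η x v := by
    intro v
    simp only [chartForm, ContinuousLinearMap.comp_apply, hx]
    rw [tderiv_chartAt_symm_self]
  -- Product rule in the chart. Antisymmetrized, the first term gives dη and the second the bracket.
  have key : ∀ Z : N → EN, SmoothFieldAt Z x → ∀ v, tderiv EN F (fun k => η k (Z k)) x v =
      fderiv ℝ (chartForm η φ) (φ x) v (Z x) +
        η x (fderiv ℝ (chartField x Z) (φ x) v) := by
    intro Z hZ v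
    have hZd : DifferentiableAt ℝ (chartField x Z) (φ x) :=
      (contDiffAt_chartField hZ).differentiableAt (by simp)
    have h1 : (fun k => η k (Z k)) =ᶠ[𝓝 x]
        fun k => (fun y => chartForm η φ y (chartField x Z y)) (φ k) := by
      filter_upwards [φ.open_source.mem_nhds hxs] with k hk
      have hk' : φ.symm (φ k) = k := φ.left_inv hk
      simp only [chartForm, chartField, ContinuousLinearMap.comp_apply]
      rw [show (chartAt EN x).symm (φ k) = k from hk', tderiv_symm_tderiv hφ hk]
    have h2 := hW.hasFDerivAt.clm_apply hZd.hasFDerivAt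
    rw [tderiv_congr h1, tderiv_comp (EN := EN) h2.differentiableAt.mdifferentiableAt
      (smoothAt_of_mem_maximalAtlas hφ hxs).diffAt, tderiv_chartAt_self, tderiv_eq_fderiv,
      h2.fderiv]
    simp only [add_apply, ContinuousLinearMap.comp_apply,
      ContinuousLinearMap.flip_apply, hW0, hval]
    rw [add_comm]
  rw [key Y hY, key X hX, fieldBracket_eq_lieBracket_chartField, VectorField.lieBracket]
  have e3 : η x (fderiv ℝ (chartField x Y) (φ x) (chartField x X (φ x)) -
      fderiv ℝ (chartField x X) (φ x) (chartField x Y (φ x))) =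
      η x (fderiv ℝ (chartField x Y) (φ x) (X x)) - η x (fderiv ℝ (chartField x X) (φ x) (Y x)) := by
    rw [hval, hval, map_sub]
  rw [e3]
  simp only [extD]
  abel

/-- The differential of a function is closed. -/
theorem extD_tderiv_self {f : N → F} {x : N} (hf : SmoothAt EN F f x) (u v : EN) :
    extD (fun k => tderiv EN F f k) x u v = 0 := by
  have hx : (chartAt EN x).symm (chartAt EN x x) = x :=
    (chartAt EN x).left_inv (mem_chart_source EN x)
  have hg : ContDiffAt ℝ ∞ (fun y => f ((chartAt EN x).symm y)) (chartAt EN x x) := by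
    rw [← contMDiffAt_iff_contDiffAt]
    refine ContMDiffAt.comp (x := chartAt EN x x) (g := f) (f := (chartAt EN x).symm) ?_
      (smoothAt_symm_of_mem_maximalAtlas (chartAt_mem_maximalAtlas' x) (mem_chart_target EN x))
    rwa [hx]
  have hfd : ∀ᶠ k in 𝓝 ((chartAt EN x).symm (chartAt EN x x)), DiffAt EN F f k := by
    rw [hx]
    have := (contMDiffAt_iff_contMDiffAt_nhds (n := 1) (by simp)).1
      (hf.of_le (by simp : (1 : WithTop ℕ∞) ≤ ∞))
    filter_upwards [this] with k hk using hk.mdifferentiableAt (by simp)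
  -- In the chart df is the derivative of f ∘ φ⁻¹, so closedness is the symmetry of second
  -- derivatives.
  have e : chartForm (fun k => tderiv EN F f k) (chartAt EN x) =ᶠ[𝓝 (chartAt EN x x)]
      fderiv ℝ (fun y => f ((chartAt EN x).symm y)) := by
    filter_upwards [(chartAt EN x).open_target.mem_nhds (mem_chart_target EN x),
      ((chartAt EN x).continuousAt_symm (mem_chart_target EN x)).eventually hfd] with y hy hfy
    ext v
    rw [← tderiv_eq_fderiv, tderiv_comp hfy
      (smoothAt_symm_of_mem_maximalAtlas (chartAt_mem_maximalAtlas' x) hy).diffAt]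
    rfl
  have hsymm : IsSymmSndFDerivAt ℝ (fun y => f ((chartAt EN x).symm y)) (chartAt EN x x) :=
    hg.isSymmSndFDerivAt
    (by simp only [minSmoothness_of_isRCLikeNormedField]; exact WithTop.coe_le_coe.2 (le_top : (2 : ℕ∞) ≤ ⊤))
  simp only [extD, e.fderiv_eq]
  rw [hsymm.eq u v, sub_self]

end OneForms

/-! ### Pull-backs of forms; extension of vectors to fields -/

section Pullbacks

variable {EN N EP P F : Type*} [NormedAddCommGroup EN] [NormedSpace ℝ EN] [FiniteDimensional ℝ EN]
  [TopologicalSpace N] [ChartedSpace EN N] [IsManifold 𝓘(ℝ, EN) ∞ N]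
  [NormedAddCommGroup EP] [NormedSpace ℝ EP] [FiniteDimensional ℝ EP]
  [TopologicalSpace P] [ChartedSpace EP P] [IsManifold 𝓘(ℝ, EP) ∞ P]
  [NormedAddCommGroup F] [NormedSpace ℝ F]

theorem SmoothAt.eventually_diffAt {f : P → N} {x : P} (hf : SmoothAt EP EN f x) :
    ∀ᶠ k in 𝓝 x, DiffAt EP EN f k := by
  have : IsManifold 𝓘(ℝ, EN) 1 N := IsManifold.of_le (n := ∞) (by simp)
  have : IsManifold 𝓘(ℝ, EP) 1 P := IsManifold.of_le (n := ∞) (by simp)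
  have := (contMDiffAt_iff_contMDiffAt_nhds (n := 1) (by simp)).1
    (hf.of_le (by simp : (1 : WithTop ℕ∞) ≤ ∞))
  filter_upwards [this] with k hk using hk.mdifferentiableAt (by simp)

/-- The tangent map of a smooth map, applied to a constant vector of the model space when the
source is a vector space. -/
theorem SmoothAt.tderiv_const {V : Type*} [NormedAddCommGroup V] [NormedSpace ℝ V] {f : V → N}
    {q : V} (hf : SmoothAt V EN f q) (v : V) :
    ContMDiffAt 𝓘(ℝ, V) 𝓘(ℝ, EN).tangent ∞
      (fun k => (⟨f k, tderiv V EN f k v⟩ : TangentBundle 𝓘(ℝ, EN) N)) q :=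
  ContMDiffAt.tderiv_apply (c := fun y => y) (V := fun _ => v) hf
    (contMDiffAt_tangent_vectorSpace_mk contMDiffAt_id contMDiffAt_const)

/-- A germ of a map with prescribed differential. -/
theorem exists_smoothAt_tderiv_eq {V : Type*} [NormedAddCommGroup V] [NormedSpace ℝ V]
    (x : N) (L : V →L[ℝ] EN) :
    ∃ f : V → N, f 0 = x ∧ SmoothAt V EN f 0 ∧ ∀ v, tderiv V EN f 0 v = L v := by
  set φ := chartAt EN x
  have hx : φ.symm (φ x) = x := φ.left_inv (mem_chart_source EN x)
  have hs : SmoothAt EN EN φ.symm (φ x) :=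
    smoothAt_symm_of_mem_maximalAtlas (chartAt_mem_maximalAtlas' x) (mem_chart_target EN x)
  have hg : ContDiff ℝ ∞ (fun v => φ x + L v) := contDiff_const.add L.contDiff
  have hg0 : φ x + L 0 = φ x := by simp
  refine ⟨fun v => φ.symm (φ x + L v), by simp [hx], ?_, fun v => ?_⟩
  · exact ContMDiffAt.comp (x := (0 : V)) (g := φ.symm) (f := fun v => φ x + L v)
      (by rwa [hg0]) hg.contMDiff.contMDiffAt
  · rw [tderiv_comp (EN := EN) (g := φ.symm) (by rw [hg0]; exact hs.diffAt)
      (hg.contMDiff.contMDiffAt.mdifferentiableAt (by simp)), hg0, tderiv_chartAt_symm_self,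
      tderiv_eq_fderiv]
    simp

/-- The pull-back of a one-form. -/
noncomputable def pullbackForm (p : P → N) (η : N → EN →L[ℝ] F) (k : P) : EP →L[ℝ] F :=
  (η (p k)).comp (tderiv EP EN p k)

theorem SmoothFormAt.pullbackForm {p : P → N} {η : N → EN →L[ℝ] F} {x : P}
    (hp : SmoothAt EP EN p x) (hη : SmoothFormAt η (p x)) :
    SmoothFormAt (pullbackForm p η : P → EP →L[ℝ] F) x := fun v =>
  ContMDiffAt.comp (x := (⟨x, v⟩ : TangentBundle 𝓘(ℝ, EP) P))
    (g := fun z : TangentBundle 𝓘(ℝ, EN) N => η z.1 z.2)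
    (f := fun z : TangentBundle 𝓘(ℝ, EP) P =>
        (⟨p z.1, tderiv EP EN p z.1 z.2⟩ : TangentBundle 𝓘(ℝ, EN) N))
    (hη _) (contMDiffAt_tangentMap' hp v)

/-- Naturality is tested on a germ ℝ² → P with partial derivatives u and v: there both sides are
antisymmetrized derivatives of the same functions, by `extD_tderiv` for the form and for its
pull-back. -/
theorem extD_pullbackForm {p : P → N} {η : N → EN →L[ℝ] F} {x : P}
    (hp : SmoothAt EP EN p x) (hη : SmoothFormAt η (p x)) (u v : EP) :
    extD (pullbackForm p η : P → EP →L[ℝ] F) x u v =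
      extD η (p x) (tderiv EP EN p x u) (tderiv EP EN p x v) := by
  let L : ℝ × ℝ →L[ℝ] EP := (ContinuousLinearMap.fst ℝ ℝ ℝ).smulRight u +
    (ContinuousLinearMap.snd ℝ ℝ ℝ).smulRight v
  obtain ⟨f, hf0, hf, hfL⟩ := exists_smoothAt_tderiv_eq x L
  have hu : u = tderiv (ℝ × ℝ) EP f 0 (1, 0) := by rw [hfL]; simp [L]
  have hv : v = tderiv (ℝ × ℝ) EP f 0 (0, 1) := by rw [hfL]; simp [L]
  have hpf : SmoothAt (ℝ × ℝ) EN (fun q => p (f q)) 0 :=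
    ContMDiffAt.comp (x := (0 : ℝ × ℝ)) (g := p) (f := f) (by rwa [hf0]) hf
  subst hf0
  have h1 := extD_tderiv (SmoothFormAt.pullbackForm hp hη) hf (1, 0) (0, 1)
  have h2 := extD_tderiv (f := fun q => p (f q)) hη hpf (1, 0) (0, 1)
  have key : ∀ c : ℝ × ℝ, (fun k => pullbackForm p η (f k) (tderiv (ℝ × ℝ) EP f k c)) =ᶠ[𝓝 0]
      fun k => η (p (f k)) (tderiv (ℝ × ℝ) EN (fun q => p (f q)) k c) := by
    intro c
    filter_upwards [hf.eventually_diffAt, hf.continuousAt.eventually hp.eventually_diffAt]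
      with k hk hk'
    rw [tderiv_comp hk' hk]
    rfl
  rw [(key _).fderiv_eq, (key _).fderiv_eq] at h1
  rw [tderiv_comp hp.diffAt hf.diffAt, tderiv_comp hp.diffAt hf.diffAt] at h2
  rw [hu, hv, h1, ← h2]

/-- The vector field with a given coordinate expression in the preferred chart around `x`. -/
theorem smoothFieldAt_of_chart {x k : N} (hk : k ∈ (chartAt EN x).source) {Z : EN → EN}
    (hZ : ContDiffAt ℝ ∞ Z (chartAt EN x k)) :
    SmoothFieldAt (fun k => tderiv EN EN (chartAt EN x).symm (chartAt EN x k)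
      (Z (chartAt EN x k))) k := by
  have hφ := chartAt_mem_maximalAtlas' (EN := EN) x
  have hc := smoothAt_of_mem_maximalAtlas hφ hk
  have h := ContMDiffAt.tderiv_apply (c := chartAt EN x) (V := fun k => Z (chartAt EN x k))
    (smoothAt_symm_of_mem_maximalAtlas hφ ((chartAt EN x).map_source hk))
    (contMDiffAt_tangent_vectorSpace_mk hc (hZ.contMDiffAt.comp k hc))
  refine h.congr_of_eventuallyEq ?_
  filter_upwards [(chartAt EN x).open_source.mem_nhds hk] with m hm
  have : (chartAt EN x).symm (chartAt EN x m) = m := (chartAt EN x).left_inv hm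
  exact tangentBundle_mk_congr this.symm rfl

/-- A tangent vector extends to a vector field. -/
theorem exists_smoothField (x : N) (X : EN) :
    ∃ V : N → EN, V x = X ∧ ∀ᶠ k in 𝓝 x, SmoothFieldAt V k :=
  ⟨fun k => tderiv EN EN (chartAt EN x).symm (chartAt EN x k) X, tderiv_chartAt_symm_self x X, by
    filter_upwards [(chartAt EN x).open_source.mem_nhds (mem_chart_source EN x)] with k hk
    exact smoothFieldAt_of_chart hk contDiffAt_const⟩

/-- A vector in the kernel of a surjective one-form extends to a vector field in the kernel. -/
theorem exists_smoothField_ker [FiniteDimensional ℝ F] {η : N → EN →L[ℝ] F} {x : N}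
    (hη : ∀ᶠ k in 𝓝 x, SmoothFormAt η k) (hs : Function.Surjective (η x)) {X : EN}
    (hX : η x X = 0) :
    ∃ V : N → EN, V x = X ∧ (∀ᶠ k in 𝓝 x, SmoothFieldAt V k) ∧ ∀ᶠ k in 𝓝 x, η k (V k) = 0 := by
  have hφ := chartAt_mem_maximalAtlas' (EN := EN) x
  set φ := chartAt EN x
  have hxs : x ∈ φ.source := mem_chart_source EN x
  have hx : φ.symm (φ x) = x := φ.left_inv hxs
  obtain ⟨B₀, hB₀⟩ := (η x : EN →ₗ[ℝ] F).exists_rightInverse_of_surjective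
    (LinearMap.range_eq_top.2 hs)
  let B : F →L[ℝ] EN := B₀.toContinuousLinearMap
  have hB : ∀ f, η x (B f) = f := fun f => DFunLike.congr_fun hB₀ f
  -- B is a right inverse of the form at `x`, so T is the identity at φ(x) and invertible nearby.
  let T : EN → F →L[ℝ] F := fun y => (chartForm η φ y).comp B
  have hW0 : chartForm η φ (φ x) = η x := by
    ext v
    simp only [chartForm, ContinuousLinearMap.comp_apply, hx]
    rw [tderiv_chartAt_symm_self]
  have hT0 : T (φ x) = (ContinuousLinearEquiv.refl ℝ F : F →L[ℝ] F) := by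
    ext f
    simp only [T, hW0, ContinuousLinearMap.comp_apply, hB]
    rfl
  have hWs : ∀ᶠ y in 𝓝 (φ x), ContDiffAt ℝ ∞ (chartForm η φ) y := by
    have hc := φ.continuousAt_symm (mem_chart_target EN x)
    rw [ContinuousAt, hx] at hc
    filter_upwards [hc.eventually hη, φ.open_target.mem_nhds (mem_chart_target EN x)] with y h1 h2
    exact contDiffAt_chartForm hφ h2 h1
  have hTc : ContinuousAt T (φ x) :=
    (hWs.self_of_nhds.continuousAt).clm_comp continuousAt_const
  have hTi : ∀ᶠ y in 𝓝 (φ x), (T y).IsInvertible := by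
    have : {S : F →L[ℝ] F | S.IsInvertible} ∈ 𝓝 (T (φ x)) := by
      refine (ContinuousLinearEquiv.isOpen (𝕜 := ℝ) (E := F) (F := F)).mem_nhds ?_
      exact ⟨_, hT0.symm⟩
    exact hTc.eventually this
  -- The constant field X corrected along the image of B so that the form kills it; the correction
  -- is zero at φ(x) because the form kills X there.
  let Z : EN → EN := fun y => X - B ((T y).inverse (chartForm η φ y X))
  have hZs : ∀ᶠ y in 𝓝 (φ x), ContDiffAt ℝ ∞ Z y := by
    filter_upwards [hWs, hTi] with y hy hyi
    obtain ⟨S, hS⟩ := hyi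
    have hTy : ContDiffAt ℝ ∞ T y := hy.clm_comp contDiffAt_const
    have hinv : ContDiffAt ℝ ∞ (fun y => (T y).inverse) y := by
      have : ContDiffAt ℝ ∞ (ContinuousLinearMap.inverse (R := ℝ)) (T y) :=
        hS ▸ contDiffAt_map_inverse S
      exact this.comp y hTy
    exact contDiffAt_const.sub (B.contDiff.contDiffAt.comp y
      (hinv.clm_apply (hy.clm_apply contDiffAt_const)))
  have hcx : Filter.Tendsto φ (𝓝 x) (𝓝 (φ x)) := φ.continuousAt hxs
  refine ⟨fun k => tderiv EN EN φ.symm (φ k) (Z (φ k)), ?_, ?_, ?_⟩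
  · show tderiv EN EN φ.symm (φ x) (Z (φ x)) = X
    rw [tderiv_chartAt_symm_self]
    simp [Z, hW0, hX]
  · filter_upwards [hcx.eventually hZs, φ.open_source.mem_nhds hxs] with k hk hks
    exact smoothFieldAt_of_chart hks hk
  · filter_upwards [hcx.eventually hTi, φ.open_source.mem_nhds hxs] with k hki hks
    have h1 : η k (tderiv EN EN φ.symm (φ k) (Z (φ k))) = chartForm η φ (φ k) (Z (φ k)) := by
      simp only [chartForm, ContinuousLinearMap.comp_apply]
      rw [φ.left_inv hks]
    rw [h1]
    obtain ⟨S, hS⟩ := hki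
    have h2 : ∀ f, chartForm η φ (φ k) (B f) = T (φ k) f := fun f => rfl
    simp only [Z, map_sub, h2, ← hS, ContinuousLinearMap.inverse_equiv]
    simp

end Pullbacks

/-! ### Charts in which a submersion is linear -/

section SubmersionCharts

variable {EP P EN N : Type*} [NormedAddCommGroup EP] [NormedSpace ℝ EP]
  [TopologicalSpace P] [ChartedSpace EP P]
  [NormedAddCommGroup EN] [NormedSpace ℝ EN]
  [TopologicalSpace N] [ChartedSpace EN N]

/-- The chart `φ` of `P` and the chart `ψ` of `N` express `f` as the linear map `L`. -/
structure LinearizedBy (f : P → N) (φ : OpenPartialHomeomorph P EP)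
    (ψ : OpenPartialHomeomorph N EN) (L : EP →L[ℝ] EN) : Prop where
  mem_dom : φ ∈ IsManifold.maximalAtlas 𝓘(ℝ, EP) ∞ P
  mem_cod : ψ ∈ IsManifold.maximalAtlas 𝓘(ℝ, EN) ∞ N
  map_source : ∀ k ∈ φ.source, f k ∈ ψ.source
  apply_eq : ∀ k ∈ φ.source, ψ (f k) = L (φ k)

theorem exists_linearizedBy {f : P → N} (hf : IsSubmersion 𝓘(ℝ, EP) 𝓘(ℝ, EN) ∞ f) (x : P) :
    ∃ φ ψ L, x ∈ φ.source ∧ LinearizedBy f φ ψ (L : EP →L[ℝ] EN) := by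
  obtain ⟨F, _, _, h⟩ := hf.isSubmersionAt x
  refine ⟨h.domChart, h.codChart, (ContinuousLinearMap.fst ℝ EN F).comp (h.equiv : EP →L[ℝ] EN × F),
    h.mem_domChart_source, h.domChart_mem_maximalAtlas, h.codChart_mem_maximalAtlas,
    fun k hk => h.source_subset_preimage_source hk, fun k hk => ?_⟩
  have hk' : h.domChart k ∈ (h.domChart.extend 𝓘(ℝ, EP)).target := by
    simpa using h.domChart.map_source hk
  have h1 := h.writtenInCharts hk'
  simp only [Function.comp_apply, OpenPartialHomeomorph.extend_coe, modelWithCornersSelf_coe,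
    id_eq, OpenPartialHomeomorph.extend_coe_symm, modelWithCornersSelf_coe_symm] at h1
  rw [h.domChart.left_inv hk] at h1
  exact h1

variable [IsManifold 𝓘(ℝ, EP) ∞ P] [IsManifold 𝓘(ℝ, EN) ∞ N]
  {f : P → N} {φ : OpenPartialHomeomorph P EP} {ψ : OpenPartialHomeomorph N EN} {L : EP →L[ℝ] EN}

theorem LinearizedBy.eq_iff (h : LinearizedBy f φ ψ L) {k k' : P} (hk : k ∈ φ.source)
    (hk' : k' ∈ φ.source) : f k = f k' ↔ L (φ k) = L (φ k') := by
  rw [← h.apply_eq k hk, ← h.apply_eq k' hk']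
  exact ⟨fun e => by rw [e], fun e => ψ.injOn (h.map_source k hk) (h.map_source k' hk') e⟩

theorem LinearizedBy.map_tderiv_eq_zero (h : LinearizedBy f φ ψ L) {k : P} (hk : k ∈ φ.source)
    (hf : DiffAt EP EN f k) {v : EP} (hv : tderiv EP EN f k v = 0) :
    L (tderiv EP EP φ k v) = 0 := by
  have h1 : tderiv EP EN (fun k => ψ (f k)) k v = tderiv EP EN (fun k => L (φ k)) k v := by
    rw [tderiv_congr]
    filter_upwards [φ.open_source.mem_nhds hk] with m hm using h.apply_eq m hm
  rw [tderiv_comp (EN := EN)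
    (smoothAt_of_mem_maximalAtlas h.mem_cod (h.map_source k hk)).diffAt hf, hv, map_zero,
    tderiv_comp (g := L) (f := φ) (EN := EP) L.differentiableAt.mdifferentiableAt
      (smoothAt_of_mem_maximalAtlas h.mem_dom hk).diffAt, tderiv_eq_fderiv, L.fderiv] at h1
  exact h1.symm

/-- A constant direction in ker L is tangent to the fibres of f throughout the chart. This supplies
the vertical fields along which the differential equation for the defect is solved. -/
theorem LinearizedBy.tderiv_symm_eq_zero (h : LinearizedBy f φ ψ L) {y : EP} (hy : y ∈ φ.target)
    (hf : DiffAt EP EN f (φ.symm y)) {v : EP} (hv : L v = 0) :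
    tderiv EP EN f (φ.symm y) (tderiv EP EP φ.symm y v) = 0 := by
  have hys := φ.map_target hy
  have hφd := (smoothAt_symm_of_mem_maximalAtlas h.mem_dom hy).diffAt
  have h1 : tderiv EP EN (fun y => ψ (f (φ.symm y))) y v = L v := by
    rw [tderiv_congr (g := fun y => L y), tderiv_eq_fderiv, L.fderiv]
    filter_upwards [φ.open_target.mem_nhds hy] with m hm
    rw [h.apply_eq _ (φ.map_target hm), φ.right_inv hm]
  have hfd : DiffAt EP EN (fun y => f (φ.symm y)) y := hf.comp y hφd
  have hψ := h.map_source _ hys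
  rw [tderiv_comp (EN := EN) (g := ψ) (f := fun y => f (φ.symm y))
    (smoothAt_of_mem_maximalAtlas h.mem_cod hψ).diffAt hfd, hv] at h1
  rw [← tderiv_comp hf hφd, ← tderiv_symm_tderiv h.mem_cod hψ
    (tderiv EP EN (fun y => f (φ.symm y)) y v), h1, map_zero]

/-- A vector tangent to a fibre of a submersion is the velocity of a curve in the fibre. -/
theorem exists_curve_in_fibre [FiniteDimensional ℝ EP] {f : P → N}
    (hf : IsSubmersion 𝓘(ℝ, EP) 𝓘(ℝ, EN) ∞ f) {x : P} {v : EP} (hv : tderiv EP EN f x v = 0) :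
    ∃ c : ℝ → P, c 0 = x ∧ SmoothAt ℝ EP c 0 ∧ tderiv ℝ EP c 0 1 = v ∧
      ∀ᶠ r in 𝓝 (0 : ℝ), f (c r) = f x := by
  obtain ⟨φ, ψ, L, hx, h⟩ := exists_linearizedBy hf x
  have hL : L (tderiv EP EP φ x v) = 0 :=
    h.map_tderiv_eq_zero hx ((hf.contMDiff x).mdifferentiableAt (by simp)) hv
  set w := tderiv EP EP φ x v
  -- A straight line in the chart with direction in ker L stays in the fibre.
  let g : ℝ → EP := fun r => φ x + r • w
  have hg : ContDiff ℝ ∞ g := contDiff_const.add (contDiff_id.smul contDiff_const)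
  have hg0 : g 0 = φ x := by simp [g]
  have hφs : SmoothAt EP EP φ.symm (g 0) := by
    rw [hg0]; exact smoothAt_symm_of_mem_maximalAtlas h.mem_dom (φ.map_source hx)
  have hc : SmoothAt ℝ EP (fun r => φ.symm (g r)) 0 :=
    ContMDiffAt.comp (x := (0 : ℝ)) (g := φ.symm) (f := g) hφs hg.contMDiff.contMDiffAt
  have hc0 : φ.symm (g 0) = x := by rw [hg0, φ.left_inv hx]
  refine ⟨fun r => φ.symm (g r), hc0, hc, ?_, ?_⟩
  · rw [tderiv_comp (EN := EP) (g := φ.symm) (f := g) hφs.diffAt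
      (hg.contMDiff.contMDiffAt.mdifferentiableAt (by simp)), tderiv_eq_fderiv]
    have : fderiv ℝ g 0 1 = w := by
      have h1 : HasFDerivAt g ((ContinuousLinearMap.id ℝ ℝ).smulRight w) 0 := by
        simpa [g] using ((ContinuousLinearMap.id ℝ ℝ).smulRight w).hasFDerivAt.const_add (φ x)
      rw [h1.fderiv]
      simp
    rw [this, hg0]
    exact tderiv_symm_tderiv h.mem_dom hx v
  · have ht : ∀ᶠ r in 𝓝 (0 : ℝ), g r ∈ φ.target :=
      hg.continuous.continuousAt.eventually (φ.open_target.mem_nhds (by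
        rw [hg0]; exact φ.map_source hx))
    filter_upwards [ht] with r hr
    rw [h.eq_iff (φ.map_target hr) hx, φ.right_inv hr]
    simp [g, hL]

end SubmersionCharts

/-! ### Structure maps and the differential of the multiplication -/

namespace LieGroupoid

variable {EM M EG G : Type*}
  [NormedAddCommGroup EM] [NormedSpace ℝ EM] [TopologicalSpace M] [ChartedSpace EM M]
  [NormedAddCommGroup EG] [NormedSpace ℝ EG] [TopologicalSpace G] [ChartedSpace EG G]
  (𝒢 : LieGroupoid EM M EG G)

theorem fiberCast_tangent {g h : G} (e : g = h) (v : EG) :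
    (fiberCast (TangentSpace 𝓘(ℝ, EG)) e v : EG) = v := by
  subst e; rfl

/-- The inclusion `A_x ⊂ T_{1_x} G`, with values in the model space. -/
noncomputable def inclV (x : M) : 𝒢.A x →L[ℝ] EG := 𝒢.incl x

theorem inclV_injective (x : M) : Function.Injective (𝒢.inclV x) := 𝒢.incl_injective x

theorem tderiv_s_inclV (x : M) (a : 𝒢.A x) : tderiv EG EM 𝒢.s (𝒢.u x) (𝒢.inclV x a) = 0 :=
  𝒢.mfderiv_incl x a

theorem exists_inclV_eq {x : M} {v : EG} (hv : tderiv EG EM 𝒢.s (𝒢.u x) v = 0) :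
    ∃ a, 𝒢.inclV x a = v := ⟨𝒢.mkA x v hv, rfl⟩

theorem smoothAt_s (g : G) : SmoothAt EG EM 𝒢.s g := 𝒢.contMDiff_s g
theorem smoothAt_t (g : G) : SmoothAt EG EM 𝒢.t g := 𝒢.contMDiff_t g
theorem smoothAt_u (x : M) : SmoothAt EM EG 𝒢.u x := 𝒢.contMDiff_u x

theorem tderiv_s_tderiv_u (x : M) (v : EM) :
    tderiv EG EM 𝒢.s (𝒢.u x) (tderiv EM EG 𝒢.u x v) = v := by
  rw [← tderiv_comp (𝒢.smoothAt_s _).diffAt (𝒢.smoothAt_u x).diffAt,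
    show (fun y => 𝒢.s (𝒢.u y)) = fun y => y from funext 𝒢.s_u, tderiv_id]

theorem tderiv_t_tderiv_u (x : M) (v : EM) :
    tderiv EG EM 𝒢.t (𝒢.u x) (tderiv EM EG 𝒢.u x v) = v := by
  rw [← tderiv_comp (𝒢.smoothAt_t _).diffAt (𝒢.smoothAt_u x).diffAt,
    show (fun y => 𝒢.t (𝒢.u y)) = fun y => y from funext 𝒢.t_u, tderiv_id]

section Mul

/-- The differential of the multiplication, with values in the model space. -/
noncomputable def dmulV (g h : G) (X Y : EG) : EG := 𝒢.dmul g h X Y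

/-- The derivative within G₂ is a linear map on the whole product, so no tangency to G₂ is required
here. -/
theorem dmulV_add (g h : G) (X X' Y Y' : EG) :
    𝒢.dmulV g h (X + X') (Y + Y') = 𝒢.dmulV g h X Y + 𝒢.dmulV g h X' Y' :=
  map_add (mfderivWithin (𝓘(ℝ, EG).prod 𝓘(ℝ, EG)) 𝓘(ℝ, EG) (fun q : G × G => 𝒢.mul q.1 q.2)
    {q | 𝒢.s q.1 = 𝒢.t q.2} (g, h)) (X, Y) (X', Y')

theorem dmulV_zero (g h : G) : 𝒢.dmulV g h 0 0 = 0 :=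
  map_zero (mfderivWithin (𝓘(ℝ, EG).prod 𝓘(ℝ, EG)) 𝓘(ℝ, EG) (fun q : G × G => 𝒢.mul q.1 q.2)
    {q | 𝒢.s q.1 = 𝒢.t q.2} (g, h))

variable {EQ Q : Type*} [NormedAddCommGroup EQ] [NormedSpace ℝ EQ] [TopologicalSpace Q]
  [ChartedSpace EQ Q] {c₁ c₂ : Q → G} {q : Q}

theorem smoothAt_mul (h₁ : SmoothAt EQ EG c₁ q) (h₂ : SmoothAt EQ EG c₂ q)
    (h : ∀ᶠ k in 𝓝 q, 𝒢.s (c₁ k) = 𝒢.t (c₂ k)) :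
    SmoothAt EQ EG (fun k => 𝒢.mul (c₁ k) (c₂ k)) q := by
  have h3 := 𝒢.contMDiffOn_mul (c₁ q, c₂ q) h.self_of_nhds
  exact (ContMDiffWithinAt.comp (x := q) (s := {k | 𝒢.s (c₁ k) = 𝒢.t (c₂ k)})
    (f := fun k => (c₁ k, c₂ k)) (g := fun q : G × G => 𝒢.mul q.1 q.2) h3
    (h₁.prodMk h₂).contMDiffWithinAt (fun k hk => hk)).contMDiffAt h

/-- The family of pairs stays in G₂, so the chain rule for derivatives within G₂ applies. The result
is a genuine derivative on the parameter space, where uniqueness is automatic; G₂ need not be shown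
to have unique derivatives. -/
theorem tderiv_mul (h₁ : DiffAt EQ EG c₁ q) (h₂ : DiffAt EQ EG c₂ q)
    (h : ∀ᶠ k in 𝓝 q, 𝒢.s (c₁ k) = 𝒢.t (c₂ k)) (v : EQ) :
    tderiv EQ EG (fun k => 𝒢.mul (c₁ k) (c₂ k)) q v =
      𝒢.dmulV (c₁ q) (c₂ q) (tderiv EQ EG c₁ q v) (tderiv EQ EG c₂ q v) := by
  have h3 := ((𝒢.contMDiffOn_mul (c₁ q, c₂ q) h.self_of_nhds).mdifferentiableWithinAt
    (by simp)).hasMFDerivWithinAt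
  have h4 := h₁.hasMFDerivAt.prodMk h₂.hasMFDerivAt
  have h5 := (HasMFDerivWithinAt.comp (x := q) (s := {k | 𝒢.s (c₁ k) = 𝒢.t (c₂ k)})
    (f := fun k => (c₁ k, c₂ k)) (g := fun q : G × G => 𝒢.mul q.1 q.2) h3
    h4.hasMFDerivWithinAt (fun k hk => hk)).hasMFDerivAt h
  have h6 := DFunLike.congr_fun h5.mfderiv v
  exact h6

end Mul

end LieGroupoid

namespace LieGroupoid

variable {EM M EG G : Type*}
  [NormedAddCommGroup EM] [NormedSpace ℝ EM] [TopologicalSpace M] [ChartedSpace EM M]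
  [NormedAddCommGroup EG] [NormedSpace ℝ EG] [TopologicalSpace G] [ChartedSpace EG G]
  (𝒢 : LieGroupoid EM M EG G)

/-! ### Right translations -/

section RightTranslation

/-- Right translation by `g` of vectors tangent to the fibre of `s` at `1_{t g}`. -/
noncomputable def rTrans (g : G) (v : EG) : EG := 𝒢.dmulV (𝒢.u (𝒢.t g)) g v 0

theorem rightInv_eq (α : ∀ x, 𝒢.A x) (g : G) :
    𝒢.rightInv α g = 𝒢.rTrans g (𝒢.inclV (𝒢.t g) (α (𝒢.t g))) :=
  fiberCast_tangent (𝒢.u_mul g) _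

theorem rTrans_zero (g : G) : 𝒢.rTrans g 0 = 0 := 𝒢.dmulV_zero _ _

/-- Split (du dt Y + v, Y) as (du dt Y, Y) + (v, 0). The first summand is mapped to Y by
differentiating 1_{t(k)} k = k, the second to the right translate of v. -/
theorem dmulV_unit_add (g : G) (v Y : EG) :
    𝒢.dmulV (𝒢.u (𝒢.t g)) g (tderiv EM EG 𝒢.u (𝒢.t g) (tderiv EG EM 𝒢.t g Y) + v) Y =
      Y + 𝒢.rTrans g v := by
  have hu : DiffAt EM EG 𝒢.u (𝒢.t g) := (𝒢.smoothAt_u _).diffAt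
  have ht : DiffAt EG EM 𝒢.t g := (𝒢.smoothAt_t g).diffAt
  have h1 := 𝒢.tderiv_mul (c₁ := fun k => 𝒢.u (𝒢.t k)) (c₂ := fun k => k) (q := g)
    (hu.comp g ht) mdifferentiableAt_id (Filter.Eventually.of_forall fun k => 𝒢.s_u _) Y
  rw [show (fun k => 𝒢.mul (𝒢.u (𝒢.t k)) k) = fun k => k from funext 𝒢.u_mul, tderiv_id,
    tderiv_comp hu ht] at h1
  have h2 := 𝒢.dmulV_add (𝒢.u (𝒢.t g)) g
    (tderiv EM EG 𝒢.u (𝒢.t g) (tderiv EG EM 𝒢.t g Y)) v Y 0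
  rw [add_zero] at h2
  rw [h2, rTrans]
  exact congrArg (· + 𝒢.dmulV (𝒢.u (𝒢.t g)) g v 0) h1.symm

variable [FiniteDimensional ℝ EG] [IsManifold 𝓘(ℝ, EG) ∞ G]
  [IsManifold 𝓘(ℝ, EM) ∞ M]

theorem exists_curve_of_vertical {g : G} {X : EG} (hX : tderiv EG EM 𝒢.s g X = 0) :
    ∃ c : ℝ → G, c 0 = g ∧ SmoothAt ℝ EG c 0 ∧ tderiv ℝ EG c 0 1 = X ∧
      ∀ᶠ r in 𝓝 (0 : ℝ), 𝒢.s (c r) = 𝒢.s g :=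
  exists_curve_in_fibre 𝒢.isSubmersion_s hX

/-- The right translate of the velocity of a curve in a fibre of `s`. -/
theorem tderiv_mul_right {c : ℝ → G} {g : G} (hc : SmoothAt ℝ EG c 0)
    (hs : ∀ᶠ r in 𝓝 (0 : ℝ), 𝒢.s (c r) = 𝒢.t g) :
    tderiv ℝ EG (fun r => 𝒢.mul (c r) g) 0 1 = 𝒢.dmulV (c 0) g (tderiv ℝ EG c 0 1) 0 := by
  rw [𝒢.tderiv_mul hc.diffAt mdifferentiableAt_const hs, tderiv_const]

/-- A curve in the source fibre with velocity X, multiplied on the right by g⁻¹, passes through the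
unit 1_{t(g)}; its velocity there is the required element of A, and multiplying by g recovers X. -/
theorem exists_eq_rTrans {g : G} {X : EG} (hX : tderiv EG EM 𝒢.s g X = 0) :
    ∃ (c : ℝ → G) (a : 𝒢.A (𝒢.t g)), c 0 = 𝒢.u (𝒢.t g) ∧ SmoothAt ℝ EG c 0 ∧
      tderiv ℝ EG c 0 1 = 𝒢.inclV _ a ∧ (∀ᶠ r in 𝓝 (0 : ℝ), 𝒢.s (c r) = 𝒢.t g) ∧
      tderiv ℝ EG (fun r => 𝒢.mul (c r) g) 0 1 = X ∧ X = 𝒢.rTrans g (𝒢.inclV _ a) := by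
  obtain ⟨c, hc0, hc, hcX, hcs⟩ := 𝒢.exists_curve_of_vertical hX
  have hcs' : ∀ᶠ r in 𝓝 (0 : ℝ), 𝒢.s (c r) = 𝒢.t (𝒢.inv g) := by simpa [𝒢.t_inv] using hcs
  have hd : SmoothAt ℝ EG (fun r => 𝒢.mul (c r) (𝒢.inv g)) 0 :=
    𝒢.smoothAt_mul hc contMDiffAt_const hcs'
  have hds : ∀ᶠ r in 𝓝 (0 : ℝ), 𝒢.s (𝒢.mul (c r) (𝒢.inv g)) = 𝒢.t g := by
    filter_upwards [hcs'] with r hr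
    rw [𝒢.s_mul hr, 𝒢.s_inv]
  have hd0 : 𝒢.mul (c 0) (𝒢.inv g) = 𝒢.u (𝒢.t g) := by rw [hc0, 𝒢.mul_inv]
  have hv : tderiv EG EM 𝒢.s (𝒢.u (𝒢.t g))
      (tderiv ℝ EG (fun r => 𝒢.mul (c r) (𝒢.inv g)) 0 1) = 0 := by
    rw [← hd0, ← tderiv_comp (𝒢.smoothAt_s _).diffAt hd.diffAt,
      tderiv_congr (g := fun _ => 𝒢.t g) hds, tderiv_const]
  obtain ⟨a, ha⟩ := 𝒢.exists_inclV_eq hv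
  have hX' : tderiv ℝ EG (fun r => 𝒢.mul (𝒢.mul (c r) (𝒢.inv g)) g) 0 1 = X := by
    rw [tderiv_congr (g := c), hcX]
    filter_upwards [hcs', hcs] with r hr hr'
    rw [𝒢.mul_assoc hr (𝒢.s_inv g), 𝒢.inv_mul, ← hr', 𝒢.mul_u]
  refine ⟨_, a, hd0, hd, ha.symm, hds, hX', ?_⟩
  rw [← hX', 𝒢.tderiv_mul_right hd hds, hd0, ← ha]
  rfl

theorem exists_curve_inclV {x : M} (a : 𝒢.A x) :
    ∃ c : ℝ → G, c 0 = 𝒢.u x ∧ SmoothAt ℝ EG c 0 ∧ tderiv ℝ EG c 0 1 = 𝒢.inclV x a ∧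
      ∀ᶠ r in 𝓝 (0 : ℝ), 𝒢.s (c r) = x := by
  obtain ⟨c, h0, h1, h2, h3⟩ := 𝒢.exists_curve_of_vertical (𝒢.tderiv_s_inclV x a)
  exact ⟨c, h0, h1, h2, by simpa [𝒢.s_u] using h3⟩

/-- The vector R_g a is the velocity of r ↦ c(r)g for a curve c in the source fibre of the unit, and
right multiplication fixes the source. -/
theorem tderiv_s_rTrans (g : G) (a : 𝒢.A (𝒢.t g)) :
    tderiv EG EM 𝒢.s g (𝒢.rTrans g (𝒢.inclV _ a)) = 0 := by
  obtain ⟨c, h0, h1, h2, h3⟩ := 𝒢.exists_curve_inclV a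
  have h4 := 𝒢.tderiv_mul_right h1 h3
  rw [h0, h2] at h4
  have h5 : 𝒢.mul (c 0) g = g := by rw [h0, 𝒢.u_mul]
  rw [rTrans, ← h4]
  have h6 := tderiv_comp (EN := EG) (g := 𝒢.s) (f := fun r => 𝒢.mul (c r) g) (x := (0 : ℝ))
    (𝒢.smoothAt_s _).diffAt (𝒢.smoothAt_mul h1 contMDiffAt_const h3).diffAt 1
  rw [h5] at h6
  rw [← h6, tderiv_congr (g := fun _ => 𝒢.s g), tderiv_const]
  filter_upwards [h3] with r hr using 𝒢.s_mul hr

theorem tderiv_t_rTrans (g : G) (a : 𝒢.A (𝒢.t g)) :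
    tderiv EG EM 𝒢.t g (𝒢.rTrans g (𝒢.inclV _ a)) =
      tderiv EG EM 𝒢.t (𝒢.u (𝒢.t g)) (𝒢.inclV _ a) := by
  obtain ⟨c, h0, h1, h2, h3⟩ := 𝒢.exists_curve_inclV a
  have h4 := 𝒢.tderiv_mul_right h1 h3
  rw [h0, h2] at h4
  have h5 : 𝒢.mul (c 0) g = g := by rw [h0, 𝒢.u_mul]
  rw [rTrans, ← h4]
  have h6 := tderiv_comp (EN := EG) (g := 𝒢.t) (f := fun r => 𝒢.mul (c r) g) (x := (0 : ℝ))
    (𝒢.smoothAt_t _).diffAt (𝒢.smoothAt_mul h1 contMDiffAt_const h3).diffAt 1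
  have h7 := tderiv_comp (EN := EG) (g := 𝒢.t) (f := c) (x := (0 : ℝ))
    (𝒢.smoothAt_t _).diffAt h1.diffAt 1
  rw [h5] at h6
  rw [h0, h2] at h7
  rw [← h6, ← h7, tderiv_congr]
  filter_upwards [h3] with r hr using 𝒢.t_mul hr

theorem rTrans_unit (x : M) (a : 𝒢.A x) : 𝒢.rTrans (𝒢.u x) (𝒢.inclV x a) = 𝒢.inclV x a := by
  obtain ⟨c, h0, h1, h2, h3⟩ := 𝒢.exists_curve_inclV a
  have h4 := 𝒢.tderiv_mul_right (g := 𝒢.u x) h1 (by simpa [𝒢.t_u] using h3)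
  rw [h0, h2] at h4
  rw [rTrans, 𝒢.t_u, ← h4, ← h2, tderiv_congr]
  filter_upwards [h3] with r hr
  rw [← hr, 𝒢.mul_u]

/-- Right translation by g⁻¹ undoes right translation by g. -/
theorem eq_zero_of_rTrans_eq_zero (g : G) (a : 𝒢.A (𝒢.t g))
    (h : 𝒢.rTrans g (𝒢.inclV _ a) = 0) : a = 0 := by
  obtain ⟨c, h0, h1, h2, h3⟩ := 𝒢.exists_curve_inclV a
  have h4 := 𝒢.tderiv_mul_right h1 h3
  rw [h0, h2] at h4
  change _ = 𝒢.rTrans g (𝒢.inclV _ a) at h4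
  rw [h] at h4
  have h5 := 𝒢.tderiv_mul_right (c := fun r => 𝒢.mul (c r) g) (g := 𝒢.inv g)
    (𝒢.smoothAt_mul h1 contMDiffAt_const h3) (by
      filter_upwards [h3] with r hr
      rw [𝒢.s_mul hr, 𝒢.t_inv])
  rw [h4, dmulV_zero] at h5
  have h6 : tderiv ℝ EG (fun r => 𝒢.mul (𝒢.mul (c r) g) (𝒢.inv g)) 0 = tderiv ℝ EG c 0 := by
    rw [tderiv_congr]
    filter_upwards [h3] with r hr
    rw [𝒢.mul_assoc hr (𝒢.t_inv g).symm, 𝒢.mul_inv, ← hr, 𝒢.mul_u]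
  rw [h6, h2] at h5
  exact 𝒢.inclV_injective _ (h5.trans (map_zero _).symm)

end RightTranslation

/-! ### Smoothness of A ⊂ TG -/

section AlgebroidBundle

variable [IsManifold 𝓘(ℝ, EM) ∞ M] [IsManifold 𝓘(ℝ, EG) ∞ G]
  [FiniteDimensional ℝ EM] [FiniteDimensional ℝ EG]

/-- The inclusion of the algebroid in the tangent bundle is smooth. -/
theorem contMDiff_inclV :
    ContMDiff (𝓘(ℝ, EM).prod 𝓘(ℝ, Fib EM EG)) 𝓘(ℝ, EG).tangent ∞
      (fun z : TotalSpace (Fib EM EG) 𝒢.A =>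
        (⟨𝒢.u z.1, 𝒢.inclV z.1 z.2⟩ : TangentBundle 𝓘(ℝ, EG) G)) := by
  rintro ⟨x₀, a₀⟩
  have hproj : ContMDiffAt (𝓘(ℝ, EM).prod 𝓘(ℝ, Fib EM EG)) 𝓘(ℝ, EM) ∞
      (fun z : TotalSpace (Fib EM EG) 𝒢.A => z.1) ⟨x₀, a₀⟩ := Bundle.contMDiffAt_proj 𝒢.A
  have hx := 𝒢.mem_trivSet x₀
  set e := trivializationAt (Fib EM EG) 𝒢.A x₀
  have hsnd : ContMDiffAt (𝓘(ℝ, EM).prod 𝓘(ℝ, Fib EM EG)) 𝓘(ℝ, Fib EM EG) ∞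
      (fun z : TotalSpace (Fib EM EG) 𝒢.A => (e z).2) ⟨x₀, a₀⟩ :=
    (((e.contMDiffOn (IB := 𝓘(ℝ, EM)) (n := ∞)).contMDiffAt
      (e.open_source.mem_nhds ((e.mem_source (x := (⟨x₀, a₀⟩ : TotalSpace (Fib EM EG) 𝒢.A))).2 hx)))).snd
  rw [(𝒢.trivG x₀).contMDiffAt_iff (IB := 𝓘(ℝ, EG))
    (f := fun z : TotalSpace (Fib EM EG) 𝒢.A =>
        (⟨𝒢.u z.1, 𝒢.inclV z.1 z.2⟩ : TangentBundle 𝓘(ℝ, EG) G)) (x₀ := ⟨x₀, a₀⟩)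
    ((Trivialization.mem_source _).2 hx.1.1)]
  refine ⟨ContMDiffAt.comp (g := 𝒢.u) (f := fun z : TotalSpace (Fib EM EG) 𝒢.A => z.1)
    (⟨x₀, a₀⟩ : TotalSpace (Fib EM EG) 𝒢.A) (𝒢.smoothAt_u x₀) hproj, ?_⟩
  have h1 : ContMDiffAt 𝓘(ℝ, EM) 𝓘(ℝ, EM × Fib EM EG →L[ℝ] EG) ∞
      (fun x => (𝒢.splitting x₀ x).inverse) x₀ :=
    (𝒢.contMDiffOn_inverse_splitting x₀).contMDiffAt ((𝒢.isOpen_trivSet x₀).mem_nhds hx)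
  have h2 : ContMDiffAt (𝓘(ℝ, EM).prod 𝓘(ℝ, Fib EM EG)) 𝓘(ℝ, EM × Fib EM EG →L[ℝ] EG) ∞
      (fun z : TotalSpace (Fib EM EG) 𝒢.A => (𝒢.splitting x₀ z.1).inverse) ⟨x₀, a₀⟩ :=
    h1.comp (⟨x₀, a₀⟩ : TotalSpace (Fib EM EG) 𝒢.A) hproj
  have h3 : ContMDiffAt (𝓘(ℝ, EM).prod 𝓘(ℝ, Fib EM EG)) 𝓘(ℝ, EM × Fib EM EG) ∞
      (fun z : TotalSpace (Fib EM EG) 𝒢.A => ((0 : EM), (e z).2)) ⟨x₀, a₀⟩ :=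
    ((ContinuousLinearMap.inr ℝ EM (Fib EM EG)).contMDiff.contMDiffAt).comp
      (⟨x₀, a₀⟩ : TotalSpace (Fib EM EG) 𝒢.A) hsnd
  -- In coordinates the inclusion sends w to `splitting`⁻¹(0, w), the vector with ds-component 0 and
  -- fibre coordinate w.
  refine (h2.clm_apply h3).congr_of_eventuallyEq ?_
  have hev : ∀ᶠ z in 𝓝 (⟨x₀, a₀⟩ : TotalSpace (Fib EM EG) 𝒢.A), z.1 ∈ 𝒢.trivSet x₀ :=
    hproj.continuousAt.eventually ((𝒢.isOpen_trivSet x₀).mem_nhds hx)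
  filter_upwards [hev] with z hz
  have h4 := 𝒢.ofCoord_toCoord hz z.2
  show (𝒢.trivG x₀ ⟨𝒢.u z.1, 𝒢.incl z.1 z.2⟩).2 =
    (𝒢.splitting x₀ z.1).inverse (0, 𝒢.toCoord x₀ z.1 (𝒢.incl z.1 z.2))
  rw [← h4, 𝒢.toCoord_ofCoord hz, ofCoord,
    ← Trivialization.continuousLinearMapAt_apply_of_mem ℝ (𝒢.trivG x₀) hz.1.1,
    (𝒢.trivG x₀).continuousLinearMapAt_symmL hz.1.1]

/-- The section of `A` with constant coordinate in the preferred trivialization around `x₀`. -/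
noncomputable def constSec (x₀ : M) (w : Fib EM EG) (z : M) : 𝒢.A z :=
  (trivializationAt (Fib EM EG) 𝒢.A x₀).symmL ℝ z w

/-- The preferred coordinates on `A` around `x₀`. -/
noncomputable def coordA (x₀ : M) (z : M) : 𝒢.A z →L[ℝ] Fib EM EG :=
  (trivializationAt (Fib EM EG) 𝒢.A x₀).continuousLinearMapAt ℝ z

theorem constSec_coordA {x₀ z : M} (hz : z ∈ 𝒢.trivSet x₀) (a : 𝒢.A z) :
    𝒢.constSec x₀ (𝒢.coordA x₀ z a) z = a :=
  (trivializationAt (Fib EM EG) 𝒢.A x₀).symmL_continuousLinearMapAt hz a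

theorem contMDiffAt_constSec {EQ Q : Type*} [NormedAddCommGroup EQ] [NormedSpace ℝ EQ]
    [TopologicalSpace Q] [ChartedSpace EQ Q] {x₀ : M} {τ : Q → M} {w : Q → Fib EM EG} {q : Q}
    (hτ : SmoothAt EQ EM τ q) (hw : SmoothAt EQ (Fib EM EG) w q) (hq : τ q ∈ 𝒢.trivSet x₀) :
    ContMDiffAt 𝓘(ℝ, EQ) (𝓘(ℝ, EM).prod 𝓘(ℝ, Fib EM EG)) ∞
      (fun k => (⟨τ k, 𝒢.constSec x₀ (w k) (τ k)⟩ : TotalSpace (Fib EM EG) 𝒢.A)) q := by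
  set e := trivializationAt (Fib EM EG) 𝒢.A x₀
  have hev : ∀ᶠ k in 𝓝 q, τ k ∈ 𝒢.trivSet x₀ :=
    hτ.continuousAt.eventually ((𝒢.isOpen_trivSet x₀).mem_nhds hq)
  rw [e.contMDiffAt_iff (IB := 𝓘(ℝ, EM)) (by rw [Trivialization.mem_source]; exact hq)]
  refine ⟨hτ, hw.congr_of_eventuallyEq ?_⟩
  filter_upwards [hev] with k hk
  have h1 : e.continuousLinearMapAt ℝ (τ k) (e.symmL ℝ (τ k) (w k)) = w k :=
    e.continuousLinearMapAt_symmL hk (w k)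
  rw [e.continuousLinearMapAt_apply_of_mem ℝ hk] at h1
  exact h1

theorem contMDiffAt_inclV_constSec {EQ Q : Type*} [NormedAddCommGroup EQ] [NormedSpace ℝ EQ]
    [TopologicalSpace Q] [ChartedSpace EQ Q] {x₀ : M} {τ : Q → M} {w : Q → Fib EM EG} {q : Q}
    (hτ : SmoothAt EQ EM τ q) (hw : SmoothAt EQ (Fib EM EG) w q) (hq : τ q ∈ 𝒢.trivSet x₀) :
    ContMDiffAt 𝓘(ℝ, EQ) 𝓘(ℝ, EG).tangent ∞ (fun k => (⟨𝒢.u (τ k),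
      𝒢.inclV (τ k) (𝒢.constSec x₀ (w k) (τ k))⟩ : TangentBundle 𝓘(ℝ, EG) G)) q :=
  ContMDiffAt.comp (x := q) (g := fun z : TotalSpace (Fib EM EG) 𝒢.A =>
        (⟨𝒢.u z.1, 𝒢.inclV z.1 z.2⟩ : TangentBundle 𝓘(ℝ, EG) G))
    (f := fun k => (⟨τ k, 𝒢.constSec x₀ (w k) (τ k)⟩ : TotalSpace (Fib EM EG) 𝒢.A))
    (𝒢.contMDiff_inclV _) (𝒢.contMDiffAt_constSec hτ hw hq)

end AlgebroidBundle

end LieGroupoid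

/-! ### Families of arrows with prescribed derivatives -/

namespace LieGroupoid

variable {EM M EG G : Type*}
  [NormedAddCommGroup EM] [NormedSpace ℝ EM] [TopologicalSpace M] [ChartedSpace EM M]
  [NormedAddCommGroup EG] [NormedSpace ℝ EG] [TopologicalSpace G] [ChartedSpace EG G]
  (𝒢 : LieGroupoid EM M EG G)
  [IsManifold 𝓘(ℝ, EM) ∞ M] [IsManifold 𝓘(ℝ, EG) ∞ G]
  [FiniteDimensional ℝ EM] [FiniteDimensional ℝ EG]

section Families

variable {Q : Type*} [NormedAddCommGroup Q] [NormedSpace ℝ Q] [FiniteDimensional ℝ Q]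

/-- A family of arrows with prescribed sources, and with prescribed derivatives along a linear
subspace on which the arrows are units. -/
theorem exists_family {ι : Type*} [Fintype ι] {τ : Q → M} {V : ι → Q → EG} {q : Q}
    (hτ : SmoothAt Q EM τ q)
    (hV : ∀ i, ContMDiffAt 𝓘(ℝ, Q) 𝓘(ℝ, EG).tangent ∞
      (fun k => (⟨𝒢.u (τ k), V i k⟩ : TangentBundle 𝓘(ℝ, EG) G)) q)
    (hVs : ∀ᶠ k in 𝓝 q, ∀ i, tderiv EG EM 𝒢.s (𝒢.u (τ k)) (V i k) = 0)
    (r : ι → Q →L[ℝ] ℝ) (hr : ∀ i, r i q = 0) :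
    ∃ c : Q → G, SmoothAt Q EG c q ∧ (∀ᶠ k in 𝓝 q, 𝒢.s (c k) = τ k) ∧
      ∀ᶠ k in 𝓝 q, (∀ i, r i k = 0) → c k = 𝒢.u (τ k) ∧
        ∀ v, tderiv Q EG c k v =
          tderiv EM EG 𝒢.u (τ k) (tderiv Q EM τ k v) + ∑ i, r i v • V i k := by
  obtain ⟨φ, ψ, L, hx, h⟩ := exists_linearizedBy 𝒢.isSubmersion_s (𝒢.u (τ q))
  have huτ : SmoothAt Q EG (fun k => 𝒢.u (τ k)) q :=
    ContMDiffAt.comp (x := q) (g := 𝒢.u) (f := τ) (𝒢.smoothAt_u _) hτ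
  have hφuτ : SmoothAt Q EG (fun k => φ (𝒢.u (τ k))) q :=
    ContMDiffAt.comp (x := q) (g := φ) (f := fun k => 𝒢.u (τ k))
      (smoothAt_of_mem_maximalAtlas h.mem_dom hx) huτ
  let W : ι → Q → EG := fun i k => tderiv EG EG φ (𝒢.u (τ k)) (V i k)
  have hW : ∀ i, SmoothAt Q EG (W i) q := fun i =>
    contMDiffAt_tangent_vectorSpace (c := fun k => φ (𝒢.u (τ k)))
      (ContMDiffAt.tderiv_apply (c := fun k => 𝒢.u (τ k)) (V := V i)
        (smoothAt_of_mem_maximalAtlas h.mem_dom hx) (hV i))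
  -- Units displaced in a chart where s is linear. Near q the W_i lie in ker L, so the source stays
  -- τ(k); where all r_i vanish, only the derivatives of the r_i contribute to that of the sum.
  let Z : Q → EG := fun k => φ (𝒢.u (τ k)) + ∑ i, r i k • W i k
  have hZ : SmoothAt Q EG Z q := by
    refine hφuτ.add (ContMDiffAt.sum fun i _ => ?_)
    exact ((r i).contMDiff.contMDiffAt).smul (hW i)
  have hZq : Z q = φ (𝒢.u (τ q)) := by simp [Z, hr]
  have hφs : SmoothAt EG EG φ.symm (Z q) := by
    rw [hZq]; exact smoothAt_symm_of_mem_maximalAtlas h.mem_dom (φ.map_source hx)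
  have hs : ∀ᶠ k in 𝓝 q, 𝒢.u (τ k) ∈ φ.source :=
    huτ.continuousAt.eventually (φ.open_source.mem_nhds hx)
  have ht : ∀ᶠ k in 𝓝 q, Z k ∈ φ.target :=
    hZ.continuousAt.eventually (φ.open_target.mem_nhds (by rw [hZq]; exact φ.map_source hx))
  refine ⟨fun k => φ.symm (Z k), ContMDiffAt.comp (x := q) (g := φ.symm) (f := Z) hφs hZ, ?_, ?_⟩
  · filter_upwards [hs, ht, hVs] with k hk hk' hkV
    have h1 : L (∑ i, r i k • W i k) = 0 := by
      simp only [map_sum, map_smul]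
      refine Finset.sum_eq_zero fun i _ => ?_
      rw [h.map_tderiv_eq_zero hk (𝒢.smoothAt_s _).diffAt (hkV i), smul_zero]
    have h2 : 𝒢.s (φ.symm (Z k)) = 𝒢.s (𝒢.u (τ k)) := by
      rw [h.eq_iff (φ.map_target hk') hk, φ.right_inv hk']
      simp only [Z, map_add, h1, add_zero]
    rw [h2, 𝒢.s_u]
  · have hWd : ∀ᶠ k in 𝓝 q, ∀ i, DiffAt Q EG (W i) k :=
      Filter.eventually_all.2 fun i => (hW i).eventually_diffAt
    filter_upwards [hs, ht, hWd, hτ.eventually_diffAt] with k hk hk' hWk hτk hrk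
    have hZk : Z k = φ (𝒢.u (τ k)) := by simp [Z, hrk]
    have hck : φ.symm (Z k) = 𝒢.u (τ k) := by rw [hZk, φ.left_inv hk]
    refine ⟨hck, fun v => ?_⟩
    have hφd := (smoothAt_of_mem_maximalAtlas h.mem_dom hk).diffAt
    have hud : DiffAt Q EG (fun k => 𝒢.u (τ k)) k := (𝒢.smoothAt_u _).diffAt.comp k hτk
    have h1 : HasFDerivAt (fun k => φ (𝒢.u (τ k))) (tderiv Q EG (fun k => φ (𝒢.u (τ k))) k) k := by
      have : DiffAt Q EG (fun k => φ (𝒢.u (τ k))) k := hφd.comp k hud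
      rw [tderiv, mfderiv_eq_fderiv]
      exact (mdifferentiableAt_iff_differentiableAt.1 this).hasFDerivAt
    have h2 : ∀ i, HasFDerivAt (fun k => r i k • W i k) ((r i).smulRight (W i k)) k := fun i => by
      have := (r i).hasFDerivAt (x := k) |>.smul
        (mdifferentiableAt_iff_differentiableAt.1 (hWk i)).hasFDerivAt
      refine this.congr_fderiv ?_
      ext v
      simp [hrk]
    have h3 : HasFDerivAt Z (tderiv Q EG (fun k => φ (𝒢.u (τ k))) k +
        ∑ i, (r i).smulRight (W i k)) k := h1.add (HasFDerivAt.fun_sum fun i _ => h2 i)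
    have h4 : tderiv Q EG Z k v =
        tderiv EG EG φ (𝒢.u (τ k)) (tderiv EM EG 𝒢.u (τ k) (tderiv Q EM τ k v) +
          ∑ i, r i v • V i k) := by
      rw [tderiv_eq_fderiv, h3.fderiv, add_apply,
        tderiv_comp (g := φ) (f := fun k => 𝒢.u (τ k)) hφd hud, tderiv_comp (𝒢.smoothAt_u _).diffAt hτk, map_add, map_sum]
      simp [W]
    rw [tderiv_comp (EN := EG) (g := φ.symm) (f := Z)
      (smoothAt_symm_of_mem_maximalAtlas h.mem_dom hk').diffAt h3.differentiableAt.mdifferentiableAt,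
      h4, hZk, tderiv_symm_tderiv h.mem_dom hk]

end Families

/-- Right translates of smooth families of vectors are smooth. -/
theorem smoothFieldAt_rTrans {V : G → EG} {g : G}
    (hV : ContMDiffAt 𝓘(ℝ, EG) 𝓘(ℝ, EG).tangent ∞
      (fun k => (⟨𝒢.u (𝒢.t k), V k⟩ : TangentBundle 𝓘(ℝ, EG) G)) g)
    (hVs : ∀ᶠ k in 𝓝 g, tderiv EG EM 𝒢.s (𝒢.u (𝒢.t k)) (V k) = 0) :
    SmoothFieldAt (fun k => 𝒢.rTrans k (V k)) g := by
  have hφ := chartAt_mem_maximalAtlas' (EN := EG) g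
  set φ := chartAt EG g
  have hg : g ∈ φ.source := mem_chart_source EG g
  have hφg : φ.symm (φ g) = g := φ.left_inv hg
  -- An extra real parameter r: for a family c(r, y) leaving the units with velocity V, the field is
  -- the derivative in direction (1, 0), at r = 0, of the product c·d. Its smoothness follows from
  -- that of the tangent map of the product.
  set q : ℝ × EG := (0, φ g)
  let d : ℝ × EG → G := fun k => φ.symm k.2
  have hd : SmoothAt (ℝ × EG) EG d q :=
    ContMDiffAt.comp (x := q) (g := φ.symm) (f := fun k : ℝ × EG => k.2)
      (smoothAt_symm_of_mem_maximalAtlas hφ (mem_chart_target EG g)) contDiff_snd.contMDiff.contMDiffAt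
  have hdq : d q = g := hφg
  have hτ : SmoothAt (ℝ × EG) EM (fun k => 𝒢.t (d k)) q :=
    ContMDiffAt.comp (x := q) (g := 𝒢.t) (f := d) (𝒢.smoothAt_t _) hd
  obtain ⟨c, hc, hcs, hcd⟩ := 𝒢.exists_family (ι := Unit) (V := fun _ k => V (d k)) hτ
    (fun _ => ContMDiffAt.comp (x := q)
      (g := fun k => (⟨𝒢.u (𝒢.t k), V k⟩ : TangentBundle 𝓘(ℝ, EG) G)) (f := d) (by rwa [hdq]) hd)
    (by
      have := hd.continuousAt.eventually (by rw [hdq]; exact hVs)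
      filter_upwards [this] with k hk _ using hk)
    (fun _ => ContinuousLinearMap.fst ℝ ℝ EG) (fun _ => rfl)
  have hm : SmoothAt (ℝ × EG) EG (fun k => 𝒢.mul (c k) (d k)) q := 𝒢.smoothAt_mul hc hd hcs
  let j : G → ℝ × EG := fun k => (0, φ k)
  have hj : SmoothAt EG (ℝ × EG) j g :=
    contMDiffAt_const.prodMk_space (smoothAt_of_mem_maximalAtlas hφ hg)
  have key := ContMDiffAt.tderiv_apply (c := j) (V := fun _ => ((1 : ℝ), (0 : EG))) (q := g) hm
    (contMDiffAt_tangent_vectorSpace_mk hj contMDiffAt_const)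
  refine key.congr_of_eventuallyEq ?_
  filter_upwards [φ.open_source.mem_nhds hg, hj.continuousAt.eventually hcd,
    hj.continuousAt.eventually hcs.eventually_nhds,
    hj.continuousAt.eventually hc.eventually_diffAt,
    hj.continuousAt.eventually hd.eventually_diffAt] with k hk h1 h2 h3 h4
  obtain ⟨h5, h6⟩ := h1 fun _ => rfl
  have hdk : d (j k) = k := φ.left_inv hk
  rw [hdk] at h5
  have e1 : 𝒢.mul (c (j k)) (d (j k)) = k := by rw [h5, hdk, 𝒢.u_mul]
  refine tangentBundle_mk_congr e1.symm ?_
  rw [𝒢.tderiv_mul h3 h4 h2, h5, hdk, rTrans]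
  have e2 : tderiv (ℝ × EG) EG d (j k) (1, 0) = 0 := by
    have := tderiv_comp (EN := EG) (g := φ.symm) (f := fun k : ℝ × EG => k.2) (x := j k)
      (smoothAt_symm_of_mem_maximalAtlas hφ (φ.map_source hk)).diffAt
      (contDiff_snd.differentiable_one.differentiableAt.mdifferentiableAt) ((1 : ℝ), (0 : EG))
    refine this.trans ?_
    rw [tderiv_eq_fderiv, fderiv_snd]
    simp
  rw [e2, h6, hdk, tderiv_comp (𝒢.smoothAt_t _).diffAt h4, e2]
  simp [hdk]

end LieGroupoid

/-! ### Forms and representations in a trivialization; dθ for multiplicative θ -/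

namespace LieGroupoid

section FibreCoordinates

variable {B F : Type*} [TopologicalSpace B] [NormedAddCommGroup F] [NormedSpace ℝ F]
  {E : B → Type*} [∀ x, AddCommGroup (E x)] [∀ x, Module ℝ (E x)] [∀ x, TopologicalSpace (E x)]
  [TopologicalSpace (TotalSpace F E)] [FiberBundle F E] [VectorBundle ℝ F E]
  (e : Trivialization F (π F E)) [MemTrivializationAtlas e]

theorem continuousLinearMapAt_fiberCast {x y : B} (h : x = y) (v : E x) :
    e.continuousLinearMapAt ℝ y (fiberCast E h v) = e.continuousLinearMapAt ℝ x v := by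
  subst h; rfl

theorem symmL_fiberCast {x y : B} (h : x = y) (w : F) :
    fiberCast E h (e.symmL ℝ x w) = e.symmL ℝ y w := by
  subst h; rfl

theorem continuousLinearMapAt_injective {x : B} (hx : x ∈ e.baseSet) :
    Function.Injective (e.continuousLinearMapAt ℝ x) :=
  Function.LeftInverse.injective (e.symmL_continuousLinearMapAt hx)

theorem continuousLinearMapAt_surjective {x : B} (hx : x ∈ e.baseSet) :
    Function.Surjective (e.continuousLinearMapAt ℝ x) :=
  Function.RightInverse.surjective (e.continuousLinearMapAt_symmL hx)

end FibreCoordinates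

variable {EM M EG G : Type*}
  [NormedAddCommGroup EM] [NormedSpace ℝ EM] [TopologicalSpace M] [ChartedSpace EM M]
  [NormedAddCommGroup EG] [NormedSpace ℝ EG] [TopologicalSpace G] [ChartedSpace EG G]
  {𝒢 : LieGroupoid EM M EG G}
  [IsManifold 𝓘(ℝ, EM) ∞ M] [IsManifold 𝓘(ℝ, EG) ∞ G]
  [FiniteDimensional ℝ EM] [FiniteDimensional ℝ EG]
  {F : Type*} [NormedAddCommGroup F] [NormedSpace ℝ F] [FiniteDimensional ℝ F]
  {E : M → Type*} [∀ x, AddCommGroup (E x)] [∀ x, Module ℝ (E x)] [∀ x, TopologicalSpace (E x)]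
  [TopologicalSpace (TotalSpace F E)] [FiberBundle F E] [VectorBundle ℝ F E]
  [ContMDiffVectorBundle ∞ F E 𝓘(ℝ, EM)]
  (e : Trivialization F (π F E)) [MemTrivializationAtlas e]

/-- A form in a trivialization of the bundle of coefficients. -/
noncomputable def formCoord (θ : OneForm 𝒢 F E) (g : G) : EG →L[ℝ] F :=
  (e.continuousLinearMapAt ℝ (𝒢.t g)).comp (θ g)

theorem formCoord_apply (θ : OneForm 𝒢 F E) (g : G) (X : EG) :
    formCoord e θ g X = e.continuousLinearMapAt ℝ (𝒢.t g) (θ g X) := rfl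

theorem formCoord_eq_zero_iff (θ : OneForm 𝒢 F E) {g : G} (hg : 𝒢.t g ∈ e.baseSet) (X : EG) :
    formCoord e θ g X = 0 ↔ θ g X = 0 :=
  map_eq_zero_iff _ (continuousLinearMapAt_injective e hg)

theorem formCoord_surjective (θ : OneForm 𝒢 F E) {g : G} (hg : 𝒢.t g ∈ e.baseSet)
    (hθ : Function.Surjective (θ g)) : Function.Surjective (formCoord e θ g) :=
  (continuousLinearMapAt_surjective e hg).comp hθ

theorem smoothFormAt_formCoord (θ : OneForm 𝒢 F E) {g : G} (hg : 𝒢.t g ∈ e.baseSet) :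
    SmoothFormAt (formCoord e θ) g := by
  intro v
  have h1 := (e.contMDiffAt_iff (IB := 𝓘(ℝ, EM))
    (f := fun z : TangentBundle 𝓘(ℝ, EG) G => (⟨𝒢.t z.1, θ.toFun z.1 z.2⟩ : TotalSpace F E))
    (x₀ := ⟨g, v⟩) ((Trivialization.mem_source _).2 hg)).1 (θ.contMDiff_toFun ⟨g, v⟩)
  refine h1.2.congr_of_eventuallyEq ?_
  filter_upwards [h1.1.continuousAt.eventually (e.open_baseSet.mem_nhds hg)] with z hz
  exact e.continuousLinearMapAt_apply_of_mem ℝ hz _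

theorem eventually_t_mem {g : G} (hg : 𝒢.t g ∈ e.baseSet) : ∀ᶠ k in 𝓝 g, 𝒢.t k ∈ e.baseSet :=
  (𝒢.smoothAt_t g).continuousAt.eventually (e.open_baseSet.mem_nhds hg)

/-- A representation in a trivialization of the bundle of coefficients. -/
noncomputable def repCoord (R : Representation 𝒢 F E) (h : G) : F →L[ℝ] F :=
  (e.continuousLinearMapAt ℝ (𝒢.t h)).comp ((R.act h).comp (e.symmL ℝ (𝒢.s h)))

theorem repCoord_u (R : Representation 𝒢 F E) {x : M} (hx : x ∈ e.baseSet) :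
    repCoord e R (𝒢.u x) = ContinuousLinearMap.id ℝ F := by
  ext w
  have h1 := congrArg (e.continuousLinearMapAt ℝ x)
    (R.act_u x (e.symmL ℝ (𝒢.s (𝒢.u x)) w))
  rw [continuousLinearMapAt_fiberCast, symmL_fiberCast, e.continuousLinearMapAt_symmL hx] at h1
  exact h1

/-- The action is given as a smooth map of total spaces. Evaluating it on sections with constant
coordinates gives smoothness on each vector, which suffices since `F` is finite-dimensional. -/
theorem smoothAt_repCoord (R : Representation 𝒢 F E) {g : G} (hs : 𝒢.s g ∈ e.baseSet)
    (ht : 𝒢.t g ∈ e.baseSet) : SmoothAt EG (F →L[ℝ] F) (repCoord e R) g := by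
  refine contMDiffAt_clm_of_apply fun w => ?_
  have hss : ∀ᶠ k in 𝓝 g, 𝒢.s k ∈ e.baseSet :=
    (𝒢.smoothAt_s g).continuousAt.eventually (e.open_baseSet.mem_nhds hs)
  have h1 : ContMDiffAt 𝓘(ℝ, EG) (𝓘(ℝ, EG).prod 𝓘(ℝ, F)) ∞
      (fun k : G => (⟨k, e.symmL ℝ (𝒢.s k) w⟩ : TotalSpace F (𝒢.sMap *ᵖ E))) g := by
    have : MemTrivializationAtlas (e.pullback 𝒢.sMap) := ⟨e, inferInstance, rfl⟩
    rw [(e.pullback 𝒢.sMap).contMDiffAt_iff (IB := 𝓘(ℝ, EG))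
      (f := fun k : G => (⟨k, e.symmL ℝ (𝒢.s k) w⟩ : TotalSpace F (𝒢.sMap *ᵖ E))) (x₀ := g)
      ((Trivialization.mem_source _).2 hs)]
    refine ⟨contMDiffAt_id, (contMDiffAt_const (c := w)).congr_of_eventuallyEq ?_⟩
    filter_upwards [hss] with k hk
    have h2 := e.continuousLinearMapAt_symmL (R := ℝ) hk w
    rw [e.continuousLinearMapAt_apply_of_mem ℝ hk] at h2
    exact h2
  have h2 := ContMDiffAt.comp (x := g)
    (g := fun z : TotalSpace F (𝒢.sMap *ᵖ E) =>
      (⟨𝒢.t z.1, R.act z.1 (show E (𝒢.s z.1) from z.2)⟩ : TotalSpace F E))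
    (f := fun k : G => (⟨k, e.symmL ℝ (𝒢.s k) w⟩ : TotalSpace F (𝒢.sMap *ᵖ E)))
    (R.contMDiff_act _) h1
  have h3 := ((e.contMDiffAt_iff (IB := 𝓘(ℝ, EM))
    (f := fun k : G => (⟨𝒢.t k, R.act k (e.symmL ℝ (𝒢.s k) w)⟩ : TotalSpace F E))
    (x₀ := g) ((Trivialization.mem_source _).2 ht)).1 h2).2
  refine h3.congr_of_eventuallyEq ?_
  filter_upwards [eventually_t_mem e ht] with k hk
  exact e.continuousLinearMapAt_apply_of_mem ℝ hk _

section Multiplicative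

variable {R : Representation 𝒢 F E} {θ : OneForm 𝒢 F E}

/-- Only the source of g must lie in the base set: there θ(Y) is rebuilt from its coordinates before
g acts. At the target only linearity of the coordinate map is used. -/
theorem IsMultiplicative.formCoord_dmulV (hθ : IsMultiplicative R θ) {g h : G}
    (c : 𝒢.s g = 𝒢.t h) (hs : 𝒢.s g ∈ e.baseSet)
    {X Y : EG} (hXY : tderiv EG EM 𝒢.s g X = tderiv EG EM 𝒢.t h Y) :
    formCoord e θ (𝒢.mul g h) (𝒢.dmulV g h X Y) =
      formCoord e θ g X + repCoord e R g (formCoord e θ h Y) := by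
  have h1 := congrArg (e.continuousLinearMapAt ℝ (𝒢.t g)) (hθ g h c X Y (by
    refine Eq.trans ?_ hXY
    exact fiberCast_tangent (G := M) (EG := EM) c _))
  rw [continuousLinearMapAt_fiberCast, map_add] at h1
  refine h1.trans (congrArg (_ + ·) ?_)
  simp only [repCoord, ContinuousLinearMap.comp_apply, formCoord_apply]
  rw [← continuousLinearMapAt_fiberCast e c.symm, e.symmL_continuousLinearMapAt hs]

/-- Multiplicativity along 1_x 1_x = 1_x gives θ(du v) = θ(du v) + θ(du v). -/
theorem IsMultiplicative.formCoord_tderiv_u (hθ : IsMultiplicative R θ) {x : M}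
    (hx : x ∈ e.baseSet) (v : EM) : formCoord e θ (𝒢.u x) (tderiv EM EG 𝒢.u x v) = 0 := by
  have huu : ∀ y, 𝒢.mul (𝒢.u y) (𝒢.u y) = 𝒢.u y := fun y => by
    have := 𝒢.mul_u (𝒢.u y)
    rwa [𝒢.s_u] at this
  have h1 := hθ.formCoord_dmulV e (g := 𝒢.u x) (h := 𝒢.u x) ((𝒢.s_u x).trans (𝒢.t_u x).symm)
    (by rwa [𝒢.s_u]) (X := tderiv EM EG 𝒢.u x v) (Y := tderiv EM EG 𝒢.u x v)
    (by rw [𝒢.tderiv_s_tderiv_u, 𝒢.tderiv_t_tderiv_u])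
  have hu : DiffAt EM EG 𝒢.u x := (𝒢.smoothAt_u x).diffAt
  have h2 := 𝒢.tderiv_mul hu hu
    (Filter.Eventually.of_forall fun y => (𝒢.s_u y).trans (𝒢.t_u y).symm) v
  rw [show (fun k => 𝒢.mul (𝒢.u k) (𝒢.u k)) = 𝒢.u from funext huu] at h2
  rw [← h2, huu, repCoord_u e R hx] at h1
  exact left_eq_add.1 h1

/-- Multiplicativity at the pair (1_{t(g)}, g) on the vectors (a, 0): the second term vanishes. -/
theorem IsMultiplicative.formCoord_rTrans (hθ : IsMultiplicative R θ) {g : G}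
    (hg : 𝒢.t g ∈ e.baseSet) (a : 𝒢.A (𝒢.t g)) :
    formCoord e θ g (𝒢.rTrans g (𝒢.inclV _ a)) =
      formCoord e θ (𝒢.u (𝒢.t g)) (𝒢.inclV _ a) := by
  have h1 := hθ.formCoord_dmulV e (g := 𝒢.u (𝒢.t g)) (h := g) (𝒢.s_u _)
    (by rwa [𝒢.s_u]) (X := 𝒢.inclV _ a) (Y := 0)
    (by rw [𝒢.tderiv_s_inclV, map_zero])
  rwa [𝒢.u_mul, map_zero, map_zero, add_zero] at h1

/-- The form vanishes on the tangent spaces of the manifold of units. -/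
theorem IsMultiplicative.extD_tderiv_u (hθ : IsMultiplicative R θ) {x : M}
    (hx : x ∈ e.baseSet) (v w : EM) :
    extD (formCoord e θ) (𝒢.u x) (tderiv EM EG 𝒢.u x v) (tderiv EM EG 𝒢.u x w) = 0 := by
  rw [← extD_pullbackForm (𝒢.smoothAt_u x)
    (smoothFormAt_formCoord e θ (by rwa [𝒢.t_u])),
    extD_congr (η' := fun _ => (0 : EM →L[ℝ] F))]
  · exact extD_zero x v w
  · filter_upwards [e.open_baseSet.mem_nhds hx] with y hy
    ext w
    exact hθ.formCoord_tderiv_u e hy w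

/-- The differential at the units of the representation, in a trivialization. -/
noncomputable def repDeriv (R : Representation 𝒢 F E) (x : M) (a : 𝒢.A x) : F →L[ℝ] F :=
  tderiv EG (F →L[ℝ] F) (repCoord e R) (𝒢.u x) (𝒢.inclV x a)

/-- The exterior derivative of a multiplicative form. -/
theorem IsMultiplicative.extD_add_rTrans (hθ : IsMultiplicative R θ) {g : G}
    (hg : 𝒢.t g ∈ e.baseSet) (Y₁ Y₂ : EG) (a₁ a₂ : 𝒢.A (𝒢.t g)) :
    extD (formCoord e θ) g (Y₁ + 𝒢.rTrans g (𝒢.inclV _ a₁)) (Y₂ + 𝒢.rTrans g (𝒢.inclV _ a₂)) =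
      extD (formCoord e θ) (𝒢.u (𝒢.t g))
        (tderiv EM EG 𝒢.u (𝒢.t g) (tderiv EG EM 𝒢.t g Y₁) + 𝒢.inclV _ a₁)
        (tderiv EM EG 𝒢.u (𝒢.t g) (tderiv EG EM 𝒢.t g Y₂) + 𝒢.inclV _ a₂) +
      extD (formCoord e θ) g Y₁ Y₂ +
      (repDeriv e R _ a₁ (formCoord e θ g Y₂) - repDeriv e R _ a₂ (formCoord e θ g Y₁)) := by
  -- c₂ passes through g with partial derivatives Y₁, Y₂. Below, c₁ passes through 1_{t(g)} with
  -- partial derivatives du dt Yᵢ + aᵢ and remains composable with c₂, so c₁c₂ passes through g with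
  -- partial derivatives Yᵢ + R_g aᵢ.
  obtain ⟨c₂, h20, h2, h2d⟩ := exists_smoothAt_tderiv_eq g
    ((ContinuousLinearMap.fst ℝ ℝ ℝ).smulRight Y₁ + (ContinuousLinearMap.snd ℝ ℝ ℝ).smulRight Y₂)
  have h2Y₁ : tderiv (ℝ × ℝ) EG c₂ 0 (1, 0) = Y₁ := by rw [h2d]; simp
  have h2Y₂ : tderiv (ℝ × ℝ) EG c₂ 0 (0, 1) = Y₂ := by rw [h2d]; simp
  have hτ : SmoothAt (ℝ × ℝ) EM (fun k => 𝒢.t (c₂ k)) 0 :=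
    ContMDiffAt.comp (x := (0 : ℝ × ℝ)) (g := 𝒢.t) (f := c₂) (𝒢.smoothAt_t _) h2
  have hτ0 : 𝒢.t (c₂ 0) = (𝒢.t g) := by rw [h20]
  let a : Fin 2 → 𝒢.A (𝒢.t g) := ![a₁, a₂]
  have hyt : 𝒢.t (c₂ 0) ∈ 𝒢.trivSet (𝒢.t g) := by rw [hτ0]; exact 𝒢.mem_trivSet (𝒢.t g)
  obtain ⟨c₁, h1, h1s, h1d⟩ := 𝒢.exists_family (q := (0 : ℝ × ℝ)) (ι := Fin 2)
    (V := fun i k => 𝒢.inclV _ (𝒢.constSec (𝒢.t g) (𝒢.coordA (𝒢.t g) (𝒢.t g) (a i)) (𝒢.t (c₂ k)))) hτ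
    (fun i => 𝒢.contMDiffAt_inclV_constSec hτ contMDiffAt_const hyt)
    (Filter.Eventually.of_forall fun k i => 𝒢.tderiv_s_inclV _ _)
    ![ContinuousLinearMap.fst ℝ ℝ ℝ, ContinuousLinearMap.snd ℝ ℝ ℝ]
    (fun i => by fin_cases i <;> rfl)
  obtain ⟨h10, h1d⟩ := h1d.self_of_nhds fun i => by fin_cases i <;> rfl
  have hV : ∀ i, 𝒢.inclV _ (𝒢.constSec (𝒢.t g) (𝒢.coordA (𝒢.t g) (𝒢.t g) (a i)) (𝒢.t (c₂ 0))) =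
      𝒢.inclV (𝒢.t g) (a i) := fun i => by
    rw [hτ0, 𝒢.constSec_coordA (𝒢.mem_trivSet (𝒢.t g))]
  simp only [hV] at h1d
  rw [hτ0] at h10
  have hτd : ∀ v, tderiv (ℝ × ℝ) EM (fun k => 𝒢.t (c₂ k)) 0 v =
      tderiv EG EM 𝒢.t g (tderiv (ℝ × ℝ) EG c₂ 0 v) := fun v => by
    rw [tderiv_comp (𝒢.smoothAt_t _).diffAt h2.diffAt, h20]
  have h1Y₁ : tderiv (ℝ × ℝ) EG c₁ 0 (1, 0) =
      tderiv EM EG 𝒢.u (𝒢.t g) (tderiv EG EM 𝒢.t g Y₁) + 𝒢.inclV (𝒢.t g) a₁ := by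
    rw [h1d, hτd, h2Y₁, hτ0]; simp [a]
  have h1Y₂ : tderiv (ℝ × ℝ) EG c₁ 0 (0, 1) =
      tderiv EM EG 𝒢.u (𝒢.t g) (tderiv EG EM 𝒢.t g Y₂) + 𝒢.inclV (𝒢.t g) a₂ := by
    rw [h1d, hτd, h2Y₂, hτ0]; simp [a]
  have hm : SmoothAt (ℝ × ℝ) EG (fun k => 𝒢.mul (c₁ k) (c₂ k)) 0 := 𝒢.smoothAt_mul h1 h2 h1s
  have hm0 : 𝒢.mul (c₁ 0) (c₂ 0) = g := by rw [h10, h20, 𝒢.u_mul]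
  have hmY₁ : tderiv (ℝ × ℝ) EG (fun k => 𝒢.mul (c₁ k) (c₂ k)) 0 (1, 0) =
      Y₁ + 𝒢.rTrans g (𝒢.inclV _ a₁) := by
    rw [𝒢.tderiv_mul h1.diffAt h2.diffAt h1s, h1Y₁, h2Y₁, h10, h20, 𝒢.dmulV_unit_add]
  have hmY₂ : tderiv (ℝ × ℝ) EG (fun k => 𝒢.mul (c₁ k) (c₂ k)) 0 (0, 1) =
      Y₂ + 𝒢.rTrans g (𝒢.inclV _ a₂) := by
    rw [𝒢.tderiv_mul h1.diffAt h2.diffAt h1s, h1Y₂, h2Y₂, h10, h20, 𝒢.dmulV_unit_add]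
  have huy : 𝒢.t (𝒢.u (𝒢.t g)) ∈ e.baseSet := by rwa [𝒢.t_u]
  have hη : SmoothFormAt (formCoord e θ) g := smoothFormAt_formCoord e θ hg
  have hηu : SmoothFormAt (formCoord e θ) (𝒢.u (𝒢.t g)) := smoothFormAt_formCoord e θ huy
  have hR : SmoothAt EG (F →L[ℝ] F) (repCoord e R) (𝒢.u (𝒢.t g)) :=
    smoothAt_repCoord e R (by rwa [𝒢.s_u]) huy
  have hRu : repCoord e R (𝒢.u (𝒢.t g)) = ContinuousLinearMap.id ℝ F := repCoord_u e R hg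
  -- The action is the identity along the units, so only the part aᵢ of the derivative of c₁
  -- differentiates it.
  have hRdu : ∀ v, tderiv EG (F →L[ℝ] F) (repCoord e R) (𝒢.u (𝒢.t g)) (tderiv EM EG 𝒢.u (𝒢.t g) v) = 0 := by
    intro v
    rw [← tderiv_comp hR.diffAt (𝒢.smoothAt_u (𝒢.t g)).diffAt,
      tderiv_congr (g := fun _ => ContinuousLinearMap.id ℝ F), tderiv_const]
    filter_upwards [e.open_baseSet.mem_nhds hg] with x hx using repCoord_u e R hx
  -- Multiplicativity holds at all parameters near 0, so it may be differentiated.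
  have hsplit : ∀ b : ℝ × ℝ,
      (fun k => formCoord e θ (𝒢.mul (c₁ k) (c₂ k))
        (tderiv (ℝ × ℝ) EG (fun k => 𝒢.mul (c₁ k) (c₂ k)) k b)) =ᶠ[𝓝 0]
      fun k => formCoord e θ (c₁ k) (tderiv (ℝ × ℝ) EG c₁ k b) +
        repCoord e R (c₁ k) (formCoord e θ (c₂ k) (tderiv (ℝ × ℝ) EG c₂ k b)) := by
    intro b
    have hsb : ∀ᶠ k in 𝓝 (0 : ℝ × ℝ), 𝒢.t (c₂ k) ∈ e.baseSet :=
      hτ.continuousAt.eventually (e.open_baseSet.mem_nhds (by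
        show 𝒢.t (c₂ 0) ∈ _
        rwa [hτ0]))
    filter_upwards [h1s.eventually_nhds, h1.eventually_diffAt, h2.eventually_diffAt, hsb]
      with k hk hk1 hk2 hkb
    rw [𝒢.tderiv_mul hk1 hk2 hk]
    refine hθ.formCoord_dmulV e hk.self_of_nhds (by rwa [hk.self_of_nhds]) ?_
    rw [← tderiv_comp (𝒢.smoothAt_s _).diffAt hk1, ← tderiv_comp (𝒢.smoothAt_t _).diffAt hk2,
      tderiv_congr hk]
  have hd1 : ∀ b : ℝ × ℝ, DifferentiableAt ℝ
      (fun k => formCoord e θ (c₁ k) (tderiv (ℝ × ℝ) EG c₁ k b)) 0 := fun b =>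
    (SmoothFormAt.apply (by rwa [h10]) (h1.tderiv_const b)).diffAt.differentiableAt
  have hd2 : ∀ b : ℝ × ℝ, DifferentiableAt ℝ
      (fun k => formCoord e θ (c₂ k) (tderiv (ℝ × ℝ) EG c₂ k b)) 0 := fun b =>
    (SmoothFormAt.apply (by rwa [h20]) (h2.tderiv_const b)).diffAt.differentiableAt
  have hRc : SmoothAt (ℝ × ℝ) (F →L[ℝ] F) (fun k => repCoord e R (c₁ k)) 0 :=
    ContMDiffAt.comp (x := (0 : ℝ × ℝ)) (g := repCoord e R) (f := c₁) (by rwa [h10]) h1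
  have hRcd := hRc.diffAt.differentiableAt
  -- Product rule at 0, where the action is the identity: the one additional term differentiates the
  -- action.
  have hder : ∀ b b' : ℝ × ℝ, fderiv ℝ (fun k => formCoord e θ (𝒢.mul (c₁ k) (c₂ k))
        (tderiv (ℝ × ℝ) EG (fun k => 𝒢.mul (c₁ k) (c₂ k)) k b)) 0 b' =
      fderiv ℝ (fun k => formCoord e θ (c₁ k) (tderiv (ℝ × ℝ) EG c₁ k b)) 0 b' +
      (fderiv ℝ (fun k => formCoord e θ (c₂ k) (tderiv (ℝ × ℝ) EG c₂ k b)) 0 b' +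
        tderiv EG (F →L[ℝ] F) (repCoord e R) (𝒢.u (𝒢.t g)) (tderiv (ℝ × ℝ) EG c₁ 0 b')
          (formCoord e θ g (tderiv (ℝ × ℝ) EG c₂ 0 b))) := by
    intro b b'
    have h3 := hRcd.hasFDerivAt.clm_apply (hd2 b).hasFDerivAt
    rw [(hsplit b).fderiv_eq, fderiv_fun_add (hd1 b) h3.differentiableAt, h3.fderiv]
    simp only [add_apply, ContinuousLinearMap.comp_apply, ContinuousLinearMap.flip_apply]
    rw [h10, hRu, h20, ← tderiv_eq_fderiv (f := fun k => repCoord e R (c₁ k)),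
      tderiv_comp (g := repCoord e R) (f := c₁) (by rw [h10]; exact hR.diffAt) h1.diffAt, h10]
    rfl
  -- Antisymmetrizing `hder`, the derivatives along c₁ and c₂ reassemble into dθ at the unit and at
  -- g.
  have key := extD_tderiv (f := fun k => 𝒢.mul (c₁ k) (c₂ k)) (q := 0)
    (by rw [hm0]; exact hη) hm (1, 0) (0, 1)
  have key1 := extD_tderiv (f := c₁) (q := 0) (by rw [h10]; exact hηu) h1 (1, 0) (0, 1)
  have key2 := extD_tderiv (f := c₂) (q := 0) (by rw [h20]; exact hη) h2 (1, 0) (0, 1)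
  rw [hmY₁, hmY₂, hm0, hder, hder, h1Y₁, h1Y₂, h2Y₁, h2Y₂, map_add, map_add, hRdu, hRdu,
    zero_add, zero_add] at key
  rw [h1Y₁, h1Y₂, h10] at key1
  rw [h2Y₁, h2Y₂, h20] at key2
  rw [key, key1, key2, repDeriv, repDeriv]
  abel

end Multiplicative

end LieGroupoid

/-! ### δθ, the Spencer operator and the torsion through dθ -/

namespace LieGroupoid

variable {EM M EG G : Type*}
  [NormedAddCommGroup EM] [NormedSpace ℝ EM] [TopologicalSpace M] [ChartedSpace EM M]
  [NormedAddCommGroup EG] [NormedSpace ℝ EG] [TopologicalSpace G] [ChartedSpace EG G]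
  {𝒢 : LieGroupoid EM M EG G}
  [IsManifold 𝓘(ℝ, EM) ∞ M] [IsManifold 𝓘(ℝ, EG) ∞ G]
  [FiniteDimensional ℝ EM] [FiniteDimensional ℝ EG]
  {F : Type*} [NormedAddCommGroup F] [NormedSpace ℝ F] [FiniteDimensional ℝ F]
  {E : M → Type*} [∀ x, AddCommGroup (E x)] [∀ x, Module ℝ (E x)] [∀ x, TopologicalSpace (E x)]
  [TopologicalSpace (TotalSpace F E)] [FiberBundle F E] [VectorBundle ℝ F E]
  [ContMDiffVectorBundle ∞ F E 𝓘(ℝ, EM)]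
  (e : Trivialization F (π F E)) [MemTrivializationAtlas e]

/-- Pointwise surjectivity at g provides an extension tangent to the kernel, which makes the choice
in `extendInKer` a meaningful one. -/
theorem isKerExtension_extendInKer {θ : OneForm 𝒢 F E} {g : G} (hs : Function.Surjective (θ g))
    {X : EG} (hX : θ g X = 0) : IsKerExtension θ g X (extendInKer θ g X) := by
  refine Classical.epsilon_spec (p := IsKerExtension θ g X) ?_
  set e := trivializationAt F E (𝒢.t g)
  have hg : 𝒢.t g ∈ e.baseSet := mem_baseSet_trivializationAt _ _ _
  obtain ⟨V, h1, h2, h3⟩ := exists_smoothField_ker (η := formCoord e θ)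
    ((eventually_t_mem e hg).mono fun k hk => smoothFormAt_formCoord e θ hk)
    (formCoord_surjective e θ hg hs) ((formCoord_eq_zero_iff e θ hg X).2 hX)
  refine ⟨V, h1, h2, ?_⟩
  filter_upwards [h3, eventually_t_mem e hg] with k hk hk'
  exact (formCoord_eq_zero_iff e θ hk' _).1 hk

theorem exists_extendInKer_eq {θ : OneForm 𝒢 F E} {g : G} (hs : Function.Surjective (θ g))
    {X : EG} (hX : θ g X = 0) : ∃ V : G → EG, extendInKer θ g X = V ∧ V g = X ∧
      SmoothFieldAt V g ∧ ∀ᶠ k in 𝓝 g, θ k (V k) = 0 := by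
  obtain ⟨h1, h2, h3⟩ := isKerExtension_extendInKer hs hX
  exact ⟨_, rfl, h1, h2.self_of_nhds, h3⟩

theorem tderiv_formCoord_ker {θ : OneForm 𝒢 F E} {g : G} {V : G → EG}
    (hV : ∀ᶠ k in 𝓝 g, θ k (V k) = 0) (Z : EG) :
    tderiv EG F (fun k => formCoord e θ k (V k)) g Z = 0 := by
  rw [tderiv_congr (g := fun _ => 0), tderiv_const]
  filter_upwards [hV] with k hk
  show e.continuousLinearMapAt ℝ _ (θ k (V k)) = 0
  rw [hk, map_zero]

/-- The partial differential in terms of the exterior derivative. -/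
theorem continuousLinearMapAt_partialDiff {θ : OneForm 𝒢 F E} {g : G} (hg : 𝒢.t g ∈ e.baseSet)
    (hs : Function.Surjective (θ g)) {X Y : EG} (hX : θ g X = 0) (hY : θ g Y = 0) :
    e.continuousLinearMapAt ℝ (𝒢.t g) (partialDiff θ g X Y) = -extD (formCoord e θ) g X Y := by
  obtain ⟨V, hV, hV1, hV2, hV3⟩ := exists_extendInKer_eq hs hX
  obtain ⟨W, hW, hW1, hW2, hW3⟩ := exists_extendInKer_eq hs hY
  -- θ(V) and θ(W) vanish near g, so only the bracket term of Cartan's formula survives, with its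
  -- minus sign.
  have h1 := extD_apply_fields (smoothFormAt_formCoord e θ hg) hV2 hW2
  rw [tderiv_formCoord_ker e hV3, tderiv_formCoord_ker e hW3, sub_self, zero_sub, hV1, hW1] at h1
  have h2 : partialDiff θ g X Y = θ g (fieldBracket (EN := EG) V W g) := by subst hV hW; rfl
  rw [h1, neg_neg, h2]
  rfl

section Sections

variable {θ : OneForm 𝒢 F E}

/-- The section `α` of the algebroid is smooth at `x`. -/
def SmoothSectionAt (𝒢 : LieGroupoid EM M EG G) (α : ∀ x, 𝒢.A x) (x : M) : Prop :=
  ContMDiffAt 𝓘(ℝ, EM) (𝓘(ℝ, EM).prod 𝓘(ℝ, Fib EM EG)) ∞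
    (fun z => (⟨z, α z⟩ : TotalSpace (Fib EM EG) 𝒢.A)) x

/-- The composition of a form with a section of the algebroid, in a trivialization. -/
noncomputable def formSection (θ : OneForm 𝒢 F E) (α : ∀ x, 𝒢.A x) (z : M) : F :=
  formCoord e θ (𝒢.u z) (𝒢.inclV z (α z))

/-- Families of elements of the algebroid are smooth families of tangent vectors. -/
theorem contMDiffAt_inclV_family {EQ Q : Type*} [NormedAddCommGroup EQ] [NormedSpace ℝ EQ]
    [TopologicalSpace Q] [ChartedSpace EQ Q] {τ : Q → M} {σ : ∀ k, 𝒢.A (τ k)} {q : Q}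
    (hσ : ContMDiffAt 𝓘(ℝ, EQ) (𝓘(ℝ, EM).prod 𝓘(ℝ, Fib EM EG)) ∞
      (fun k => (⟨τ k, σ k⟩ : TotalSpace (Fib EM EG) 𝒢.A)) q) :
    ContMDiffAt 𝓘(ℝ, EQ) 𝓘(ℝ, EG).tangent ∞
      (fun k => (⟨𝒢.u (τ k), 𝒢.inclV (τ k) (σ k)⟩ : TangentBundle 𝓘(ℝ, EG) G)) q :=
  ContMDiffAt.comp (x := q) (g := fun z : TotalSpace (Fib EM EG) 𝒢.A =>
        (⟨𝒢.u z.1, 𝒢.inclV z.1 z.2⟩ : TangentBundle 𝓘(ℝ, EG) G))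
    (f := fun k => (⟨τ k, σ k⟩ : TotalSpace (Fib EM EG) 𝒢.A)) (𝒢.contMDiff_inclV _) hσ

theorem smoothAt_formSection {α : ∀ x, 𝒢.A x} {x : M} (hx : x ∈ e.baseSet)
    (hα : SmoothSectionAt 𝒢 α x) : SmoothAt EM F (formSection e θ α) x :=
  SmoothFormAt.apply (c := 𝒢.u) (smoothFormAt_formCoord e θ (by rwa [𝒢.t_u]))
    (contMDiffAt_inclV_family hα)

theorem smoothFieldAt_rightInv {α : ∀ x, 𝒢.A x} {g : G}
    (hα : SmoothSectionAt 𝒢 α (𝒢.t g)) : SmoothFieldAt (𝒢.rightInv α) g := by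
  have h1 : 𝒢.rightInv α = fun k => 𝒢.rTrans k (𝒢.inclV (𝒢.t k) (α (𝒢.t k))) :=
    funext fun k => 𝒢.rightInv_eq α k
  have h2 := 𝒢.smoothFieldAt_rTrans (V := fun k => 𝒢.inclV (𝒢.t k) (α (𝒢.t k)))
    (contMDiffAt_inclV_family (ContMDiffAt.comp (x := g)
      (g := fun z => (⟨z, α z⟩ : TotalSpace (Fib EM EG) 𝒢.A)) (f := 𝒢.t) hα (𝒢.smoothAt_t g)))
    (Filter.Eventually.of_forall fun k => 𝒢.tderiv_s_inclV _ _)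
  rw [h1]
  exact h2

theorem rightInv_u (α : ∀ x, 𝒢.A x) (x : M) :
    𝒢.rightInv α (𝒢.u x) = 𝒢.inclV x (α x) := by
  have h1 : ∀ y, y = x → 𝒢.rTrans (𝒢.u x) (𝒢.inclV y (α y)) = 𝒢.inclV x (α x) := by
    rintro _ rfl
    exact 𝒢.rTrans_unit _ _
  exact (𝒢.rightInv_eq α _).trans (h1 _ (𝒢.t_u x))

variable {R : Representation 𝒢 F E}

/-- Right invariance of θ on vertical vectors says θ(α^r) = t^*(lα). -/
theorem IsMultiplicative.tderiv_formCoord_rightInv (hθ : IsMultiplicative R θ)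
    {α : ∀ x, 𝒢.A x} {x : M} (hx : x ∈ e.baseSet) (hα : SmoothSectionAt 𝒢 α x) (v : EG) :
    tderiv EG F (fun k => formCoord e θ k (𝒢.rightInv α k)) (𝒢.u x) v =
      tderiv EM F (formSection e θ α) x (tderiv EG EM 𝒢.t (𝒢.u x) v) := by
  have h1 : (fun k => formCoord e θ k (𝒢.rightInv α k)) =ᶠ[𝓝 (𝒢.u x)]
      fun k => formSection e θ α (𝒢.t k) := by
    filter_upwards [eventually_t_mem (𝒢 := 𝒢) e (g := 𝒢.u x) (by rwa [𝒢.t_u])] with k hk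
    exact (congrArg _ (𝒢.rightInv_eq α k)).trans (hθ.formCoord_rTrans e hk _)
  have h2 := tderiv_comp (g := formSection e θ α) (f := 𝒢.t) (x := 𝒢.u x)
    (by rw [𝒢.t_u]; exact (smoothAt_formSection e hx hα).diffAt) (𝒢.smoothAt_t _).diffAt v
  rw [tderiv_congr h1, h2, 𝒢.t_u]

theorem exists_rightInv_eq {α : ∀ x, 𝒢.A x} {x : M} (hα : SmoothSectionAt 𝒢 α x) :
    ∃ V : G → EG, 𝒢.rightInv α = V ∧ V (𝒢.u x) = 𝒢.inclV x (α x) ∧ SmoothFieldAt V (𝒢.u x) :=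
  ⟨_, rfl, rightInv_u α x, smoothFieldAt_rightInv (by rwa [𝒢.t_u])⟩

/-- The Spencer operator in terms of the exterior derivative. -/
theorem IsMultiplicative.continuousLinearMapAt_spencer (hθ : IsMultiplicative R θ)
    {α : ∀ x, 𝒢.A x} {x : M} (hs : Function.Surjective (θ (𝒢.u x))) (hx : x ∈ e.baseSet)
    (hα : SmoothSectionAt 𝒢 α x) (X : EM) :
    e.continuousLinearMapAt ℝ x (spencer θ α x X) =
      tderiv EM F (formSection e θ α) x X -
        extD (formCoord e θ) (𝒢.u x) (tderiv EM EG 𝒢.u x X) (𝒢.inclV x (α x)) := by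
  have hux : 𝒢.t (𝒢.u x) ∈ e.baseSet := by rwa [𝒢.t_u]
  have hX0 : θ (𝒢.u x) (tderiv EM EG 𝒢.u x X) = 0 :=
    (formCoord_eq_zero_iff e θ hux _).1 (hθ.formCoord_tderiv_u e hx X)
  obtain ⟨V, hV, hV1, hV2, hV3⟩ := exists_extendInKer_eq hs hX0
  obtain ⟨W, hW, hW1, hW2⟩ := exists_rightInv_eq hα
  -- θ(V) = 0 near the unit, while θ(α^r) = t^*(lα) is differentiated along du X, which dt maps to
  -- X.
  have h1 := extD_apply_fields (smoothFormAt_formCoord e θ hux) hV2 hW2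
  have h2 := hθ.tderiv_formCoord_rightInv e hx hα (tderiv EM EG 𝒢.u x X)
  rw [hW, 𝒢.tderiv_t_tderiv_u] at h2
  rw [tderiv_formCoord_ker e hV3, hV1, hW1, sub_zero, h2] at h1
  have h3 : spencer θ α x X = atUnit θ x (fieldBracket (EN := EG) V W (𝒢.u x)) := by
    subst hV hW; rfl
  rw [h1, sub_sub_cancel, h3]
  exact continuousLinearMapAt_fiberCast e (𝒢.t_u x) _

/-- Cartan's formula for the fields α^r and β^r at the unit, with θ(α^r) = t^*(lα) and likewise for
β. -/
theorem IsMultiplicative.continuousLinearMapAt_algebroidBracket (hθ : IsMultiplicative R θ)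
    {α β : ∀ x, 𝒢.A x} {x : M} (hx : x ∈ e.baseSet)
    (hα : SmoothSectionAt 𝒢 α x) (hβ : SmoothSectionAt 𝒢 β x) :
    e.continuousLinearMapAt ℝ x (atUnit θ x (𝒢.algebroidBracket α β x)) =
      tderiv EM F (formSection e θ β) x (tderiv EG EM 𝒢.t (𝒢.u x) (𝒢.inclV x (α x))) -
      tderiv EM F (formSection e θ α) x (tderiv EG EM 𝒢.t (𝒢.u x) (𝒢.inclV x (β x))) -
      extD (formCoord e θ) (𝒢.u x) (𝒢.inclV x (α x)) (𝒢.inclV x (β x)) := by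
  obtain ⟨V, hV, hV1, hV2⟩ := exists_rightInv_eq hα
  obtain ⟨W, hW, hW1, hW2⟩ := exists_rightInv_eq hβ
  have h1 := extD_apply_fields (smoothFormAt_formCoord e θ (by rwa [𝒢.t_u])) hV2 hW2
  have h2 := hθ.tderiv_formCoord_rightInv e hx hα (𝒢.inclV x (β x))
  have h3 := hθ.tderiv_formCoord_rightInv e hx hβ (𝒢.inclV x (α x))
  rw [hV] at h2
  rw [hW] at h3
  rw [hV1, hW1, h2, h3] at h1
  rw [h1, sub_sub_cancel, algebroidBracket, atUnit, continuousLinearMapAt_fiberCast, hV, hW]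
  rfl

theorem anchor_eq (x : M) (a : 𝒢.A x) :
    𝒢.anchor x a = tderiv EG EM 𝒢.t (𝒢.u x) (𝒢.inclV x a) :=
  fiberCast_tangent (G := M) (EG := EM) (𝒢.t_u x) _

theorem smoothSectionAt_extend {x : M} (a : 𝒢.A x) :
    SmoothSectionAt 𝒢 (FiberBundle.extend (Fib EM EG) a) x := by
  have h := 𝒢.contMDiffAt_constSec (EQ := EM) (x₀ := x) (τ := fun z => z)
    (w := fun _ => (trivializationAt (Fib EM EG) 𝒢.A x ⟨x, a⟩).2) (q := x) contMDiffAt_id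
    contMDiffAt_const (𝒢.mem_trivSet x)
  refine h.congr_of_eventuallyEq ?_
  filter_upwards [(𝒢.isOpen_trivSet x).mem_nhds (𝒢.mem_trivSet x)] with z hz
  have : FiberBundle.extend (Fib EM EG) a z =
      𝒢.constSec x (trivializationAt (Fib EM EG) 𝒢.A x ⟨x, a⟩).2 z :=
    (Trivialization.symmL_apply (R := ℝ) _ hz _).symm
  rw [this]

/-- The torsion tensor in terms of the exterior derivative. -/
theorem IsMultiplicative.continuousLinearMapAt_halfBracket (hθ : IsMultiplicative R θ) {x : M}
    (hs : Function.Surjective (θ (𝒢.u x))) (hx : x ∈ e.baseSet) (a b : 𝒢.A x) :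
    e.continuousLinearMapAt ℝ x (halfBracket θ x a b) =
      extD (formCoord e θ) (𝒢.u x) (𝒢.inclV x a) (𝒢.inclV x b) -
      extD (formCoord e θ) (𝒢.u x)
        (tderiv EM EG 𝒢.u x (tderiv EG EM 𝒢.t (𝒢.u x) (𝒢.inclV x a))) (𝒢.inclV x b) +
      extD (formCoord e θ) (𝒢.u x)
        (tderiv EM EG 𝒢.u x (tderiv EG EM 𝒢.t (𝒢.u x) (𝒢.inclV x b))) (𝒢.inclV x a) := by
  have ha := smoothSectionAt_extend a
  have hb := smoothSectionAt_extend b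
  rw [halfBracket, map_sub, map_sub, anchor_eq, anchor_eq]
  have h1 := hθ.continuousLinearMapAt_spencer e hs hx hb
    (tderiv EG EM 𝒢.t (𝒢.u x) (𝒢.inclV x a))
  have h2 := hθ.continuousLinearMapAt_spencer e hs hx ha
    (tderiv EG EM 𝒢.t (𝒢.u x) (𝒢.inclV x b))
  have h3 := hθ.continuousLinearMapAt_algebroidBracket e hx ha hb
  rw [FiberBundle.extend_apply_self] at h1 h2
  rw [FiberBundle.extend_apply_self, FiberBundle.extend_apply_self] at h3
  -- The derivatives of lα and lβ cancel, and what is left depends only on a and b.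
  refine (congrArg₂ (· - ·) (congrArg₂ (· - ·) h1 h2) h3).trans ?_
  abel

end Sections

end LieGroupoid

/-! ### Leibniz rule for finite sums -/

section SumRule

variable {EQ Q F : Type*} [NormedAddCommGroup EQ] [NormedSpace ℝ EQ] [TopologicalSpace Q]
  [ChartedSpace EQ Q] [NormedAddCommGroup F] [NormedSpace ℝ F]

theorem tderiv_add' {f g : Q → F} {q : Q} (hf : DiffAt EQ F f q) (hg : DiffAt EQ F g q) (v : EQ) :
    tderiv EQ F (fun k => f k + g k) q v = tderiv EQ F f q v + tderiv EQ F g q v :=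
  DFunLike.congr_fun (mvfderiv_add hf hg) v

theorem tderiv_smul' {f : Q → ℝ} {g : Q → F} {q : Q} (hf : DiffAt EQ ℝ f q)
    (hg : DiffAt EQ F g q) (v : EQ) :
    tderiv EQ F (fun k => f k • g k) q v = f q • tderiv EQ F g q v + tderiv EQ ℝ f q v • g q :=
  DFunLike.congr_fun (mvfderiv_smul hf hg) v

theorem tderiv_sum_smul {ι : Type*} (s : Finset ι) {f : ι → Q → ℝ} {g : ι → Q → F} {q : Q}
    (hf : ∀ i, SmoothAt EQ ℝ (f i) q) (hg : ∀ i, SmoothAt EQ F (g i) q) (v : EQ) :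
    tderiv EQ F (fun k => ∑ i ∈ s, f i k • g i k) q v =
      ∑ i ∈ s, (f i q • tderiv EQ F (g i) q v + tderiv EQ ℝ (f i) q v • g i q) := by
  classical
  induction s using Finset.induction_on with
  | empty =>
    simp only [Finset.sum_empty]
    exact tderiv_const q 0 v
  | insert i s hi ih =>
    simp only [Finset.sum_insert hi]
    rw [tderiv_add' (f := fun k => f i k • g i k) (g := fun k => ∑ i ∈ s, f i k • g i k)
      (SmoothAt.diffAt ((hf i).smul (hg i)))
      (SmoothAt.diffAt (ContMDiffAt.sum fun j _ => (hf j).smul (hg j))), ih,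
      tderiv_smul' (hf i).diffAt (hg i).diffAt]

end SumRule

/-! ### The pulled-back Spencer operator and the Maurer–Cartan form through dθ -/

namespace LieGroupoid

theorem eq_sum_localFrame {B F : Type*} [TopologicalSpace B] [NormedAddCommGroup F]
    [NormedSpace ℝ F] {E : B → Type*} [∀ x, AddCommGroup (E x)] [∀ x, Module ℝ (E x)]
    [∀ x, TopologicalSpace (E x)] [TopologicalSpace (TotalSpace F E)] [FiberBundle F E]
    [VectorBundle ℝ F E] (t : Trivialization F (π F E)) [MemTrivializationAtlas t]
    {ι : Type*} [Fintype ι] (b : Module.Basis ι ℝ F) {z : B} (hz : z ∈ t.baseSet) (a : E z) :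
    a = ∑ i, b.repr (t ⟨z, a⟩).2 i • t.localFrame b i z := by
  refine continuousLinearMapAt_injective t hz ?_
  have h1 : ∀ i, t.continuousLinearMapAt ℝ z (t.localFrame b i z) = b i := by
    intro i
    rw [t.localFrame_apply_of_mem_baseSet b hz,
      Trivialization.continuousLinearMapAt_apply_of_mem ℝ t hz]
    simp [Trivialization.basisAt, hz]
  rw [map_sum]
  simp only [map_smul, h1, b.sum_repr]
  exact t.continuousLinearMapAt_apply_of_mem ℝ hz a

variable {EM M EG G : Type*}
  [NormedAddCommGroup EM] [NormedSpace ℝ EM] [TopologicalSpace M] [ChartedSpace EM M]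
  [NormedAddCommGroup EG] [NormedSpace ℝ EG] [TopologicalSpace G] [ChartedSpace EG G]
  {𝒢 : LieGroupoid EM M EG G}
  [IsManifold 𝓘(ℝ, EM) ∞ M] [IsManifold 𝓘(ℝ, EG) ∞ G]
  [FiniteDimensional ℝ EM] [FiniteDimensional ℝ EG]
  {F : Type*} [NormedAddCommGroup F] [NormedSpace ℝ F] [FiniteDimensional ℝ F]
  {E : M → Type*} [∀ x, AddCommGroup (E x)] [∀ x, Module ℝ (E x)] [∀ x, TopologicalSpace (E x)]
  [TopologicalSpace (TotalSpace F E)] [FiberBundle F E] [VectorBundle ℝ F E]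
  [ContMDiffVectorBundle ∞ F E 𝓘(ℝ, EM)]
  (e : Trivialization F (π F E)) [MemTrivializationAtlas e]
  {R : Representation 𝒢 F E} {θ : OneForm 𝒢 F E}

/-- The pull-back of the Spencer operator in terms of the exterior derivative. -/
theorem IsMultiplicative.continuousLinearMapAt_pullbackSpencer (hθ : IsMultiplicative R θ)
    {EQ Q : Type*} [NormedAddCommGroup EQ] [NormedSpace ℝ EQ] [TopologicalSpace Q]
    [ChartedSpace EQ Q] {τ : Q → M} {σ : ∀ k, 𝒢.A (τ k)} {q : Q}
    (hs : Function.Surjective (θ (𝒢.u (τ q)))) (hq : τ q ∈ e.baseSet)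
    (hσ : ContMDiffAt 𝓘(ℝ, EQ) (𝓘(ℝ, EM).prod 𝓘(ℝ, Fib EM EG)) ∞
      (fun k => (⟨τ k, σ k⟩ : TotalSpace (Fib EM EG) 𝒢.A)) q) (X : EQ) :
    e.continuousLinearMapAt ℝ (τ q) (pullbackSpencer θ τ σ q X) =
      tderiv EQ F (fun k => formCoord e θ (𝒢.u (τ k)) (𝒢.inclV _ (σ k))) q X -
      extD (formCoord e θ) (𝒢.u (τ q)) (tderiv EM EG 𝒢.u (τ q) (tderiv EQ EM τ q X))
        (𝒢.inclV _ (σ q)) := by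
  set t := trivializationAt (Fib EM EG) 𝒢.A (τ q) with ht
  set b := Module.finBasis ℝ (Fib EM EG) with hb
  have hqt : τ q ∈ 𝒢.trivSet (τ q) := 𝒢.mem_trivSet (τ q)
  let f := fun i (k : Q) => b.repr (t ⟨τ k, σ k⟩).2 i
  obtain ⟨hτ, hc⟩ := (t.contMDiffAt_iff (IB := 𝓘(ℝ, EM))
    (f := fun k => (⟨τ k, σ k⟩ : TotalSpace (Fib EM EG) 𝒢.A)) (x₀ := q)
    ((Trivialization.mem_source _).2 hqt)).1 hσ
  replace hτ : SmoothAt EQ EM τ q := hτ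
  have hf : ∀ i, SmoothAt EQ ℝ (f i) q := fun i =>
    ContMDiffAt.comp (x := q) (g := LinearMap.toContinuousLinearMap (b.coord i))
      (f := fun k => (t ⟨τ k, σ k⟩).2) (ContinuousLinearMap.contMDiff _).contMDiffAt hc
  have hfr : ∀ i, SmoothSectionAt 𝒢 (t.localFrame b i) (τ q) := fun i =>
    contMDiffAt_localFrame_of_mem (I := 𝓘(ℝ, EM)) (n := ∞) (e := t) b i hqt
  have hlam : ∀ i, SmoothAt EM F (formSection e θ (t.localFrame b i)) (τ q) := fun i =>
    smoothAt_formSection e hq (hfr i)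
  have hlamτ : ∀ i, SmoothAt EQ F (fun k => formSection e θ (t.localFrame b i) (τ k)) q := fun i =>
    ContMDiffAt.comp (x := q) (g := formSection e θ (t.localFrame b i)) (f := τ) (hlam i) hτ
  -- Write lσ = ∑ f_i (lα_i) ∘ τ. Its derivative supplies the terms (X f_i) lα_i together with the
  -- derivative part of f_i Dα_i, so the frame disappears from the result.
  have h1 : (fun k => formCoord e θ (𝒢.u (τ k)) (𝒢.inclV _ (σ k))) =ᶠ[𝓝 q]
      fun k => ∑ i, f i k • formSection e θ (t.localFrame b i) (τ k) := by
    filter_upwards [hτ.continuousAt.eventually ((𝒢.isOpen_trivSet _).mem_nhds hqt)] with k hk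
    have h2 := eq_sum_localFrame t b hk (σ k)
    conv_lhs => rw [h2]
    rw [map_sum, map_sum]
    simp only [map_smul]
    rfl
  have h3 : 𝒢.inclV _ (σ q) = ∑ i, f i q • 𝒢.inclV _ (t.localFrame b i (τ q)) := by
    have h2 := eq_sum_localFrame t b hqt (σ q)
    conv_lhs => rw [h2]
    rw [map_sum]
    simp only [map_smul]
    rfl
  rw [tderiv_congr h1, tderiv_sum_smul _ hf hlamτ, h3, extD_sum_right, ← Finset.sum_sub_distrib]
  refine (map_sum (e.continuousLinearMapAt ℝ (τ q)) _ _).trans (Finset.sum_congr rfl fun i _ => ?_)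
  refine (map_add (e.continuousLinearMapAt ℝ (τ q)) _ _).trans ?_
  rw [map_smul, map_smul]
  have h4 := hθ.continuousLinearMapAt_spencer e hs hq (hfr i) (tderiv EQ EM τ q X)
  have h5 : e.continuousLinearMapAt ℝ (τ q) (symbolMap θ (τ q) (t.localFrame b i (τ q))) =
      formSection e θ (t.localFrame b i) (τ q) := continuousLinearMapAt_fiberCast e (𝒢.t_u _) _
  rw [extD_smul_right, tderiv_comp (hlam i).diffAt hτ.diffAt, add_sub_right_comm, ← smul_sub]
  exact congrArg₂ (· + ·) (congrArg (f i q • ·) h4) (congrArg (tderiv EQ ℝ (f i) q X • ·) h5)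

section MaurerCartan

variable {EG' G' : Type*} [NormedAddCommGroup EG'] [NormedSpace ℝ EG'] [TopologicalSpace G']
  [ChartedSpace EG' G'] [IsManifold 𝓘(ℝ, EG') ∞ G'] [FiniteDimensional ℝ EG']
  {𝒢' : LieGroupoid EM M EG' G'} {θ' : OneForm 𝒢' (Fib EM EG) 𝒢.A}

/-- The form `l θ'`, in a trivialization. -/
noncomputable def symbolForm (θ : OneForm 𝒢 F E) (θ' : OneForm 𝒢' (Fib EM EG) 𝒢.A) (g : G') :
    EG' →L[ℝ] F :=
  (formCoord e θ (𝒢.u (𝒢'.t g))).comp ((𝒢.inclV (𝒢'.t g)).comp (θ' g))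

theorem contMDiffAt_oneForm_apply {V : G' → EG'} {g : G'} (hV : SmoothFieldAt V g) :
    ContMDiffAt 𝓘(ℝ, EG') (𝓘(ℝ, EM).prod 𝓘(ℝ, Fib EM EG)) ∞
      (fun k => (⟨𝒢'.t k, θ' k (V k)⟩ : TotalSpace (Fib EM EG) 𝒢.A)) g :=
  ContMDiffAt.comp (x := g) (g := fun z : TangentBundle 𝓘(ℝ, EG') G' =>
      (⟨𝒢'.t z.1, θ'.toFun z.1 z.2⟩ : TotalSpace (Fib EM EG) 𝒢.A))
    (f := fun k => (⟨k, V k⟩ : TangentBundle 𝓘(ℝ, EG') G')) (θ'.contMDiff_toFun _) hV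

theorem smoothFormAt_symbolForm {g : G'} (hg : 𝒢'.t g ∈ e.baseSet) :
    SmoothFormAt (symbolForm e θ θ') g := by
  intro v
  have h1 := ContMDiffAt.comp (x := (⟨g, v⟩ : TangentBundle 𝓘(ℝ, EG') G'))
    (g := fun z : TotalSpace (Fib EM EG) 𝒢.A =>
      (⟨𝒢.u z.1, 𝒢.inclV z.1 z.2⟩ : TangentBundle 𝓘(ℝ, EG) G))
    (f := fun z : TangentBundle 𝓘(ℝ, EG') G' =>
      (⟨𝒢'.t z.1, θ'.toFun z.1 z.2⟩ : TotalSpace (Fib EM EG) 𝒢.A))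
    (𝒢.contMDiff_inclV _) (θ'.contMDiff_toFun _)
  exact ContMDiffAt.comp (x := (⟨g, v⟩ : TangentBundle 𝓘(ℝ, EG') G'))
    (g := fun z : TangentBundle 𝓘(ℝ, EG) G => formCoord e θ z.1 z.2)
    (f := fun z : TangentBundle 𝓘(ℝ, EG') G' =>
      (⟨𝒢.u (𝒢'.t z.1), 𝒢.inclV _ (θ'.toFun z.1 z.2)⟩ : TangentBundle 𝓘(ℝ, EG) G))
    (smoothFormAt_formCoord e θ (by rwa [𝒢.t_u]) _) h1

/-- The Maurer-Cartan form in terms of exterior derivatives. -/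
theorem IsMultiplicative.continuousLinearMapAt_maurerCartan (hθ : IsMultiplicative R θ)
    {g : G'} (hs : Function.Surjective (θ (𝒢.u (𝒢'.t g)))) (hg : 𝒢'.t g ∈ e.baseSet)
    {X Y : G' → EG'} (hX : SmoothFieldAt X g) (hY : SmoothFieldAt Y g) :
    e.continuousLinearMapAt ℝ (𝒢'.t g) (maurerCartan θ θ' X Y g) =
      extD (symbolForm e θ θ') g (X g) (Y g) -
      extD (formCoord e θ) (𝒢.u (𝒢'.t g))
        (tderiv EM EG 𝒢.u (𝒢'.t g) (tderiv EG' EM 𝒢'.t g (X g) -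
          tderiv EG EM 𝒢.t (𝒢.u (𝒢'.t g)) (𝒢.inclV _ (θ' g (X g)))) + 𝒢.inclV _ (θ' g (X g)))
        (tderiv EM EG 𝒢.u (𝒢'.t g) (tderiv EG' EM 𝒢'.t g (Y g) -
          tderiv EG EM 𝒢.t (𝒢.u (𝒢'.t g)) (𝒢.inclV _ (θ' g (Y g)))) + 𝒢.inclV _ (θ' g (Y g))) := by
  have h1 := hθ.continuousLinearMapAt_pullbackSpencer e hs hg
    (contMDiffAt_oneForm_apply (θ' := θ') hY) (X g)
  have h2 := hθ.continuousLinearMapAt_pullbackSpencer e hs hg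
    (contMDiffAt_oneForm_apply (θ' := θ') hX) (Y g)
  have h3 := hθ.continuousLinearMapAt_halfBracket e hs hg (θ' g (X g)) (θ' g (Y g))
  have h4 := extD_apply_fields (smoothFormAt_symbolForm (θ := θ) (θ' := θ') e hg) hX hY
  have h5 : e.continuousLinearMapAt ℝ (𝒢'.t g)
      (symbolMap θ (𝒢'.t g) (θ' g (fieldBracket (EN := EG') X Y g))) =
      symbolForm e θ θ' g (fieldBracket X Y g) := continuousLinearMapAt_fiberCast e (𝒢.t_u _) _
  have h6 : e.continuousLinearMapAt ℝ (𝒢'.t g) (maurerCartan θ θ' X Y g) =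
      e.continuousLinearMapAt ℝ (𝒢'.t g)
        (pullbackSpencer θ 𝒢'.t (fun k => θ' k (Y k)) g (X g)) -
      e.continuousLinearMapAt ℝ (𝒢'.t g)
        (pullbackSpencer θ 𝒢'.t (fun k => θ' k (X k)) g (Y g)) -
      e.continuousLinearMapAt ℝ (𝒢'.t g)
        (symbolMap θ (𝒢'.t g) (θ' g (fieldBracket (EN := EG') X Y g))) -
      e.continuousLinearMapAt ℝ (𝒢'.t g) (halfBracket θ (𝒢'.t g) (θ' g (X g)) (θ' g (Y g))) := by
    rw [← map_sub, ← map_sub, ← map_sub]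
    rfl
  have h7 : tderiv EG' F (fun k => symbolForm e θ θ' k (Y k)) g (X g) =
    tderiv EG' F (fun k => formCoord e θ (𝒢.u (𝒢'.t k)) (𝒢.inclV _ (θ' k (Y k)))) g (X g) := rfl
  have h8 : tderiv EG' F (fun k => symbolForm e θ θ' k (X k)) g (Y g) =
    tderiv EG' F (fun k => formCoord e θ (𝒢.u (𝒢'.t k)) (𝒢.inclV _ (θ' k (X k)))) g (Y g) := rfl
  rw [h6, h1, h2, h3, h5, h4, h7, h8]
  simp only [map_sub]
  generalize 𝒢.inclV _ (θ' g (X g)) = a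
  generalize 𝒢.inclV _ (θ' g (Y g)) = b
  -- dθ vanishes on pairs of vectors tangent to the units; the Spencer and torsion terms therefore
  -- combine into one value of dθ at the unit.
  simp only [extD_add_left, extD_add_right, extD_sub_left, extD_sub_right,
    hθ.extD_tderiv_u e hg]
  rw [extD_swap _ _ a (tderiv EM EG 𝒢.u (𝒢'.t g) (tderiv EG' EM 𝒢'.t g (Y g))),
    extD_swap _ _ a (tderiv EM EG 𝒢.u (𝒢'.t g) (tderiv EG EM 𝒢.t (𝒢.u (𝒢'.t g)) b))]
  abel

end MaurerCartan

end LieGroupoid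

/-! ### Right translation over a base point known up to equality -/

namespace LieGroupoid

section Transport

variable {EM M EG G : Type*}
  [NormedAddCommGroup EM] [NormedSpace ℝ EM] [TopologicalSpace M] [ChartedSpace EM M]
  [NormedAddCommGroup EG] [NormedSpace ℝ EG] [TopologicalSpace G] [ChartedSpace EG G]
  {𝒢 : LieGroupoid EM M EG G}
  [IsManifold 𝓘(ℝ, EM) ∞ M] [IsManifold 𝓘(ℝ, EG) ∞ G]
  [FiniteDimensional ℝ EM] [FiniteDimensional ℝ EG]
  {F : Type*} [NormedAddCommGroup F] [NormedSpace ℝ F] [FiniteDimensional ℝ F]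
  {E : M → Type*} [∀ x, AddCommGroup (E x)] [∀ x, Module ℝ (E x)] [∀ x, TopologicalSpace (E x)]
  [TopologicalSpace (TotalSpace F E)] [FiberBundle F E] [VectorBundle ℝ F E]
  [ContMDiffVectorBundle ∞ F E 𝓘(ℝ, EM)]
  (e : Trivialization F (π F E)) [MemTrivializationAtlas e]
  {R : Representation 𝒢 F E} {θ : OneForm 𝒢 F E}

/-- The base point y is a variable because the lemma serves at p(g) with y = t(g), and t(p(g)) =
t(g) does not hold by definition. -/
theorem IsMultiplicative.apply_rTrans (hθ : IsMultiplicative R θ) {g : G} {y : M}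
    (hy : 𝒢.t g = y) (a : 𝒢.A y) :
    fiberCast E hy (θ g (𝒢.rTrans g (𝒢.inclV y a))) = symbolMap θ y a := by
  subst hy
  have hg : 𝒢.t g ∈ (trivializationAt F E (𝒢.t g)).baseSet := mem_baseSet_trivializationAt _ _ _
  refine continuousLinearMapAt_injective _ hg ?_
  exact (hθ.formCoord_rTrans _ hg a).trans (continuousLinearMapAt_fiberCast _ (𝒢.t_u _) _).symm

theorem IsMultiplicative.apply_tderiv_u (hθ : IsMultiplicative R θ) (x : M) (v : EM) :
    θ (𝒢.u x) (tderiv EM EG 𝒢.u x v) = 0 := by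
  have hx : x ∈ (trivializationAt F E x).baseSet := mem_baseSet_trivializationAt _ _ _
  exact (formCoord_eq_zero_iff _ θ (by rwa [𝒢.t_u]) _).1 (hθ.formCoord_tderiv_u _ hx v)

theorem continuousLinearMapAt_symbolMap (x : M) (a : 𝒢.A x) :
    e.continuousLinearMapAt ℝ x (symbolMap θ x a) = formCoord e θ (𝒢.u x) (𝒢.inclV x a) :=
  continuousLinearMapAt_fiberCast e (𝒢.t_u x) _

/-- This is `extD_add_rTrans` for the decomposition Xᵢ = (Xᵢ - R_g aᵢ) + R_g aᵢ, using dt(R_g a) =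
ρ(a). -/
theorem IsMultiplicative.extD_sub_rTrans (hθ : IsMultiplicative R θ) {g : G} {y : M}
    (hy : 𝒢.t g = y) (hye : y ∈ e.baseSet) (X₁ X₂ : EG) (a₁ a₂ : 𝒢.A y) :
    extD (formCoord e θ) g X₁ X₂ =
      extD (formCoord e θ) (𝒢.u y)
        (tderiv EM EG 𝒢.u y (tderiv EG EM 𝒢.t g X₁ -
          tderiv EG EM 𝒢.t (𝒢.u y) (𝒢.inclV y a₁)) + 𝒢.inclV y a₁)
        (tderiv EM EG 𝒢.u y (tderiv EG EM 𝒢.t g X₂ -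
          tderiv EG EM 𝒢.t (𝒢.u y) (𝒢.inclV y a₂)) + 𝒢.inclV y a₂) +
      extD (formCoord e θ) g (X₁ - 𝒢.rTrans g (𝒢.inclV y a₁)) (X₂ - 𝒢.rTrans g (𝒢.inclV y a₂)) +
      (repDeriv e R y a₁ (formCoord e θ g (X₂ - 𝒢.rTrans g (𝒢.inclV y a₂))) -
        repDeriv e R y a₂ (formCoord e θ g (X₁ - 𝒢.rTrans g (𝒢.inclV y a₁)))) := by
  subst hy
  have h := hθ.extD_add_rTrans e hye (X₁ - 𝒢.rTrans g (𝒢.inclV _ a₁))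
    (X₂ - 𝒢.rTrans g (𝒢.inclV _ a₂)) a₁ a₂
  rwa [sub_add_cancel, sub_add_cancel, map_sub (tderiv EG EM 𝒢.t g), map_sub (tderiv EG EM 𝒢.t g),
    𝒢.tderiv_t_rTrans, 𝒢.tderiv_t_rTrans] at h

end Transport

/-! ### The differential of p on source fibres; the Pfaffian conditions -/

section Morphism

variable {EM M EG G EG' G' : Type*}
  [NormedAddCommGroup EM] [NormedSpace ℝ EM] [TopologicalSpace M] [ChartedSpace EM M]
  [NormedAddCommGroup EG] [NormedSpace ℝ EG] [TopologicalSpace G] [ChartedSpace EG G]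
  [NormedAddCommGroup EG'] [NormedSpace ℝ EG'] [TopologicalSpace G'] [ChartedSpace EG' G']
  {𝒢' : LieGroupoid EM M EG' G'} {𝒢 : LieGroupoid EM M EG G} {p : G' → G}

theorem IsHom.smoothAt (hp : IsHom 𝒢' 𝒢 p) (g : G') : SmoothAt EG' EG p g := hp.contMDiff g

theorem IsHom.tderiv_s (hp : IsHom 𝒢' 𝒢 p) (g : G') (X : EG') :
    tderiv EG EM 𝒢.s (p g) (tderiv EG' EG p g X) = tderiv EG' EM 𝒢'.s g X := by
  rw [← tderiv_comp (𝒢.smoothAt_s _).diffAt (hp.smoothAt g).diffAt,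
    show (fun k => 𝒢.s (p k)) = 𝒢'.s from funext hp.s_map]

theorem IsHom.tderiv_t (hp : IsHom 𝒢' 𝒢 p) (g : G') (X : EG') :
    tderiv EG EM 𝒢.t (p g) (tderiv EG' EG p g X) = tderiv EG' EM 𝒢'.t g X := by
  rw [← tderiv_comp (𝒢.smoothAt_t _).diffAt (hp.smoothAt g).diffAt,
    show (fun k => 𝒢.t (p k)) = 𝒢'.t from funext hp.t_map]

theorem IsHom.tderiv_u (hp : IsHom 𝒢' 𝒢 p) (x : M) (v : EM) :
    tderiv EG' EG p (𝒢'.u x) (tderiv EM EG' 𝒢'.u x v) = tderiv EM EG 𝒢.u x v := by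
  rw [← tderiv_comp (hp.smoothAt _).diffAt (𝒢'.smoothAt_u x).diffAt,
    show (fun k => p (𝒢'.u k)) = 𝒢.u from funext hp.map_u]

theorem IsHom.inclV_lieMap (hp : IsHom 𝒢' 𝒢 p) (x : M) (a : 𝒢'.A x) :
    𝒢.inclV x (lieMap hp x a) = tderiv EG' EG p (𝒢'.u x) (𝒢'.inclV x a) :=
  fiberCast_tangent (EG := EG) (hp.map_u x) _

variable
  [IsManifold 𝓘(ℝ, EM) ∞ M] [IsManifold 𝓘(ℝ, EG) ∞ G] [IsManifold 𝓘(ℝ, EG') ∞ G']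
  [FiniteDimensional ℝ EM] [FiniteDimensional ℝ EG] [FiniteDimensional ℝ EG']

/-- Differentiate p(c(r)g) = p(c(r))p(g) along a curve c in the source fibre of the unit. -/
theorem IsHom.tderiv_rTrans (hp : IsHom 𝒢' 𝒢 p) (g : G') (a : 𝒢'.A (𝒢'.t g)) :
    tderiv EG' EG p g (𝒢'.rTrans g (𝒢'.inclV _ a)) =
      𝒢.rTrans (p g) (𝒢.inclV _ (lieMap hp _ a)) := by
  obtain ⟨c, h0, h1, h2, h3⟩ := 𝒢'.exists_curve_inclV a
  have h4 := 𝒢'.tderiv_mul_right (g := g) h1 h3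
  rw [h0, h2] at h4
  change _ = 𝒢'.rTrans g (𝒢'.inclV _ a) at h4
  have hm0 : 𝒢'.mul (c 0) g = g := by rw [h0, 𝒢'.u_mul]
  have h5 := tderiv_comp (g := p) (f := fun r => 𝒢'.mul (c r) g) (x := (0 : ℝ))
    (hp.smoothAt _).diffAt (𝒢'.smoothAt_mul h1 contMDiffAt_const h3).diffAt 1
  rw [hm0, h4] at h5
  have hpc : SmoothAt ℝ EG (fun r => p (c r)) 0 :=
    ContMDiffAt.comp (x := (0 : ℝ)) (g := p) (f := c) (hp.smoothAt _) h1
  have h6 := 𝒢.tderiv_mul_right (c := fun r => p (c r)) (g := p g) hpc (by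
    filter_upwards [h3] with r hr
    rw [hp.s_map, hr, hp.t_map])
  rw [tderiv_comp (g := p) (f := c) (hp.smoothAt _).diffAt h1.diffAt, h0, h2, hp.map_u,
    ← hp.inclV_lieMap] at h6
  rw [← h5, tderiv_congr (g := fun r => 𝒢.mul (p (c r)) (p g)), h6, rTrans, hp.t_map]
  filter_upwards [h3] with r hr using hp.map_mul hr

variable {R' : Representation 𝒢' (Fib EM EG) 𝒢.A} {θ' : OneForm 𝒢' (Fib EM EG) 𝒢.A}
  {hp : IsHom 𝒢' 𝒢 p}

/-- On the fibres of the source map, `d p` is determined by `θ'`. -/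
theorem IsMultiplicative.tderiv_vertical (hθ' : IsMultiplicative R' θ')
    (hLie : ∀ x (a : 𝒢'.A x), lieMap hp x a = symbolMap θ' x a) {g : G'} {X : EG'}
    (hX : tderiv EG' EM 𝒢'.s g X = 0) :
    tderiv EG' EG p g X = 𝒢.rTrans (p g) (𝒢.inclV _ (θ' g X)) := by
  -- With X = R_g a, dp sends it to the right translate of Lie(p)a = θ'(a), and θ'(R_g a) = θ'(a).
  obtain ⟨-, a, -, -, -, -, -, rfl⟩ := 𝒢'.exists_eq_rTrans hX
  rw [hp.tderiv_rTrans, hLie, ← hθ'.apply_rTrans (rfl : 𝒢'.t g = 𝒢'.t g)]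
  rfl

/-- At the unit, lift b through the surjective dp. The lift is automatically tangent to the source
fibre because p preserves sources, and its right translate to g keeps the value of θ'. -/
theorem IsMultiplicative.exists_vertical (hθ' : IsMultiplicative R' θ')
    (hLie : ∀ x (a : 𝒢'.A x), lieMap hp x a = symbolMap θ' x a)
    (hsub : IsSubmersion 𝓘(ℝ, EG') 𝓘(ℝ, EG) ∞ p) (g : G') (b : 𝒢.A (𝒢'.t g)) :
    ∃ X : EG', tderiv EG' EM 𝒢'.s g X = 0 ∧ θ' g X = b := by
  have hsurj : ∀ v : EG, ∃ X : EG', tderiv EG' EG p (𝒢'.u (𝒢'.t g)) X = v :=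
    surjective_mfderiv_of_isSubmersion hsub (𝒢'.u (𝒢'.t g))
  obtain ⟨X, hX⟩ := hsurj (𝒢.inclV _ b)
  have hXs : tderiv EG' EM 𝒢'.s (𝒢'.u (𝒢'.t g)) X = 0 := by
    rw [← hp.tderiv_s, hX, hp.map_u, 𝒢.tderiv_s_inclV]
  obtain ⟨a, rfl⟩ := 𝒢'.exists_inclV_eq hXs
  refine ⟨𝒢'.rTrans g (𝒢'.inclV _ a), 𝒢'.tderiv_s_rTrans g a, ?_⟩
  have h1 := hθ'.apply_rTrans (rfl : 𝒢'.t g = 𝒢'.t g) a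
  rw [← hLie] at h1
  refine Eq.trans h1 (𝒢.inclV_injective _ ?_)
  rw [hp.inclV_lieMap, hX]

/-- On vertical vectors dp is θ' followed by right translation, which is injective on A. This
identifies ker θ' ∩ ker ds with the tangent spaces of the fibres of p, giving both involutivity and
condition (iii). -/
theorem IsMultiplicative.tderiv_eq_zero_iff (hθ' : IsMultiplicative R' θ')
    (hLie : ∀ x (a : 𝒢'.A x), lieMap hp x a = symbolMap θ' x a) {g : G'} {X : EG'} :
    tderiv EG' EG p g X = 0 ↔ θ' g X = 0 ∧ tderiv EG' EM 𝒢'.s g X = 0 := by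
  constructor
  · intro h
    have hs : tderiv EG' EM 𝒢'.s g X = 0 := by rw [← hp.tderiv_s, h, map_zero]
    refine ⟨?_, hs⟩
    rw [hθ'.tderiv_vertical hLie hs] at h
    have gen : ∀ (y : M) (hy : 𝒢.t (p g) = y) (a : 𝒢.A y),
        𝒢.rTrans (p g) (𝒢.inclV y a) = 0 → a = 0 := by
      rintro _ rfl a ha
      exact 𝒢.eq_zero_of_rTrans_eq_zero _ a ha
    exact gen _ (hp.t_map g) _ h
  · rintro ⟨h, hs⟩
    rw [hθ'.tderiv_vertical hLie hs]
    refine Eq.trans (congrArg (fun a => 𝒢.rTrans (p g) (𝒢.inclV _ a)) h) ?_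
    show 𝒢.rTrans (p g) (𝒢.inclV _ 0) = 0
    rw [map_zero, 𝒢.rTrans_zero]

/-- The fibres of a map have involutive tangent spaces. -/
theorem tderiv_fieldBracket_eq_zero {f : G' → G} {g : G'} (hf : SmoothAt EG' EG f g)
    {V W : G' → EG'} (hV : SmoothFieldAt V g) (hW : SmoothFieldAt W g)
    (hfV : ∀ᶠ k in 𝓝 g, tderiv EG' EG f k (V k) = 0)
    (hfW : ∀ᶠ k in 𝓝 g, tderiv EG' EG f k (W k) = 0) :
    tderiv EG' EG f g (fieldBracket V W g) = 0 := by
  have hφ := chartAt_mem_maximalAtlas' (EN := EG) (f g)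
  set φ := chartAt EG (f g)
  have hg : f g ∈ φ.source := mem_chart_source EG (f g)
  have hφf : SmoothAt EG' EG (fun k => φ (f k)) g :=
    ContMDiffAt.comp (x := g) (g := φ) (f := f) (smoothAt_of_mem_maximalAtlas hφ hg) hf
  -- η = d(φ ∘ f) is closed and kills V and W, so Cartan's formula leaves η([V, W]) = 0.
  let η : G' → EG' →L[ℝ] EG := fun k => tderiv EG' EG (fun k => φ (f k)) k
  have hη : SmoothFormAt η g :=
    SmoothFormAt.pullbackForm (η := fun _ => ContinuousLinearMap.id ℝ EG) hφf fun v =>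
      (contMDiff_snd_tangentBundle_modelSpace EG 𝓘(ℝ, EG)).contMDiffAt
  have hη0 : ∀ Z : G' → EG', (∀ᶠ k in 𝓝 g, tderiv EG' EG f k (Z k) = 0) → ∀ v,
      tderiv EG' EG (fun k => η k (Z k)) g v = 0 := by
    intro Z hZ v
    rw [tderiv_congr (g := fun _ => 0), tderiv_const]
    filter_upwards [hZ, hf.eventually_diffAt,
      hf.continuousAt.eventually (φ.open_source.mem_nhds hg)] with k hk hk1 hk2
    show tderiv EG' EG (fun k => φ (f k)) k (Z k) = 0
    rw [tderiv_comp (g := φ) (f := f) (smoothAt_of_mem_maximalAtlas hφ hk2).diffAt hk1, hk,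
      map_zero]
  have h1 := extD_apply_fields hη hV hW
  rw [hη0 V hfV, hη0 W hfW, extD_tderiv_self hφf, sub_self, zero_sub, eq_comm, neg_eq_zero] at h1
  have h2 : tderiv EG' EG (fun k => φ (f k)) g (fieldBracket V W g) = 0 := h1
  rw [tderiv_comp (g := φ) (f := f) (smoothAt_of_mem_maximalAtlas hφ hg).diffAt hf.diffAt] at h2
  rw [← tderiv_symm_tderiv hφ hg (tderiv EG' EG f g (fieldBracket V W g)), h2, map_zero]

/-- A multiplicative form that restricts to `Lie (p)` for a submersion `p` makes a Pfaffian
groupoid. -/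
theorem IsMultiplicative.isPfaffian (hθ' : IsMultiplicative R' θ')
    (hLie : ∀ x (a : 𝒢'.A x), lieMap hp x a = symbolMap θ' x a)
    (hsub : IsSubmersion 𝓘(ℝ, EG') 𝓘(ℝ, EG) ∞ p) : IsPfaffian R' θ' where
  isMultiplicative := hθ'
  surjective g b := by
    obtain ⟨X, -, hX⟩ := hθ'.exists_vertical hLie hsub g b
    exact ⟨X, hX⟩
  transversal g X := by
    -- Subtracting a vertical vector with the same value of θ' leaves a vector in ker θ'.
    obtain ⟨Z, hZs, hZ⟩ := hθ'.exists_vertical hLie hsub g (θ' g X)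
    let Z' : TangentSpace 𝓘(ℝ, EG') g := Z
    refine ⟨X - Z', Z', (sub_add_cancel X Z').symm, ?_, hZs⟩
    exact (map_sub (θ' g) X Z').trans (sub_eq_zero.2 hZ.symm)
  involutive g V W hV hW h := by
    have h1 := tderiv_fieldBracket_eq_zero (hp.smoothAt g) (V := V) (W := W) hV.self_of_nhds
      hW.self_of_nhds (h.mono fun k hk => (hθ'.tderiv_eq_zero_iff hLie).2 hk.1)
      (h.mono fun k hk => (hθ'.tderiv_eq_zero_iff hLie).2 hk.2)
    exact ((hθ'.tderiv_eq_zero_iff hLie).1 h1).1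

end Morphism

end LieGroupoid

/-! ### The defect p^*θ - lθ'; a prolongation solves the Maurer–Cartan equation -/

namespace LieGroupoid

variable {EM M EG G EG' G' : Type*}
  [NormedAddCommGroup EM] [NormedSpace ℝ EM] [TopologicalSpace M] [ChartedSpace EM M]
  [NormedAddCommGroup EG] [NormedSpace ℝ EG] [TopologicalSpace G] [ChartedSpace EG G]
  [NormedAddCommGroup EG'] [NormedSpace ℝ EG'] [TopologicalSpace G'] [ChartedSpace EG' G']
  {𝒢' : LieGroupoid EM M EG' G'} {𝒢 : LieGroupoid EM M EG G} {p : G' → G}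
  [IsManifold 𝓘(ℝ, EM) ∞ M] [IsManifold 𝓘(ℝ, EG) ∞ G] [IsManifold 𝓘(ℝ, EG') ∞ G']
  [FiniteDimensional ℝ EM] [FiniteDimensional ℝ EG] [FiniteDimensional ℝ EG']
  {F : Type*} [NormedAddCommGroup F] [NormedSpace ℝ F] [FiniteDimensional ℝ F]
  {E : M → Type*} [∀ x, AddCommGroup (E x)] [∀ x, Module ℝ (E x)] [∀ x, TopologicalSpace (E x)]
  [TopologicalSpace (TotalSpace F E)] [FiberBundle F E] [VectorBundle ℝ F E]
  [ContMDiffVectorBundle ∞ F E 𝓘(ℝ, EM)]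
  (e : Trivialization F (π F E)) [MemTrivializationAtlas e]
  {R : Representation 𝒢 F E} {θ : OneForm 𝒢 F E}
  {R' : Representation 𝒢' (Fib EM EG) 𝒢.A} {θ' : OneForm 𝒢' (Fib EM EG) 𝒢.A}
  {hp : IsHom 𝒢' 𝒢 p}

/-- The form `p^* θ - l θ'`, in a trivialization. -/
noncomputable def defectForm (θ : OneForm 𝒢 F E) (θ' : OneForm 𝒢' (Fib EM EG) 𝒢.A) (p : G' → G)
    (g : G') : EG' →L[ℝ] F :=
  pullbackForm p (formCoord e θ) g - symbolForm e θ θ' g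

/-- The difference of `d p (X)` and of the right translate of `θ' (X)`. -/
noncomputable def horPart (θ' : OneForm 𝒢' (Fib EM EG) 𝒢.A) (p : G' → G) (g : G') (X : EG') :
    EG :=
  tderiv EG' EG p g X - 𝒢.rTrans (p g) (𝒢.inclV _ (θ' g X))

theorem smoothFormAt_pullbackForm_formCoord (hp : IsHom 𝒢' 𝒢 p) {g : G'}
    (hg : 𝒢'.t g ∈ e.baseSet) :
    SmoothFormAt (pullbackForm p (formCoord e θ) : G' → EG' →L[ℝ] F) g :=
  SmoothFormAt.pullbackForm (hp.smoothAt g) (smoothFormAt_formCoord e θ (by rwa [hp.t_map]))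

theorem smoothFormAt_defectForm (hp : IsHom 𝒢' 𝒢 p) {g : G'} (hg : 𝒢'.t g ∈ e.baseSet) :
    SmoothFormAt (defectForm e θ θ' p) g := fun v =>
  (smoothFormAt_pullbackForm_formCoord e hp hg v).sub (smoothFormAt_symbolForm e hg v)

theorem extD_defectForm (hp : IsHom 𝒢' 𝒢 p) {g : G'} (hg : 𝒢'.t g ∈ e.baseSet) (X Y : EG') :
    extD (defectForm e θ θ' p) g X Y =
      extD (formCoord e θ) (p g) (tderiv EG' EG p g X) (tderiv EG' EG p g Y) -
        extD (symbolForm e θ θ') g X Y := by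
  rw [← extD_pullbackForm (hp.smoothAt g) (smoothFormAt_formCoord e θ (by rwa [hp.t_map]))]
  exact extD_sub (smoothFormAt_pullbackForm_formCoord e hp hg) (smoothFormAt_symbolForm e hg) X Y

/-- Right invariance of θ gives lθ'(X) = θ(R_{p(g)} θ'X), so the defect is θ on what remains of
dp(X). -/
theorem IsMultiplicative.defectForm_apply (hθ : IsMultiplicative R θ) (hp : IsHom 𝒢' 𝒢 p)
    (g : G') (X : EG') : defectForm e θ θ' p g X = formCoord e θ (p g) (horPart θ' p g X) := by
  have h1 := congrArg (e.continuousLinearMapAt ℝ (𝒢'.t g))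
    (hθ.apply_rTrans (hp.t_map g) (θ' g X))
  rw [continuousLinearMapAt_fiberCast, continuousLinearMapAt_symbolMap] at h1
  rw [horPart, map_sub]
  exact congrArg (formCoord e θ (p g) (tderiv EG' EG p g X) - ·) h1.symm

/-- The Maurer-Cartan form in terms of the exterior derivative of `p^* θ - l θ'`. -/
theorem IsMultiplicative.continuousLinearMapAt_maurerCartan_eq_defect
    (hθ : IsMultiplicative R θ) (hp : IsHom 𝒢' 𝒢 p) {g : G'}
    (hs : Function.Surjective (θ (𝒢.u (𝒢'.t g)))) (hg : 𝒢'.t g ∈ e.baseSet)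
    {X Y : G' → EG'} (hX : SmoothFieldAt X g) (hY : SmoothFieldAt Y g) :
    e.continuousLinearMapAt ℝ (𝒢'.t g) (maurerCartan θ θ' X Y g) =
      extD (formCoord e θ) (p g) (horPart θ' p g (X g)) (horPart θ' p g (Y g)) +
      (repDeriv e R (𝒢'.t g) (θ' g (X g)) (defectForm e θ θ' p g (Y g)) -
        repDeriv e R (𝒢'.t g) (θ' g (Y g)) (defectForm e θ θ' p g (X g))) -
      extD (defectForm e θ θ' p) g (X g) (Y g) := by
  have h1 := hθ.continuousLinearMapAt_maurerCartan (θ' := θ') e hs hg hX hY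
  -- Since dt(dp X) = dt X, the term at the unit is the one occurring in `h1`, and eliminating it
  -- gives the formula.
  have h2 := hθ.extD_sub_rTrans e (hp.t_map g) hg (tderiv EG' EG p g (X g))
    (tderiv EG' EG p g (Y g)) (θ' g (X g)) (θ' g (Y g))
  rw [hp.tderiv_t, hp.tderiv_t] at h2
  rw [extD_defectForm e hp hg, h2, h1, hθ.defectForm_apply e hp, hθ.defectForm_apply e hp,
    horPart, horPart]
  abel

theorem IsMultiplicative.horPart_vertical (hθ' : IsMultiplicative R' θ')
    (hLie : ∀ x (a : 𝒢'.A x), lieMap hp x a = symbolMap θ' x a) {g : G'} {X : EG'}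
    (hX : tderiv EG' EM 𝒢'.s g X = 0) : horPart θ' p g X = 0 :=
  sub_eq_zero.2 (hθ'.tderiv_vertical hLie hX)

theorem horPart_of_ker {g : G'} {X : EG'} (hX : θ' g X = 0) :
    horPart θ' p g X = tderiv EG' EG p g X := by
  have h1 : 𝒢.rTrans (p g) (𝒢.inclV _ (θ' g X)) = 0 := by
    refine Eq.trans (congrArg (fun a => 𝒢.rTrans (p g) (𝒢.inclV _ a)) hX) ?_
    show 𝒢.rTrans (p g) (𝒢.inclV _ 0) = 0
    rw [map_zero, 𝒢.rTrans_zero]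
  rw [horPart, h1, sub_zero]

/-- A Lie prolongation satisfies the Maurer-Cartan equation. -/
theorem IsLieProlongation.satisfiesMaurerCartan
    (hLie : ∀ x (a : 𝒢'.A x), lieMap hp x a = symbolMap θ' x a)
    (h : IsLieProlongation R' θ' R θ hp) : SatisfiesMaurerCartan θ θ' := by
  intro g X Y hX hY
  have hθ' := h.isPfaffian'.isMultiplicative
  have hθ := h.isPfaffian.isMultiplicative
  set e := trivializationAt F E (𝒢'.t g)
  have hg : 𝒢'.t g ∈ e.baseSet := mem_baseSet_trivializationAt _ _ _
  have hdec : ∀ (k : G') (X : EG'), ∃ Z Z' : EG', X = Z + Z' ∧ θ' k Z = 0 ∧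
      tderiv EG' EM 𝒢'.s k Z' = 0 := fun k X => h.isPfaffian'.transversal k X
  -- In a decomposition X = Z + Z' with Z in ker θ' and Z' vertical, Z' contributes nothing to the
  -- horizontal part.
  have hhor : ∀ (k : G') (X : EG'), ∃ Z : EG', θ' k Z = 0 ∧
      horPart θ' p k X = tderiv EG' EG p k Z := by
    intro k X
    obtain ⟨Z, Z', rfl, hZ, hZ'⟩ := hdec k X
    refine ⟨Z, hZ, ?_⟩
    have h2 : θ' k (Z + Z') = θ' k Z' :=
      (map_add (θ' k) _ _).trans ((congrArg (· + _) hZ).trans (zero_add _))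
    have h3 : 𝒢.rTrans (p k) (𝒢.inclV _ (θ' k (Z + Z'))) =
        𝒢.rTrans (p k) (𝒢.inclV _ (θ' k Z')) :=
      congrArg (fun a => 𝒢.rTrans (p k) (𝒢.inclV _ a)) h2
    rw [horPart, h3, map_add, hθ'.tderiv_vertical hLie hZ', add_sub_cancel_right]
  have hζ : ∀ k, 𝒢'.t k ∈ e.baseSet → defectForm e θ θ' p k = 0 := by
    intro k hk
    ext X
    obtain ⟨Z, hZ, hZX⟩ := hhor k X
    rw [hθ.defectForm_apply e hp, hZX]
    exact (formCoord_eq_zero_iff e θ (by rwa [hp.t_map]) _).2 (h.isPfaffianMorphism.map_ker k Z hZ)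
  -- Horizontal parts are images under dp of vectors in ker θ', where dθ = -δθ vanishes by condition
  -- (iv).
  have hext : ∀ X Y, extD (formCoord e θ) (p g) (horPart θ' p g X) (horPart θ' p g Y) = 0 := by
    intro X Y
    obtain ⟨Z, hZ, hZX⟩ := hhor g X
    obtain ⟨W, hW, hWY⟩ := hhor g Y
    have h1 := continuousLinearMapAt_partialDiff (θ := θ) (g := p g) e (by rwa [hp.t_map])
      (h.isPfaffian.surjective _) (h.isPfaffianMorphism.map_ker g Z hZ)
      (h.isPfaffianMorphism.map_ker g W hW)
    have h2 : e.continuousLinearMapAt ℝ (𝒢.t (p g)) (partialDiff θ (p g)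
        (mfderiv 𝓘(ℝ, EG') 𝓘(ℝ, EG) p g Z) (mfderiv 𝓘(ℝ, EG') 𝓘(ℝ, EG) p g W)) = 0 := by
      rw [h.partialDiff_map g Z W hZ hW, map_zero]
    rw [hZX, hWY, ← neg_eq_zero]
    exact h1.symm.trans h2
  have hζd : ∀ X Y, extD (defectForm e θ θ' p) g X Y = 0 := by
    intro X Y
    rw [extD_congr (η' := fun _ => (0 : EG' →L[ℝ] F))
      ((eventually_t_mem e hg).mono fun k hk => hζ k hk)]
    exact extD_zero g X Y
  have h3 : ∀ X Y : G' → EG', SmoothFieldAt X g → SmoothFieldAt Y g →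
      maurerCartan θ θ' X Y g = 0 := by
    intro X Y hX hY
    have h4 := hθ.continuousLinearMapAt_maurerCartan_eq_defect (θ' := θ') e hp
      (h.isPfaffian.surjective _) hg hX hY
    rw [hext, hζd, hζ g hg] at h4
    refine continuousLinearMapAt_injective e hg (h4.trans ?_)
    simp
  exact h3 X Y hX.self_of_nhds hY.self_of_nhds

end LieGroupoid

/-! ### Propagation of p^*θ = lθ' along source fibres -/

namespace LieGroupoid

variable {EM M EG G EG' G' : Type*}
  [NormedAddCommGroup EM] [NormedSpace ℝ EM] [TopologicalSpace M] [ChartedSpace EM M]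
  [NormedAddCommGroup EG] [NormedSpace ℝ EG] [TopologicalSpace G] [ChartedSpace EG G]
  [NormedAddCommGroup EG'] [NormedSpace ℝ EG'] [TopologicalSpace G'] [ChartedSpace EG' G']
  {𝒢' : LieGroupoid EM M EG' G'} {𝒢 : LieGroupoid EM M EG G} {p : G' → G}
  [IsManifold 𝓘(ℝ, EM) ∞ M] [IsManifold 𝓘(ℝ, EG) ∞ G] [IsManifold 𝓘(ℝ, EG') ∞ G']
  [FiniteDimensional ℝ EM] [FiniteDimensional ℝ EG] [FiniteDimensional ℝ EG']
  {F : Type*} [NormedAddCommGroup F] [NormedSpace ℝ F] [FiniteDimensional ℝ F]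
  {E : M → Type*} [∀ x, AddCommGroup (E x)] [∀ x, Module ℝ (E x)] [∀ x, TopologicalSpace (E x)]
  [TopologicalSpace (TotalSpace F E)] [FiberBundle F E] [VectorBundle ℝ F E]
  [ContMDiffVectorBundle ∞ F E 𝓘(ℝ, EM)]
  (e : Trivialization F (π F E)) [MemTrivializationAtlas e]
  {R : Representation 𝒢 F E} {θ : OneForm 𝒢 F E}
  {R' : Representation 𝒢' (Fib EM EG) 𝒢.A} {θ' : OneForm 𝒢' (Fib EM EG) 𝒢.A}
  {hp : IsHom 𝒢' 𝒢 p}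

/-- The equality `p^* θ = l θ'` at `g`. -/
def IsCompatibleAt (hp : IsHom 𝒢' 𝒢 p) (θ : OneForm 𝒢 F E) (θ' : OneForm 𝒢' (Fib EM EG) 𝒢.A)
    (g : G') : Prop :=
  ∀ X : EG', fiberCast E (hp.t_map g) (θ (p g) (tderiv EG' EG p g X)) =
    symbolMap θ (𝒢'.t g) (θ' g X)

theorem defectForm_eq_zero_iff (hp : IsHom 𝒢' 𝒢 p) {g : G'} (hg : 𝒢'.t g ∈ e.baseSet) :
    defectForm e θ θ' p g = 0 ↔ IsCompatibleAt hp θ θ' g := by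
  have h1 : ∀ X : EG', defectForm e θ θ' p g X =
      e.continuousLinearMapAt ℝ (𝒢'.t g)
        (fiberCast E (hp.t_map g) (θ (p g) (tderiv EG' EG p g X))) -
      e.continuousLinearMapAt ℝ (𝒢'.t g) (symbolMap θ (𝒢'.t g) (θ' g X)) := by
    intro X
    rw [continuousLinearMapAt_fiberCast, continuousLinearMapAt_symbolMap]
    rfl
  constructor
  · intro h X
    have h2 := h1 X
    rw [h] at h2
    exact continuousLinearMapAt_injective e hg (sub_eq_zero.1 h2.symm)
  · intro h
    ext X
    rw [h1, h X, sub_self]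
    rfl

/-- A tangent vector at a unit is du(v) plus a vertical vector. The defect kills vertical vectors
because their horizontal part is zero, and kills du(v) because θ and θ' vanish along units and p
preserves units. -/
theorem IsMultiplicative.isCompatibleAt_u (hθ : IsMultiplicative R θ)
    (hθ' : IsMultiplicative R' θ') (hLie : ∀ x (a : 𝒢'.A x), lieMap hp x a = symbolMap θ' x a)
    (x : M) : IsCompatibleAt hp θ θ' (𝒢'.u x) := by
  set e := trivializationAt F E x
  have hx : x ∈ e.baseSet := mem_baseSet_trivializationAt _ _ _
  have hux : 𝒢'.t (𝒢'.u x) ∈ e.baseSet := by rwa [𝒢'.t_u]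
  rw [← defectForm_eq_zero_iff e hp hux]
  ext X
  have hX : tderiv EG' EM 𝒢'.s (𝒢'.u x)
      (X - tderiv EM EG' 𝒢'.u x (tderiv EG' EM 𝒢'.s (𝒢'.u x) X)) = 0 := by
    rw [map_sub, 𝒢'.tderiv_s_tderiv_u, sub_self]
  have h1 := hθ.defectForm_apply (θ' := θ') e hp (𝒢'.u x)
    (X - tderiv EM EG' 𝒢'.u x (tderiv EG' EM 𝒢'.s (𝒢'.u x) X))
  rw [hθ'.horPart_vertical hLie hX, map_zero, map_sub, sub_eq_zero] at h1
  have h2 := hθ.defectForm_apply (θ' := θ') e hp (𝒢'.u x)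
    (tderiv EM EG' 𝒢'.u x (tderiv EG' EM 𝒢'.s (𝒢'.u x) X))
  rw [horPart_of_ker (hθ'.apply_tderiv_u _ _), hp.tderiv_u, hp.map_u,
    hθ.formCoord_tderiv_u e hx] at h2
  rw [h1, h2]
  rfl

/-- The main identity with MC = 0, solved for dζ; it is pointwise in X and Y, so any extension to
fields serves. -/
theorem IsMultiplicative.extD_defectForm_of_maurerCartan (hθ : IsMultiplicative R θ)
    (hs : ∀ g, Function.Surjective (θ g)) (hp : IsHom 𝒢' 𝒢 p)
    (hMC : SatisfiesMaurerCartan θ θ') {g : G'} (hg : 𝒢'.t g ∈ e.baseSet) (X Y : EG') :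
    extD (defectForm e θ θ' p) g X Y =
      extD (formCoord e θ) (p g) (horPart θ' p g X) (horPart θ' p g Y) +
      (repDeriv e R (𝒢'.t g) (θ' g X) (defectForm e θ θ' p g Y) -
        repDeriv e R (𝒢'.t g) (θ' g Y) (defectForm e θ θ' p g X)) := by
  obtain ⟨V, rfl, hV⟩ := exists_smoothField g X
  obtain ⟨W, rfl, hW⟩ := exists_smoothField g Y
  have h1 := hθ.continuousLinearMapAt_maurerCartan_eq_defect (θ' := θ') e hp (hs _) hg
    hV.self_of_nhds hW.self_of_nhds
  have h2 : maurerCartan θ θ' V W g = 0 := hMC g V W hV hW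
  rw [h2, map_zero] at h1
  exact (sub_eq_zero.1 h1.symm).symm

/-- The coefficient of the linear equation satisfied by `p^* θ - l θ'` along the fibres of the
source map is smooth. -/
theorem smoothAt_repDeriv {φ : OpenPartialHomeomorph G' EG'}
    (hφ : φ ∈ IsManifold.maximalAtlas 𝓘(ℝ, EG') ∞ G') {y : EG'} (hy : y ∈ φ.target)
    (hye : 𝒢'.t (φ.symm y) ∈ e.baseSet) (Δ : EG') :
    SmoothAt EG' (F →L[ℝ] F) (fun z => repDeriv e R (𝒢'.t (φ.symm z))
      (θ' (φ.symm z) (tderiv EG' EG' φ.symm z Δ))) y := by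
  have h1 := (smoothAt_symm_of_mem_maximalAtlas hφ hy).tderiv_const Δ
  have h2 : ContMDiffAt 𝓘(ℝ, EG') (𝓘(ℝ, EM).prod 𝓘(ℝ, Fib EM EG)) ∞
      (fun z => (⟨𝒢'.t (φ.symm z), θ' (φ.symm z) (tderiv EG' EG' φ.symm z Δ)⟩ :
        TotalSpace (Fib EM EG) 𝒢.A)) y :=
    ContMDiffAt.comp (x := y) (g := fun z : TangentBundle 𝓘(ℝ, EG') G' =>
      (⟨𝒢'.t z.1, θ'.toFun z.1 z.2⟩ : TotalSpace (Fib EM EG) 𝒢.A))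
    (f := fun z => (⟨φ.symm z, tderiv EG' EG' φ.symm z Δ⟩ : TangentBundle 𝓘(ℝ, EG') G'))
    (θ'.contMDiff_toFun _) h1
  -- The coefficient is the tangent map of `repCoord` applied to the smooth family θ'(Δ) of vectors
  -- at units.
  exact contMDiffAt_tangent_vectorSpace (ContMDiffAt.tderiv_apply (f := repCoord e R)
    (smoothAt_repCoord e R (by rwa [𝒢.s_u]) (by rwa [𝒢.t_u])) (contMDiffAt_inclV_family h2))

/-- Compatibility propagates along segments in the fibres of the source map. -/
theorem IsMultiplicative.exists_nhds_isCompatibleAt (hθ : IsMultiplicative R θ)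
    (hs : ∀ g, Function.Surjective (θ g)) (hθ' : IsMultiplicative R' θ')
    (hLie : ∀ x (a : 𝒢'.A x), lieMap hp x a = symbolMap θ' x a)
    (hMC : SatisfiesMaurerCartan θ θ') (g₁ : G') :
    ∃ U ∈ 𝓝 g₁, ∀ g ∈ U, ∀ g' ∈ U, 𝒢'.s g = 𝒢'.s g' →
      IsCompatibleAt hp θ θ' g → IsCompatibleAt hp θ θ' g' := by
  set e := trivializationAt F E (𝒢'.t g₁)
  have hg₁ : 𝒢'.t g₁ ∈ e.baseSet := mem_baseSet_trivializationAt _ _ _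
  obtain ⟨φ, ψ, L, hx, h⟩ := exists_linearizedBy 𝒢'.isSubmersion_s g₁
  have hφ := h.mem_dom
  have hnear : ∀ᶠ y in 𝓝 (φ g₁), y ∈ φ.target ∧ 𝒢'.t (φ.symm y) ∈ e.baseSet := by
    have h1 := φ.continuousAt_symm (φ.map_source hx)
    rw [ContinuousAt, φ.left_inv hx] at h1
    filter_upwards [φ.open_target.mem_nhds (φ.map_source hx),
      h1.eventually (eventually_t_mem e hg₁)] with y hy hy' using ⟨hy, hy'⟩
  -- A ball is convex, so segments between its points stay in the chart and over the trivialization.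
  obtain ⟨ε, hε, hball⟩ := Metric.eventually_nhds_iff_ball.1 hnear
  refine ⟨φ.source ∩ φ ⁻¹' Metric.ball (φ g₁) ε, Filter.inter_mem (φ.open_source.mem_nhds hx)
    ((φ.continuousAt hx).eventually (Metric.ball_mem_nhds _ hε)), ?_⟩
  rintro g ⟨hgs, hgb⟩ g' ⟨hgs', hgb'⟩ hss hc
  -- s is linear in this chart and agrees at g and g', so the segment from φ(g) to φ(g') lies in one
  -- source fibre.
  set Δ := φ g' - φ g
  have hLΔ : L Δ = 0 := by
    rw [map_sub, sub_eq_zero]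
    exact ((h.eq_iff hgs hgs').1 hss).symm
  let γ : ℝ → EG' := fun r => φ g + r • Δ
  have hγd : ∀ r, HasDerivAt γ Δ r := fun r => by
    exact (((hasDerivAt_id r).smul_const Δ).const_add (φ g)).congr_deriv (one_smul ℝ Δ)
  have hγ : ∀ r ∈ Icc (0 : ℝ) 1, γ r ∈ Metric.ball (φ g₁) ε := by
    intro r hr
    have := (convex_ball (φ g₁) ε).add_smul_sub_mem hgb hgb' hr
    exact this
  let ζ := chartForm (defectForm e θ θ' p) φ
  let S : EG' → F →L[ℝ] F := fun z => repDeriv e R (𝒢'.t (φ.symm z))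
      (θ' (φ.symm z) (tderiv EG' EG' φ.symm z Δ))
  have hvert : ∀ y, y ∈ φ.target → ζ y Δ = 0 := by
    intro y hy
    show defectForm e θ θ' p (φ.symm y) (tderiv EG' EG' φ.symm y Δ) = 0
    rw [hθ.defectForm_apply e hp, hθ'.horPart_vertical hLie
      (h.tderiv_symm_eq_zero hy (𝒢'.smoothAt_s _).diffAt hLΔ), map_zero]
  have hζd : ∀ y ∈ Metric.ball (φ g₁) ε, ContDiffAt ℝ ∞ ζ y := fun y hy =>
    contDiffAt_chartForm hφ (hball y hy).1 (smoothFormAt_defectForm e hp (hball y hy).2)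
  -- dζ(Δ, v) is D_Δ(ζ(v)) - D_v(ζ(Δ)), and ζ(Δ) = 0 identically. The Maurer–Cartan identity, with
  -- zero horizontal part of Δ, equates this to S ζ(v).
  have hode : ∀ y ∈ Metric.ball (φ g₁) ε, ∀ v, fderiv ℝ (fun z => ζ z v) y Δ = S y (ζ y v) := by
    intro y hy v
    obtain ⟨hyt, hye⟩ := hball y hy
    have h1 := extD_tderiv (f := φ.symm) (q := y) (smoothFormAt_defectForm (θ := θ) (θ' := θ') e hp hye)
      (smoothAt_symm_of_mem_maximalAtlas hφ hyt) Δ v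
    rw [hθ.extD_defectForm_of_maurerCartan e hs hp hMC hye, hθ'.horPart_vertical hLie
      (h.tderiv_symm_eq_zero hyt (𝒢'.smoothAt_s _).diffAt hLΔ)] at h1
    have h2 : extD (formCoord e θ) (p (φ.symm y)) 0
        (horPart θ' p (φ.symm y) (tderiv EG' EG' φ.symm y v)) = 0 := by simp [extD]
    have h3 : (fun k => defectForm e θ θ' p (φ.symm k) (tderiv EG' EG' φ.symm k Δ)) =ᶠ[𝓝 y]
        fun _ => 0 := by
      filter_upwards [φ.open_target.mem_nhds hyt] with z hz using hvert z hz
    have h4 : defectForm e θ θ' p (φ.symm y) (tderiv EG' EG' φ.symm y Δ) = 0 := hvert y hyt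
    rw [h2, h4, h3.fderiv_eq, map_zero, sub_zero, zero_add, fderiv_const_apply] at h1
    refine Eq.trans ?_ h1.symm
    simp [ζ, chartForm]
  have hSc : ContinuousOn (fun r => S (γ r)) (Icc 0 1) := by
    intro r hr
    obtain ⟨hyt, hye⟩ := hball _ (hγ r hr)
    have h1 : ContinuousAt S (γ r) := (smoothAt_repDeriv e hφ hyt hye Δ).continuousAt
    exact (ContinuousAt.comp (x := r) (f := γ) (g := S) h1
      (hγd r).continuousAt).continuousWithinAt
  obtain ⟨K, hK⟩ := isCompact_Icc.exists_bound_of_continuousOn hSc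
  have hder : ∀ v, ∀ r ∈ Icc (0 : ℝ) 1,
      HasDerivAt (fun r => ζ (γ r) v) (S (γ r) (ζ (γ r) v)) r := by
    intro v r hr
    have h1 : DifferentiableAt ℝ (fun z => ζ z v) (γ r) :=
      ((hζd _ (hγ r hr)).differentiableAt (by simp)).clm_apply (differentiableAt_const v)
    rw [← hode _ (hγ r hr)]
    exact h1.hasFDerivAt.comp_hasDerivAt r (hγd r)
  have hγ0 : γ 0 = φ g := by simp [γ]
  have hγ1 : γ 1 = φ g' := by simp [γ, Δ]
  have hte : ∀ k ∈ φ.source, φ k ∈ Metric.ball (φ g₁) ε → 𝒢'.t k ∈ e.baseSet := by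
    intro k hk hkb
    have := (hball _ hkb).2
    rwa [φ.left_inv hk] at this
  have hζ0 : ∀ v, ζ (γ 0) v = 0 := by
    intro v
    have h1 := (defectForm_eq_zero_iff e hp (hte g hgs hgb)).2 hc
    simp only [ζ, hγ0, chartForm, ContinuousLinearMap.comp_apply, φ.left_inv hgs, h1]
    rfl
  rw [← defectForm_eq_zero_iff e hp (hte g' hgs' hgb')]
  ext X
  -- Grönwall: f(0) = 0 and |f'| ≤ K|f| force f = 0. The constant vector is dφ(X) at g', so that the
  -- endpoint value is ζ(X) at g'.
  have h1 := eq_zero_of_abs_deriv_le_mul_abs_self_of_eq_zero_right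
    (f := fun r => ζ (γ r) (tderiv EG' EG' φ g' X)) (K := K) (a := 0) (b := 1)
    (fun r hr => (hder _ r hr).continuousAt.continuousWithinAt)
    (fun r hr => (hder _ r (Ico_subset_Icc_self hr)).hasDerivWithinAt) (hζ0 _)
    (fun r hr => ((S (γ r)).le_opNorm _).trans
      (mul_le_mul_of_nonneg_right (hK r (Ico_subset_Icc_self hr)) (norm_nonneg _)))
    1 (right_mem_Icc.2 zero_le_one)
  simp only [hγ1, ζ, chartForm, ContinuousLinearMap.comp_apply] at h1
  rw [tderiv_symm_tderiv hφ hgs', φ.left_inv hgs'] at h1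
  exact h1

/-- On a source-connected groupoid, the Maurer-Cartan equation implies `p^* θ = l θ'`. -/
theorem IsMultiplicative.isCompatibleAt_of_maurerCartan (hθ : IsMultiplicative R θ)
    (hs : ∀ g, Function.Surjective (θ g)) (hθ' : IsMultiplicative R' θ')
    (hLie : ∀ x (a : 𝒢'.A x), lieMap hp x a = symbolMap θ' x a)
    (hconn : ∀ x : M, IsConnected (𝒢'.s ⁻¹' {x}))
    (hMC : SatisfiesMaurerCartan θ θ') (g : G') : IsCompatibleAt hp θ θ' g := by
  -- Being compatible at a implies being compatible at b is a transitive relation that holds in both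
  -- directions between nearby points of a fibre; connectedness links 1_{s(g)} to g.
  refine ((hconn (𝒢'.s g)).isPreconnected.induction₂'
    (fun a b => IsCompatibleAt hp θ θ' a → IsCompatibleAt hp θ θ' b) ?_
    (fun a b c _ _ _ hab hbc ha => hbc (hab ha)) (x := 𝒢'.u (𝒢'.s g)) (y := g)
    (𝒢'.s_u _) rfl) (hθ.isCompatibleAt_u hθ' hLie _)
  intro a ha
  obtain ⟨U, hU, h⟩ := hθ.exists_nhds_isCompatibleAt hs hθ' hLie hMC a
  filter_upwards [mem_nhdsWithin_of_mem_nhds hU, self_mem_nhdsWithin] with b hb hbs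
  have hab : 𝒢'.s a = 𝒢'.s b := Eq.trans ha (Eq.symm hbs)
  exact ⟨h a (mem_of_mem_nhds hU) b hb hab, h b hb a (mem_of_mem_nhds hU) hab.symm⟩

end LieGroupoid

/-! ### From p^*θ = lθ' to the conditions of a Lie prolongation -/

namespace LieGroupoid

variable {EM M EG G EG' G' : Type*}
  [NormedAddCommGroup EM] [NormedSpace ℝ EM] [TopologicalSpace M] [ChartedSpace EM M]
  [NormedAddCommGroup EG] [NormedSpace ℝ EG] [TopologicalSpace G] [ChartedSpace EG G]
  [NormedAddCommGroup EG'] [NormedSpace ℝ EG'] [TopologicalSpace G'] [ChartedSpace EG' G']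
  {𝒢' : LieGroupoid EM M EG' G'} {𝒢 : LieGroupoid EM M EG G} {p : G' → G}
  [IsManifold 𝓘(ℝ, EM) ∞ M] [IsManifold 𝓘(ℝ, EG) ∞ G] [IsManifold 𝓘(ℝ, EG') ∞ G']
  [FiniteDimensional ℝ EM] [FiniteDimensional ℝ EG] [FiniteDimensional ℝ EG']
  {F : Type*} [NormedAddCommGroup F] [NormedSpace ℝ F] [FiniteDimensional ℝ F]
  {F : Type*} [NormedAddCommGroup F] [NormedSpace ℝ F] [FiniteDimensional ℝ F]
  {E : M → Type*} [∀ x, AddCommGroup (E x)] [∀ x, Module ℝ (E x)] [∀ x, TopologicalSpace (E x)]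
  [TopologicalSpace (TotalSpace F E)] [FiberBundle F E] [VectorBundle ℝ F E]
  [ContMDiffVectorBundle ∞ F E 𝓘(ℝ, EM)]
  (e : Trivialization F (π F E)) [MemTrivializationAtlas e]
  {R : Representation 𝒢 F E} {θ : OneForm 𝒢 F E}
  {R' : Representation 𝒢' (Fib EM EG) 𝒢.A} {θ' : OneForm 𝒢' (Fib EM EG) 𝒢.A}
  {hp : IsHom 𝒢' 𝒢 p}

/-- The map `l = θ|_A`, as a linear map on the fibres. -/
noncomputable def symbolLinearMap (θ : OneForm 𝒢 F E) (x : M) : 𝒢.A x →ₗ[ℝ] E x where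
  toFun := symbolMap θ x
  map_add' a b := by
    refine continuousLinearMapAt_injective (trivializationAt F E x)
      (mem_baseSet_trivializationAt _ _ _) ?_
    simp only [continuousLinearMapAt_symbolMap, map_add]
  map_smul' c a := by
    refine continuousLinearMapAt_injective (trivializationAt F E x)
      (mem_baseSet_trivializationAt _ _ _) ?_
    simp only [continuousLinearMapAt_symbolMap, map_smul, RingHom.id_apply]

theorem fiberCast_zero {B : Type*} {V : B → Type*} [∀ x, AddCommGroup (V x)] {x y : B}
    (h : x = y) : fiberCast V h 0 = 0 := by
  subst h; rfl

theorem fiberCast_eq_zero {B : Type*} {V : B → Type*} [∀ x, AddCommGroup (V x)] {x y : B}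
    (h : x = y) {v : V x} (hv : fiberCast V h v = 0) : v = 0 := by
  subst h; exact hv

theorem symbolMap_zero (x : M) : symbolMap θ x 0 = 0 :=
  map_zero (symbolLinearMap θ x)

theorem IsCompatibleAt.apply_eq_zero {g : G'} (h : IsCompatibleAt hp θ θ' g) {X : EG'}
    (hX : θ' g X = 0) : θ (p g) (tderiv EG' EG p g X) = 0 := by
  refine fiberCast_eq_zero (hp.t_map g) ((h X).trans ?_)
  exact (congrArg (symbolMap θ (𝒢'.t g)) hX).trans (symbolMap_zero _)

/-- The image under `l` of the curvature of `θ'`, in terms of the exterior derivative of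
`l θ'`. -/
theorem continuousLinearMapAt_symbolMap_partialDiff {g : G'} (hg : 𝒢'.t g ∈ e.baseSet)
    (hs : Function.Surjective (θ' g)) {X Y : EG'} (hX : θ' g X = 0) (hY : θ' g Y = 0) :
    e.continuousLinearMapAt ℝ (𝒢'.t g) (symbolMap θ (𝒢'.t g) (partialDiff θ' g X Y)) =
      -extD (symbolForm e θ θ') g X Y := by
  have hzero : ∀ {V : G' → EG'}, (∀ᶠ k in 𝓝 g, θ' k (V k) = 0) → ∀ Z : EG',
      tderiv EG' F (fun k => symbolForm e θ θ' k (V k)) g Z = 0 := by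
    intro V hV Z
    rw [tderiv_congr (g := fun _ => 0), tderiv_const]
    filter_upwards [hV] with k hk
    show formCoord e θ (𝒢.u (𝒢'.t k)) (𝒢.inclV (𝒢'.t k) (θ' k (V k))) = 0
    rw [← continuousLinearMapAt_symbolMap, hk, symbolMap_zero, map_zero]
  obtain ⟨V, hV, hV1, hV2, hV3⟩ := exists_extendInKer_eq hs hX
  obtain ⟨W, hW, hW1, hW2, hW3⟩ := exists_extendInKer_eq hs hY
  have h1 := extD_apply_fields (smoothFormAt_symbolForm (θ := θ) (θ' := θ') e hg) hV2 hW2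
  rw [hzero hV3, hzero hW3, sub_self, zero_sub, hV1, hW1] at h1
  have h2 : partialDiff θ' g X Y = θ' g (fieldBracket (EN := EG') V W g) := by subst hV hW; rfl
  rw [h1, neg_neg, h2, continuousLinearMapAt_symbolMap]
  rfl

theorem extD_defectForm_eq_zero (hcomp : ∀ g, IsCompatibleAt hp θ θ' g) {g : G'}
    (hg : 𝒢'.t g ∈ e.baseSet) (X Y : EG') : extD (defectForm e θ θ' p) g X Y = 0 := by
  rw [extD_congr (η' := fun _ => (0 : EG' →L[ℝ] F))
    ((eventually_t_mem e hg).mono fun k hk => (defectForm_eq_zero_iff e hp hk).2 (hcomp k))]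
  exact extD_zero g X Y

/-- With ζ = 0 near g the main identity reduces to dθ(hX, hY) = 0, and hX = dp(X) on ker θ'. -/
theorem extD_formCoord_tderiv_eq_zero (hθ : IsPfaffian R θ) (hMC : SatisfiesMaurerCartan θ θ')
    (hcomp : ∀ g, IsCompatibleAt hp θ θ' g) {g : G'} (hg : 𝒢'.t g ∈ e.baseSet) {X Y : EG'}
    (hX : θ' g X = 0) (hY : θ' g Y = 0) :
    extD (formCoord e θ) (p g) (tderiv EG' EG p g X) (tderiv EG' EG p g Y) = 0 := by
  have h1 := hθ.isMultiplicative.extD_defectForm_of_maurerCartan e hθ.surjective hp hMC hg X Y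
  rw [extD_defectForm_eq_zero e hcomp hg, (defectForm_eq_zero_iff e hp hg).2 (hcomp g),
    horPart_of_ker hX, horPart_of_ker hY] at h1
  simpa using h1.symm

theorem partialDiff_tderiv_eq_zero (hθ : IsPfaffian R θ) (hMC : SatisfiesMaurerCartan θ θ')
    (hcomp : ∀ g, IsCompatibleAt hp θ θ' g) {g : G'} {X Y : EG'}
    (hX : θ' g X = 0) (hY : θ' g Y = 0) :
    partialDiff θ (p g) (tderiv EG' EG p g X) (tderiv EG' EG p g Y) = 0 := by
  have hg : 𝒢'.t g ∈ (trivializationAt F E (𝒢'.t g)).baseSet := mem_baseSet_trivializationAt _ _ _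
  have hpg : 𝒢.t (p g) ∈ (trivializationAt F E (𝒢'.t g)).baseSet := by rwa [hp.t_map]
  refine continuousLinearMapAt_injective _ hpg ?_
  rw [continuousLinearMapAt_partialDiff _ hpg (hθ.surjective _) ((hcomp g).apply_eq_zero hX)
    ((hcomp g).apply_eq_zero hY), extD_formCoord_tderiv_eq_zero _ hθ hMC hcomp hg hX hY, neg_zero,
    map_zero]

/-- On ker θ', l(δθ') = -d(lθ'). As dζ = 0, d(lθ')(X,Y) equals dθ(dp X, dp Y), which vanishes. -/
theorem symbolMap_partialDiff_eq_zero (hθ : IsPfaffian R θ)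
    (hs : ∀ g, Function.Surjective (θ' g)) (hMC : SatisfiesMaurerCartan θ θ')
    (hcomp : ∀ g, IsCompatibleAt hp θ θ' g) {g : G'} {X Y : EG'}
    (hX : θ' g X = 0) (hY : θ' g Y = 0) :
    symbolMap θ (𝒢'.t g) (partialDiff θ' g X Y) = 0 := by
  set e := trivializationAt F E (𝒢'.t g)
  have hg : 𝒢'.t g ∈ e.baseSet := mem_baseSet_trivializationAt _ _ _
  refine continuousLinearMapAt_injective e hg ?_
  have h1 := extD_defectForm (θ := θ) (θ' := θ') e hp hg X Y
  rw [extD_defectForm_eq_zero e hcomp hg, extD_formCoord_tderiv_eq_zero e hθ hMC hcomp hg hX hY,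
    zero_sub] at h1
  rw [continuousLinearMapAt_symbolMap_partialDiff e hg (hs g) hX hY, ← h1, map_zero]

/-- On a source-connected groupoid, a solution of the Maurer-Cartan equation defines a Lie
prolongation. -/
theorem isLieProlongation_of_maurerCartan (hθ : IsPfaffian R θ)
    (hsub : IsSubmersion 𝓘(ℝ, EG') 𝓘(ℝ, EG) ∞ p) (hsurj : Function.Surjective p)
    (hθ' : IsMultiplicative R' θ') (hLie : ∀ x (a : 𝒢'.A x), lieMap hp x a = symbolMap θ' x a)
    (hconn : ∀ x : M, IsConnected (𝒢'.s ⁻¹' {x})) (hMC : SatisfiesMaurerCartan θ θ') :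
    IsLieProlongation R' θ' R θ hp := by
  have hP : IsPfaffian R' θ' := hθ'.isPfaffian hLie hsub
  have hcomp : ∀ g, IsCompatibleAt hp θ θ' g :=
    hθ.isMultiplicative.isCompatibleAt_of_maurerCartan hθ.surjective hθ' hLie hconn hMC
  have hcurv : ∀ (g : G') (X Y : TangentSpace 𝓘(ℝ, EG') g), θ' g X = 0 → θ' g Y = 0 →
      partialDiff θ (p g) (mfderiv 𝓘(ℝ, EG') 𝓘(ℝ, EG) p g X)
        (mfderiv 𝓘(ℝ, EG') 𝓘(ℝ, EG) p g Y) = 0 :=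
    fun g X Y hX hY => partialDiff_tderiv_eq_zero hθ hMC hcomp hX hY
  exact
    { isPfaffian' := hP
      isPfaffian := hθ
      isPfaffianMorphism :=
        { map_ker := fun g X hX => (hcomp g).apply_eq_zero hX
          -- Since Lie(p) = θ'|_{A'}, the map p₀ is l itself; both sides of the curvature condition
          -- are zero.
          exists_map := ⟨symbolLinearMap θ, fun x a => congrArg (symbolMap θ x) (hLie x a).symm,
            fun g X Y hX hY => by
              rw [hcurv g X Y hX hY, fiberCast_zero]
              exact symbolMap_partialDiff_eq_zero hθ hP.surjective hMC hcomp hX hY⟩ }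
      surjective := hsurj
      isSubmersion := hsub
      map_ker_s := fun g X hX hs => (hθ'.tderiv_eq_zero_iff hLie).2 ⟨hX, hs⟩
      partialDiff_map := hcurv
      exists_equiv := ⟨fun x => LinearEquiv.refl ℝ (𝒢.A x), contMDiff_id,
        fun x a => (hLie x a).symm⟩ }

end LieGroupoid

theorem theorem4
    {EM M EG G EG' G' : Type*}
    [NormedAddCommGroup EM] [NormedSpace ℝ EM] [FiniteDimensional ℝ EM]
    [TopologicalSpace M] [ChartedSpace EM M] [IsManifold 𝓘(ℝ, EM) ∞ M]
    [NormedAddCommGroup EG] [NormedSpace ℝ EG] [FiniteDimensional ℝ EG]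
    [TopologicalSpace G] [ChartedSpace EG G] [IsManifold 𝓘(ℝ, EG) ∞ G]
    [NormedAddCommGroup EG'] [NormedSpace ℝ EG'] [FiniteDimensional ℝ EG']
    [TopologicalSpace G'] [ChartedSpace EG' G'] [IsManifold 𝓘(ℝ, EG') ∞ G']
    -- a Pfaffian groupoid `(G, θ)` with coefficients in a representation `E`
    (𝒢 : LieGroupoid EM M EG G)
    {F : Type*} [NormedAddCommGroup F] [NormedSpace ℝ F] [FiniteDimensional ℝ F]
    {E : M → Type*} [∀ x, AddCommGroup (E x)] [∀ x, Module ℝ (E x)] [∀ x, TopologicalSpace (E x)]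
    [TopologicalSpace (TotalSpace F E)] [FiberBundle F E] [VectorBundle ℝ F E]
    [ContMDiffVectorBundle ∞ F E 𝓘(ℝ, EM)]
    (R : LieGroupoid.Representation 𝒢 F E) (θ : LieGroupoid.OneForm 𝒢 F E)
    (hθ : LieGroupoid.IsPfaffian R θ)
    -- a morphism `p : G' → G` which is a surjective submersion
    (𝒢' : LieGroupoid EM M EG' G') {p : G' → G} (hp : LieGroupoid.IsHom 𝒢' 𝒢 p)
    (hsub : IsSubmersion 𝓘(ℝ, EG') 𝓘(ℝ, EG) ∞ p) (hsurj : Function.Surjective p)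
    -- a multiplicative form `θ' ∈ Ω¹(G', t^* A)` with `Lie (p) = θ'|_{A'}`
    (R' : LieGroupoid.Representation 𝒢' (LieGroupoid.Fib EM EG) 𝒢.A)
    (θ' : LieGroupoid.OneForm 𝒢' (LieGroupoid.Fib EM EG) 𝒢.A)
    (hθ' : LieGroupoid.IsMultiplicative R' θ')
    (hLie : ∀ x (a : 𝒢'.A x), LieGroupoid.lieMap hp x a = LieGroupoid.symbolMap θ' x a) :
    (LieGroupoid.IsLieProlongation R' θ' R θ hp → LieGroupoid.SatisfiesMaurerCartan θ θ') ∧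
    ((∀ x : M, IsConnected (𝒢'.s ⁻¹' {x})) →
      LieGroupoid.SatisfiesMaurerCartan θ θ' → LieGroupoid.IsLieProlongation R' θ' R θ hp) := by
  exact ⟨LieGroupoid.IsLieProlongation.satisfiesMaurerCartan hLie,
    LieGroupoid.isLieProlongation_of_maurerCartan hθ hsub hsurj hθ' hLie⟩
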